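/- Let $G$ be a finite group and $k$ a field of characteristic zero. The quantum codouble $D^*(G)=kG\blacktriangleright\!\!< k(G)$ is the Hopf algebra with basis $s\otimes\delta_u$ ($s,u\in G$), with the tensor product algebra structure of $kG\otimes k(G)$ and $$\Delta(s\otimes\delta_u)=\sum_{v\in G}(s\otimes\delta_v)\otimes(v^{-1}sv\otimes\delta_{v^{-1}u}),\quad \epsilon(s\otimes\delta_u)=\delta_{u,1},\quad S(s\otimes\delta_u)=u^{-1}s^{-1}u\otimes\delta_{u^{-1}}.$$ A bicovariant calculus on a Hopf algebra $A$ is an $A$-bimodule $\Omega^1$ with a derivation $\mathrm d:A\to\Omega^1$ such that the elements $a\,\mathrm db$ span $\Omega^1$, which is an $A$-bicomodule whose coactions $\Delta_L,\Delta_R$ are bimodule maps, and for which $\mathrm d$ is a bicomodule map. Isomorphisms of calculi are the bijective bimodule maps commuting with $\mathrm d$. The calculus is coirreducible if $\Omega^1\neq0$ and it has no proper nonzero quotient calculus. Its dimension is that of the space of right-invariant 1-forms $\{\omega:\Delta_R\omega=\omega\otimes1\}$. Fix a point $s_{\mathcal C}$ in each conjugacy class $\mathcal C$ of $G$. Consider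 pairs $(\mathcal C,V)$ where $\mathcal C$ is a conjugacy class and $V$ is an irreducible $k$-representation of the centralizer $G_0$ of $s_{\mathcal C}$, with at least one of $\mathcal C,V$ nontrivial (that is, $\mathcal C\ne\{1\}$ or $V$ is not the trivial representation). Pairs are identified if their classes agree and their representations are isomorphic. Let $W=\{f:G\to V\mid f(gh)=g\cdot f(h)\ \ \forall g\in G_0,\ h\in G\}$ be the associated representation of the quantum double $D(G)=k(G)\rtimes kG$, where $(\rho(\delta_s\otimes u)f)(h)$ is $f(hu)$ if $h^{-1}s_{\mathcal C}h=s$ and $0$ otherwise. Let $\mathcal Q_2:D^*(G)\to D(G)$ be the quantum Killing form, $\mathcal Q_2(s\otimes\delta_u)=\delta_{sus^{-1}}\otimes s$. A bicovariant calculus on $D^*(G)$ is attached to $(\mathcal C,V)$ if its Maurer–Cartan form $\varpi(a)=\sum \mathrm d(a_{(1)})\,S(a_{(2)})$ satisfies, for all $a\in D^*(G)$, $$\varpi(a)=0\iff \rho(\mathcal Q_2(a))=\epsilon(a)\,\mathrm{id}_W.$$ **Theorem 5.1.** This relation is a one-to-one correspondence between coirreducible bicovariant differential calculi on $D^*(G)$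 up to isomorphism and pairs $(\mathcal C,V)$ up to isomorphism: to every pair a coirreducible calculus is attached, every coirreducible bicovariant calculus is attached to some pair, and calculi attached to two pairs are isomorphic if and only if the pairs are isomorphic. For the calculus attached to $(\mathcal C,V)$ the spaces of left-invariant and of right-invariant 1-forms have the same dimension $n$, and $$n\cdot\dim_k \mathrm{End}_{G_0}(V)=|\mathcal C|^2\dim(V)^2 .$$ In particular the dimension of the calculus is $n=|\mathcal C|^2\dim(V)^2$ whenever $\mathrm{End}_{G_0}(V)=k$, and so for all pairs if $k$ is algebraically closed. -/

import Mathlib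

open scoped TensorProduct

universe u v

/-! ### First order bicovariant differential calculi on a Hopf algebra -/

/-- A bicovariant first order differential calculus `(Ω¹, d)` on a Hopf algebra `A` over `k`:
an `A`-bimodule `Form` (left action `lmul a ω = a·ω`, right action `rmul ω a = ω·a`) with a
derivation `d : A → Form` such that the elements `a·d b` span `Form`, which is an `A`-bicomodule
under coactions that are bimodule maps, and for which `d` is a bicomodule map.
Since `Form` is a quotient of `A ⊗ A`, it may be taken in the universe of `A`. -/
structure BicovariantCalculus (k : Type u) (A : Type v) [Field k] [Ring A] [HopfAlgebra k A] where
  Form : Type v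
  [addCommGroup : AddCommGroup Form]
  [module : Module k Form]
  lmul : A →ₗ[k] Form →ₗ[k] Form
  rmul : Form →ₗ[k] A →ₗ[k] Form
  one_lmul : ∀ ω, lmul 1 ω = ω
  mul_lmul : ∀ a b ω, lmul (a * b) ω = lmul a (lmul b ω)
  rmul_one : ∀ ω, rmul ω 1 = ω
  rmul_mul : ∀ ω a b, rmul ω (a * b) = rmul (rmul ω a) b
  lmul_rmul : ∀ a ω b, rmul (lmul a ω) b = lmul a (rmul ω b)
  d : A →ₗ[k] Form
  leibniz : ∀ a b, d (a * b) = rmul (d a) b + lmul a (d b)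
  span_eq_top : Submodule.span k {ω | ∃ a b, ω = lmul a (d b)} = ⊤
  /-- the left coaction `Δ_L` -/
  coactL : Form →ₗ[k] A ⊗[k] Form
  /-- the right coaction `Δ_R` -/
  coactR : Form →ₗ[k] Form ⊗[k] A
  coactL_coassoc : (TensorProduct.assoc k A A Form).toLinearMap ∘ₗ
      (Coalgebra.comul (R := k) (A := A)).rTensor Form ∘ₗ coactL = coactL.lTensor A ∘ₗ coactL
  coactL_counit : (Coalgebra.counit (R := k) (A := A)).rTensor Form ∘ₗ coactL =
      TensorProduct.mk k k Form 1
  coactR_coassoc : (TensorProduct.assoc k Form A A).toLinearMap ∘ₗ coactR.rTensor A ∘ₗ coactR =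
      (Coalgebra.comul (R := k) (A := A)).lTensor Form ∘ₗ coactR
  coactR_counit : (Coalgebra.counit (R := k) (A := A)).lTensor Form ∘ₗ coactR =
      (TensorProduct.mk k Form k).flip 1
  coactL_coactR : (TensorProduct.assoc k A Form A).toLinearMap ∘ₗ coactL.rTensor A ∘ₗ coactR =
      coactR.lTensor A ∘ₗ coactL
  coactL_lmul : ∀ a ω, coactL (lmul a ω) =
      TensorProduct.map₂ (LinearMap.mul k A) lmul (Coalgebra.comul a) (coactL ω)
  coactL_rmul : ∀ ω a, coactL (rmul ω a) =
      TensorProduct.map₂ (LinearMap.mul k A) rmul (coactL ω) (Coalgebra.comul a)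
  coactR_lmul : ∀ a ω, coactR (lmul a ω) =
      TensorProduct.map₂ lmul (LinearMap.mul k A) (Coalgebra.comul a) (coactR ω)
  coactR_rmul : ∀ ω a, coactR (rmul ω a) =
      TensorProduct.map₂ rmul (LinearMap.mul k A) (coactR ω) (Coalgebra.comul a)
  coactL_d : coactL ∘ₗ d = d.lTensor A ∘ₗ Coalgebra.comul
  coactR_d : coactR ∘ₗ d = d.rTensor A ∘ₗ Coalgebra.comul

namespace BicovariantCalculus

attribute [instance] BicovariantCalculus.addCommGroup BicovariantCalculus.module

variable {k : Type u} {A : Type v} [Field k] [Ring A] [HopfAlgebra k A]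

/-- Morphisms of calculi: bimodule maps commuting with `d`. Such a map is unique if it exists,
surjective, and automatically compatible with the coactions, as these are determined by `d`. So
a morphism exhibits `Ω'` as a quotient calculus of `Ω`. -/
structure Hom (Ω Ω' : BicovariantCalculus k A) where
  toLinearMap : Ω.Form →ₗ[k] Ω'.Form
  map_lmul : ∀ a ω, toLinearMap (Ω.lmul a ω) = Ω'.lmul a (toLinearMap ω)
  map_rmul : ∀ ω a, toLinearMap (Ω.rmul ω a) = Ω'.rmul (toLinearMap ω) a
  map_d : ∀ a, toLinearMap (Ω.d a) = Ω'.d a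

/-- Isomorphism of calculi. -/
def Isomorphic (Ω Ω' : BicovariantCalculus k A) : Prop :=
  ∃ f : Hom Ω Ω', Function.Bijective f.toLinearMap

/-- A calculus is coirreducible if it is nonzero and has no proper nonzero quotient calculus. -/
def Coirreducible (Ω : BicovariantCalculus k A) : Prop :=
  Nontrivial Ω.Form ∧
    ∀ (Ω' : BicovariantCalculus k A) (f : Hom Ω Ω'),
      Subsingleton Ω'.Form ∨ Function.Bijective f.toLinearMap

/-- The space of right-invariant 1-forms: those `ω` with `Δ_R ω = ω ⊗ 1`. -/
def rightInvariant (Ω : BicovariantCalculus k A) : Submodule k Ω.Form :=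
  LinearMap.eqLocus Ω.coactR ((TensorProduct.mk k Ω.Form A).flip 1)

/-- The space of left-invariant 1-forms: those `ω` with `Δ_L ω = 1 ⊗ ω`. -/
def leftInvariant (Ω : BicovariantCalculus k A) : Submodule k Ω.Form :=
  LinearMap.eqLocus Ω.coactL (TensorProduct.mk k A Ω.Form 1)

/-- The right-invariant Maurer-Cartan form `a ↦ ∑ d(a₍₁₎)·S(a₍₂₎)`. -/
noncomputable def maurerCartan (Ω : BicovariantCalculus k A) : A →ₗ[k] Ω.Form :=
  TensorProduct.lift (Ω.rmul.compl₁₂ Ω.d (HopfAlgebra.antipode k)) ∘ₗ Coalgebra.comul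

end BicovariantCalculus

/-! ### The quantum codouble `D^*(G)` -/

/-- The quantum codouble `D^*(G) = kG ⊗ k(G)` of a finite group. As an algebra it is the tensor
product `kG ⊗ k(G)`, that is, the algebra of functions on `G` with values in `kG` under pointwise
operations; `s ⊗ δ_u` is the function with value `s` at `u` and `0` elsewhere. -/
def Codouble (k : Type u) (G : Type v) [Field k] [Group G] : Type (max u v) :=
  G → MonoidAlgebra k G

namespace Codouble

variable {k : Type u} {G : Type v} [Field k] [Group G]

noncomputable instance : Ring (Codouble k G) :=
  inferInstanceAs (Ring (G → MonoidAlgebra k G))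

noncomputable instance : Algebra k (Codouble k G) :=
  inferInstanceAs (Algebra k (G → MonoidAlgebra k G))

/-- The coefficient of `s ⊗ δ_u`. -/
noncomputable def coeff (s u : G) : Codouble k G →ₗ[k] k where
  toFun a := (a u).coeff s
  map_add' _ _ := by rfl
  map_smul' _ _ := by rfl

@[ext]
theorem ext {a b : Codouble k G} (h : ∀ s u, coeff s u a = coeff s u b) : a = b := by
  funext u
  exact MonoidAlgebra.coeff_injective (Finsupp.ext fun s => h s u)

variable [DecidableEq G]

/-- The basis element `s ⊗ δ_u`. -/
noncomputable def basis (s u : G) : Codouble k G :=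
  Pi.single u (MonoidAlgebra.single s 1)

theorem coeff_basis (s u t v : G) :
    coeff (k := k) s u (basis t v) = if t = s ∧ v = u then 1 else 0 := by
  change ((Pi.single v (MonoidAlgebra.single t (1 : k)) : G → MonoidAlgebra k G) u).coeff s = _
  by_cases h : v = u
  · subst h
    simp [Finsupp.single_apply]
  · simp [h, Ne.symm h]

theorem basis_mul (s u t v : G) :
    (basis s u * basis t v : Codouble k G) = if u = v then basis (s * t) u else 0 := by
  funext w
  change (basis s u : Codouble k G) w * (basis t v : Codouble k G) w = _
  split_ifs with h
  · subst h
    by_cases hw : w = u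
    · subst hw; simp [basis]
    · simp [basis, hw]
  · by_cases hw : w = u
    · subst hw
      have : (basis t v : Codouble k G) w = 0 := by simp [basis, h]
      rw [this, mul_zero]; rfl
    · have : (basis s u : Codouble k G) w = 0 := by simp [basis, hw]
      rw [this, zero_mul]; rfl

variable [Fintype G]

theorem one_eq : (1 : Codouble k G) = ∑ u, basis 1 u := by
  ext s w
  rw [map_sum]
  simp only [coeff_basis]
  change ((1 : MonoidAlgebra k G)).coeff s = _
  rw [MonoidAlgebra.one_def, MonoidAlgebra.coeff_single, Finsupp.single_apply]
  by_cases h : 1 = s <;> simp [h]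

/-- The linear map with prescribed values on the basis `s ⊗ δ_u`. -/
noncomputable def lift {M : Type*} [AddCommGroup M] [Module k M] (x : G → G → M) :
    Codouble k G →ₗ[k] M :=
  ∑ s, ∑ u, (coeff s u).smulRight (x s u)

theorem lift_basis {M : Type*} [AddCommGroup M] [Module k M] (x : G → G → M) (s u : G) :
    lift x (basis s u : Codouble k G) = x s u := by
  simp only [lift, LinearMap.sum_apply, LinearMap.smulRight_apply, coeff_basis, ite_and, ite_smul,
    one_smul, zero_smul]
  simp

theorem eq_sum (a : Codouble k G) : a = ∑ s, ∑ u, coeff s u a • basis s u := by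
  ext t v
  simp only [map_sum, map_smul, coeff_basis, smul_eq_mul, ite_and]
  simp

theorem hom_ext {M : Type*} [AddCommGroup M] [Module k M] {f g : Codouble k G →ₗ[k] M}
    (h : ∀ s u, f (basis s u) = g (basis s u)) : f = g := by
  ext a
  rw [eq_sum a]
  simp only [map_sum, map_smul, h]

/-- The coproduct `Δ(s ⊗ δ_u) = ∑_{vw = u} (s ⊗ δ_v) ⊗ (v⁻¹sv ⊗ δ_w)`, i.e. `s` and `δ_u`
have the coproducts `∑_v s δ_v ⊗ v⁻¹sv` and `∑_{vw = u} δ_v ⊗ δ_w`;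
the counit is `ε(s ⊗ δ_u) = δ_{u,1}`. -/
noncomputable instance : CoalgebraStruct k (Codouble k G) where
  comul := lift fun s u => ∑ v, basis s v ⊗ₜ[k] basis (v⁻¹ * s * v) (v⁻¹ * u)
  counit := lift fun _ u => if u = 1 then 1 else 0

theorem comul_basis (s u : G) : Coalgebra.comul (R := k) (basis s u : Codouble k G) =
    ∑ v, basis s v ⊗ₜ[k] basis (v⁻¹ * s * v) (v⁻¹ * u) :=
  lift_basis _ s u

theorem counit_basis (s u : G) :
    Coalgebra.counit (R := k) (basis s u : Codouble k G) = if u = 1 then 1 else 0 :=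
  lift_basis _ s u

noncomputable instance : Coalgebra k (Codouble k G) where
  coassoc := by
    refine hom_ext fun s u => ?_
    simp only [LinearMap.comp_apply, comul_basis, map_sum, LinearMap.rTensor_tmul,
      LinearMap.lTensor_tmul, TensorProduct.sum_tmul, TensorProduct.tmul_sum,
      LinearEquiv.coe_coe, TensorProduct.assoc_tmul]
    rw [Finset.sum_comm]
    refine Finset.sum_congr rfl fun v _ => ?_
    refine Fintype.sum_equiv (Equiv.mulLeft v⁻¹) _ _ fun w => ?_
    simp [mul_assoc]
  rTensor_counit_comp_comul := by
    refine hom_ext fun s u => ?_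
    simp [comul_basis, counit_basis, TensorProduct.ite_tmul]
  lTensor_counit_comp_comul := by
    refine hom_ext fun s u => ?_
    simp [comul_basis, counit_basis, TensorProduct.tmul_ite, inv_mul_eq_one]

noncomputable instance : Bialgebra k (Codouble k G) where
  counit_one := by
    simp [one_eq, counit_basis]
  mul_compr₂_counit := by
    refine hom_ext fun s u => hom_ext fun t v => ?_
    simp only [LinearMap.compr₂_apply, LinearMap.mul_apply', LinearMap.compl₁₂_apply, basis_mul,
      counit_basis]
    by_cases h : u = v
    · subst h; simp [counit_basis]
    · by_cases hu : u = 1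
      · subst hu; simp [h, Ne.symm h]
      · simp [h, hu]
  comul_one := by
    simp only [one_eq, map_sum, comul_basis, Algebra.TensorProduct.one_def,
      TensorProduct.sum_tmul, TensorProduct.tmul_sum]
    rw [Finset.sum_comm]
    conv_rhs => rw [Finset.sum_comm]
    refine Finset.sum_congr rfl fun v _ => ?_
    refine Fintype.sum_equiv (Equiv.mulLeft v⁻¹) _ _ fun w => ?_
    simp
  mul_compr₂_comul := by
    refine hom_ext fun s u => hom_ext fun t v => ?_
    simp only [LinearMap.compr₂_apply, LinearMap.mul_apply', LinearMap.compl₁₂_apply, basis_mul,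
      comul_basis, Finset.sum_mul_sum, Algebra.TensorProduct.tmul_mul_tmul]
    by_cases h : u = v
    · subst h
      rw [if_pos rfl, comul_basis]
      refine Finset.sum_congr rfl fun w _ => ?_
      simp [TensorProduct.ite_tmul, mul_assoc]
    · rw [if_neg h, map_zero]
      refine (Finset.sum_eq_zero fun w _ => Finset.sum_eq_zero fun x _ => ?_).symm
      by_cases hw : w = x
      · subst hw; simp [h]
      · simp [hw]

/-- The antipode is `S(s ⊗ δ_u) = u⁻¹s⁻¹u ⊗ δ_{u⁻¹}`. -/
noncomputable instance : HopfAlgebra k (Codouble k G) where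
  antipode := lift fun s u => basis (u⁻¹ * s⁻¹ * u) u⁻¹
  mul_antipode_rTensor_comul := by
    refine hom_ext fun s u => ?_
    simp only [LinearMap.comp_apply, comul_basis, map_sum, LinearMap.rTensor_tmul, lift_basis,
      LinearMap.mul'_apply, basis_mul, counit_basis, Algebra.linearMap_apply]
    by_cases h : u = 1
    · subst h
      simp only [mul_one, if_true, map_one, one_eq]
      refine Fintype.sum_equiv (Equiv.inv G) _ _ fun w => ?_
      simp [mul_assoc]
    · simp [h]
  mul_antipode_lTensor_comul := by
    refine hom_ext fun s u => ?_
    simp only [LinearMap.comp_apply, comul_basis, map_sum, LinearMap.lTensor_tmul, lift_basis,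
      LinearMap.mul'_apply, basis_mul, counit_basis, Algebra.linearMap_apply]
    by_cases h : u = 1
    · subst h
      simp [one_eq, mul_assoc]
    · have h' : ∀ x : G, x ≠ u⁻¹ * x := fun x hx => h (by simpa using hx)
      simp [h, h']

end Codouble

/-! ### Pairs `(C, V)` and the associated representations of the double `D(G)` -/

section Pairs

variable {k : Type u} {G : Type v} [Field k] [Group G]

/-- A pair `(C, V)`: a conjugacy class `C` of `G` and an irreducible representation `V` over `k`
of the centralizer of the chosen point of `C`, with `C ≠ {1}` or `V` nontrivial. -/
structure CentralizerPair (k : Type u) {G : Type v} [Field k] [Group G]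
    (base : ConjClasses G → G) where
  cls : ConjClasses G
  V : Type u
  [addCommGroup : AddCommGroup V]
  [module : Module k V]
  rep : Representation k (Subgroup.centralizer {base cls}) V
  irreducible : rep.IsIrreducible
  nontrivial : cls ≠ ConjClasses.mk 1 ∨ ¬ rep.IsTrivial

attribute [instance] CentralizerPair.addCommGroup CentralizerPair.module

/-- Two pairs are identified if they have the same class and isomorphic representations. -/
def CentralizerPair.Isomorphic {base : ConjClasses G → G} (P Q : CentralizerPair k base) : Prop :=
  P.cls = Q.cls ∧ ∃ e : P.V ≃ₗ[k] Q.V,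
    ∀ (g : G) (hP : g ∈ Subgroup.centralizer {base P.cls})
      (hQ : g ∈ Subgroup.centralizer {base Q.cls}) (x : P.V),
        e (P.rep ⟨g, hP⟩ x) = Q.rep ⟨g, hQ⟩ (e x)

namespace DoubleRep

variable {s₀ : G} {V : Type u} [AddCommGroup V] [Module k V]
  (π : Representation k (Subgroup.centralizer {s₀}) V)

/-- The space of the representation `W` of the quantum double `D(G) = k(G) ⋊ kG` given by a point
`s₀` and a representation `V` of its centralizer `G₀`: the representation of `G` induced from `V`,
realized on the functions `f : G → V` with `f (g h) = g·f(h)` for `g ∈ G₀`. It is graded by the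
conjugacy class of `s₀`: functions supported on the coset `G₀h` have degree `h⁻¹s₀h`. -/
abbrev Space : Submodule k (G → V) :=
  Representation.coindV (Subgroup.centralizer {s₀}).subtype π

variable [DecidableEq G]

/-- The action of `δ_s ∈ k(G)` on `W`: the projection to the component of degree `s`. -/
def proj (s : G) : Module.End k (Space π) where
  toFun f := ⟨fun h => if h⁻¹ * s₀ * h = s then f.1 h else 0, by
    intro g h
    have hg : s₀ * (g : G) = (g : G) * s₀ := Subgroup.mem_centralizer_iff.1 g.2 s₀ rfl
    have : ((g : G) * h)⁻¹ * s₀ * ((g : G) * h) = h⁻¹ * s₀ * h := by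
      calc _ = h⁻¹ * (g : G)⁻¹ * (s₀ * (g : G)) * h := by group
        _ = _ := by rw [hg]; group
    have hf := f.2 g h
    change (if ((g : G) * h)⁻¹ * s₀ * ((g : G) * h) = s then f.1 ((g : G) * h) else 0) =
      π g (if h⁻¹ * s₀ * h = s then f.1 h else 0)
    simp only [Subgroup.coe_subtype] at hf
    simp only [this, hf]
    split_ifs <;> simp⟩
  map_add' f f' := by
    ext h; simp only [Submodule.coe_add, Pi.add_apply]; split_ifs <;> simp
  map_smul' c f := by
    ext h
    simp only [Submodule.coe_smul, Pi.smul_apply, RingHom.id_apply]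
    split_ifs <;> simp

/-- The action `ρ(δ_s ⊗ u)` of the basis element `δ_s ⊗ u` of `D(G)` on `W`. -/
noncomputable def act (s u : G) : Module.End k (Space π) :=
  proj π s * Representation.coind (Subgroup.centralizer {s₀}).subtype π u

/-- The product of `D(G)` is respected:
`(δ_s ⊗ u)(δ_t ⊗ v) = δ_{s, u t u⁻¹} δ_s ⊗ uv`. -/
theorem act_mul (s u t v : G) :
    act π s u * act π t v = if s = u * t * u⁻¹ then act π s (u * v) else 0 := by
  ext f h
  have key : (h * u)⁻¹ * s₀ * (h * u) = t ↔ h⁻¹ * s₀ * h = u * t * u⁻¹ := by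
    constructor
    · rintro rfl; group
    · intro e
      calc _ = u⁻¹ * (h⁻¹ * s₀ * h) * u := by group
        _ = t := by rw [e]; group
  have h0 : ∀ a b x : G, ∀ f' : Space π, (act π a b f').1 x =
      if x⁻¹ * s₀ * x = a then f'.1 (x * b) else 0 := fun _ _ _ _ => rfl
  rw [Module.End.mul_apply, h0, h0]
  by_cases hs : s = u * t * u⁻¹
  · rw [if_pos hs, h0, mul_assoc h u v]
    split_ifs with h1 h2 <;> first | rfl | exact absurd (key.2 (h1.trans hs)) h2
  · rw [if_neg hs]
    change _ = (0 : V)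
    split_ifs with h1 h2
    · exact absurd (h1.symm.trans (key.1 h2)) hs
    · rfl
    · rfl

/-- The map `a ↦ ρ(𝒬₂(a))` from `D^*(G)` to `End(W)`, where
`𝒬 = ℛ₂₁ℛ = ∑_{s,u} (δ_{sus⁻¹} ⊗ s) ⊗ (δ_s ⊗ u)` is the quantum Killing form of `D(G)` and
`𝒬₂(a) = (id ⊗ a)(𝒬)`, so that `𝒬₂(s ⊗ δ_u) = δ_{sus⁻¹} ⊗ s`. -/
noncomputable def killing [Fintype G] : Codouble k G →ₗ[k] Module.End k (Space π) :=
  Codouble.lift fun s u => act π (s * u * s⁻¹) s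

end DoubleRep

/-- The calculus `Ω` is the one attached to the pair `(C, V)` with associated representation
`(ρ, W)` of `D(G)`: up to an injective linear identification of right-invariant forms with
endomorphisms of `W`, its Maurer-Cartan form is `a ↦ ρ(𝒬₂(a)) - ε(a) id`. Equivalently
`d a = ∑ ρ(𝒬₂(a₍₁₎)) a₍₂₎ - θ a` with `θ = id ∈ End(W)`. -/
def BicovariantCalculus.AttachedTo [Fintype G] [DecidableEq G] {base : ConjClasses G → G}
    (Ω : BicovariantCalculus k (Codouble k G)) (P : CentralizerPair k base) : Prop :=
  ∀ a : Codouble k G, Ω.maurerCartan a = 0 ↔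
    DoubleRep.killing P.rep a = (Coalgebra.counit a : k) • 1

end Pairs

-- The calculus is encoded in the kernel of its Maurer–Cartan form, this kernel becomes a two-sided
-- ideal of the double, and such ideals are studied through simple modules.
--
-- Write `ϖ` for the Maurer–Cartan form. Since `d a = ϖ(a₍₁₎)·a₍₂₎`, and since right-invariant forms
-- freely generate `Ω¹` as a right module, a morphism `Ω → Ω'` exists exactly when `ker ϖ ≤ ker ϖ'`
-- (`nonempty_hom_iff`). As `ϖ(1) = 0`, the kernel is `k·1` plus its part in the augmentation ideal.
-- Transport that part by the linear bijection `𝒬₂`, under which `s ⊗ δ_u` becomes `s·δ_u` in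
-- `D(G)`. The product rule for `ϖ` gives stability under left multiplication by group elements and
-- right multiplication by the `δ_w`; left covariance, through the adjoint coaction, gives the other
-- two. So calculi correspond to two-sided ideals of `D(G)` inside `ker ε`, inclusions being
-- quotients (`ideal`, `ker_maurerCartan_le_iff`), and every such ideal occurs (`exists_ideal_eq`).
--
-- The ideal attached to a pair is `Ann(W) ∩ ker ε`. The module `W` is simple, it is not the counit
-- representation, and it determines the pair. A two-sided ideal acting nontrivially on a simple `W`
-- acts by all operators of the algebra (`IsSimpleModule.exists_mem_smul_eq`). Hence nothing lies
-- strictly between `Ann(W) ∩ ker ε` and `ker ε`, which is coirreducibility; a related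
-- semisimplicity argument recovers `W` from the ideal. Conversely, for an ideal `J` strictly inside
-- `ker ε`, the normalized integral `e` of `D(G)` yields a simple module killed by `J` which is not
-- the counit representation (`exists_ideal_le`). It is induced from a centralizer
-- (`DoubleRep.exists_equiv_space`), so `J ≤ Ann(W) ∩ ker ε` for some pair. Characteristic zero
-- serves only to normalize `e`.
--
-- For the dimension, the right-invariant forms are the image of `ϖ`, of the same dimension as the
-- image of `D(G)` in `End(W)`. By density this image is `End_D(W)` with `D = End_{D(G)}(W) ≅
-- End_{G₀}(V)`, so its dimension times `dim D` is `(dim W)²`, where `dim W = |C| dim V`.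

universe w

/-! ### Morphisms of calculi over a general Hopf algebra. -/

namespace BicovariantCalculus

section General

variable {k : Type u} {A : Type v} [Field k] [Ring A] [HopfAlgebra k A]
  (Ω : BicovariantCalculus k A)

theorem d_one : Ω.d 1 = 0 := by
  have h := Ω.leibniz 1 1
  rw [mul_one, Ω.rmul_one, Ω.one_lmul] at h
  simpa using h

/-- The surjection `a ⊗ b ↦ d(a)·b` onto the space of forms. -/
noncomputable def ofTensor : A ⊗[k] A →ₗ[k] Ω.Form := TensorProduct.lift (Ω.rmul ∘ₗ Ω.d)

@[simp]
theorem ofTensor_tmul (a b : A) : Ω.ofTensor (a ⊗ₜ b) = Ω.rmul (Ω.d a) b := rfl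

theorem lmul_d (a b : A) : Ω.lmul a (Ω.d b) = Ω.d (a * b) - Ω.rmul (Ω.d a) b := by
  rw [Ω.leibniz]; abel

theorem ofTensor_surjective : Function.Surjective Ω.ofTensor := by
  rw [← LinearMap.range_eq_top, ← top_le_iff, ← Ω.span_eq_top, Submodule.span_le]
  rintro _ ⟨a, b, rfl⟩
  refine ⟨(a * b) ⊗ₜ 1 - a ⊗ₜ b, ?_⟩
  simp [Ω.rmul_one, Ω.lmul_d]

/-- A linear map between forms is a morphism of calculi when it is compatible with the
presentations by elements `d(a)·b`. -/
noncomputable def homOfTensor {Ω' : BicovariantCalculus k A} (f : Ω.Form →ₗ[k] Ω'.Form)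
    (hf : ∀ a b, f (Ω.rmul (Ω.d a) b) = Ω'.rmul (Ω'.d a) b) : Hom Ω Ω' where
  toLinearMap := f
  map_lmul c ω := by
    obtain ⟨z, rfl⟩ := Ω.ofTensor_surjective ω
    induction z with
    | zero => simp
    | add x y hx hy => simp only [map_add, hx, hy]
    | tmul a b =>
      rw [ofTensor_tmul, ← Ω.lmul_rmul, hf, ← Ω'.lmul_rmul, lmul_d, lmul_d]
      simp only [map_sub, LinearMap.sub_apply, hf, ← Ω.rmul_mul, ← Ω'.rmul_mul]
  map_rmul ω c := by
    obtain ⟨z, rfl⟩ := Ω.ofTensor_surjective ω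
    induction z with
    | zero => simp
    | add x y hx hy => simp only [map_add, hx, hy, LinearMap.add_apply]
    | tmul a b => rw [ofTensor_tmul, ← Ω.rmul_mul, hf, hf, ← Ω'.rmul_mul]
  map_d a := by
    have h := hf a 1
    rwa [Ω.rmul_one, Ω'.rmul_one] at h

variable {Ω} in
theorem Hom.map_ofTensor {Ω' : BicovariantCalculus k A} (f : Hom Ω Ω') (z : A ⊗[k] A) :
    f.toLinearMap (Ω.ofTensor z) = Ω'.ofTensor z := by
  induction z with
  | zero => simp
  | add x y hx hy => simp only [map_add, hx, hy]
  | tmul a b => rw [ofTensor_tmul, f.map_rmul, f.map_d, ofTensor_tmul]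

variable {Ω} in
theorem Hom.surjective {Ω' : BicovariantCalculus k A} (f : Hom Ω Ω') :
    Function.Surjective f.toLinearMap := fun ω => by
  obtain ⟨z, rfl⟩ := Ω'.ofTensor_surjective ω
  exact ⟨_, f.map_ofTensor z⟩

variable {Ω} in
theorem Hom.map_maurerCartan {Ω' : BicovariantCalculus k A} (f : Hom Ω Ω') (a : A) :
    f.toLinearMap (Ω.maurerCartan a) = Ω'.maurerCartan a := by
  simp only [maurerCartan, LinearMap.comp_apply]
  induction (Coalgebra.comul (R := k) a) with
  | zero => simp
  | add x y hx hy => simp only [map_add, hx, hy]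
  | tmul a b => simp [f.map_rmul, f.map_d]

/-- Both spaces of forms are quotients of `A ⊗ A` by `a ⊗ b ↦ d(a)·b`, so an inclusion of kernels
induces a map, and compatibility with these presentations already forces it to be a morphism. -/
theorem exists_hom_of_ker_le {Ω' : BicovariantCalculus k A}
    (h : LinearMap.ker Ω.ofTensor ≤ LinearMap.ker Ω'.ofTensor) : Nonempty (Hom Ω Ω') := by
  let e := Ω.ofTensor.quotKerEquivOfSurjective Ω.ofTensor_surjective
  refine ⟨Ω.homOfTensor ((LinearMap.ker Ω.ofTensor).liftQ Ω'.ofTensor h ∘ₗ e.symm.toLinearMap)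
    fun a b => ?_⟩
  have : e (Submodule.Quotient.mk (a ⊗ₜ b)) = Ω.rmul (Ω.d a) b := rfl
  rw [LinearMap.comp_apply, ← this]
  simp

/-- The map `ω ⊗ b ↦ ω·S(b₍₁₎) ⊗ b₍₂₎`. -/
noncomputable def rightUnwind : Ω.Form ⊗[k] A →ₗ[k] Ω.Form ⊗[k] A :=
  (TensorProduct.lift (Ω.rmul.compl₂ (HopfAlgebra.antipode k))).rTensor A ∘ₗ
    (TensorProduct.assoc k Ω.Form A A).symm.toLinearMap ∘ₗ
    (Coalgebra.comul (R := k) (A := A)).lTensor Ω.Form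

/-- The map `b ⊗ ω ↦ b₍₁₎ ⊗ S(b₍₂₎)·ω`. -/
noncomputable def leftUnwind : A ⊗[k] Ω.Form →ₗ[k] A ⊗[k] Ω.Form :=
  (TensorProduct.lift (Ω.lmul ∘ₗ (HopfAlgebra.antipode k))).lTensor A ∘ₗ
    (TensorProduct.assoc k A A Ω.Form).toLinearMap ∘ₗ
    (Coalgebra.comul (R := k) (A := A)).rTensor Ω.Form

end General

/-! ### Maurer–Cartan forms over the codouble. -/

section Codouble

open _root_.Codouble

variable {k : Type u} {G : Type v} [Field k] [Group G] [Fintype G] [DecidableEq G]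
  (Ω : BicovariantCalculus k (Codouble k G))

theorem _root_.Codouble.antipode_basis (s u : G) :
    HopfAlgebra.antipode k (basis s u : Codouble k G) = basis (u⁻¹ * s⁻¹ * u) u⁻¹ :=
  lift_basis _ s u

theorem rmul_basis (ω : Ω.Form) (s u t v : G) :
    Ω.rmul (Ω.rmul ω (basis s u)) (basis t v) =
      if u = v then Ω.rmul ω (basis (s * t) u) else 0 := by
  rw [← Ω.rmul_mul, basis_mul]; split_ifs <;> simp

theorem lmul_basis (ω : Ω.Form) (s u t v : G) :
    Ω.lmul (basis s u) (Ω.lmul (basis t v) ω) =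
      if u = v then Ω.lmul (basis (s * t) u) ω else 0 := by
  rw [← Ω.mul_lmul, basis_mul]; split_ifs <;> simp

theorem maurerCartan_basis (s u : G) : Ω.maurerCartan (basis s u) =
    ∑ v, Ω.rmul (Ω.d (basis s v)) (basis (u⁻¹ * s⁻¹ * u) (u⁻¹ * v)) := by
  simp only [maurerCartan, LinearMap.comp_apply, comul_basis, map_sum, TensorProduct.lift.tmul,
    LinearMap.compl₁₂_apply, antipode_basis]
  refine Finset.sum_congr rfl fun v _ => ?_
  congr 2 <;> group

theorem sum_rmul_basis_one (ω : Ω.Form) : ∑ u, Ω.rmul ω (basis 1 u) = ω := by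
  rw [← map_sum, ← one_eq, Ω.rmul_one]

theorem sum_lmul_basis_one (ω : Ω.Form) : ∑ u, Ω.lmul (basis 1 u) ω = ω := by
  rw [← LinearMap.sum_apply, ← map_sum, ← one_eq, Ω.one_lmul]

/-- This is `d a = ϖ(a₍₁₎)·a₍₂₎`, which inverts the definition of `ϖ` by the antipode axiom. -/
theorem d_basis (s u : G) : Ω.d (basis s u) =
    ∑ v, Ω.rmul (Ω.maurerCartan (basis s v)) (basis (v⁻¹ * s * v) (v⁻¹ * u)) := by
  simp only [maurerCartan_basis, map_sum, LinearMap.sum_apply, rmul_basis]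
  rw [Finset.sum_comm]
  simp only [mul_right_inj]
  simp [mul_assoc]
  conv_lhs => rw [← Ω.sum_rmul_basis_one (Ω.d (basis s u))]
  refine (Fintype.sum_equiv ((Equiv.inv G).trans (Equiv.mulRight u)) _ _ fun w => ?_).symm
  simp

theorem coactR_d_basis (s u : G) : Ω.coactR (Ω.d (basis s u)) =
    ∑ v, Ω.d (basis s v) ⊗ₜ basis (v⁻¹ * s * v) (v⁻¹ * u) := by
  have h := congrArg (fun f => f (basis s u)) Ω.coactR_d
  simpa [comul_basis] using h

theorem coactL_d_basis (s u : G) : Ω.coactL (Ω.d (basis s u)) =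
    ∑ v, basis s v ⊗ₜ Ω.d (basis (v⁻¹ * s * v) (v⁻¹ * u)) := by
  have h := congrArg (fun f => f (basis s u)) Ω.coactL_d
  simpa [comul_basis] using h

theorem coactR_rmul_d_basis (s v t w : G) :
    Ω.coactR (Ω.rmul (Ω.d (basis s v)) (basis t w)) =
      ∑ x, ∑ y, Ω.rmul (Ω.d (basis s x)) (basis t y) ⊗ₜ
        (basis (x⁻¹ * s * x) (x⁻¹ * v) * basis (y⁻¹ * t * y) (y⁻¹ * w)) := by
  simp only [Ω.coactR_rmul, coactR_d_basis, comul_basis, map_sum, LinearMap.sum_apply,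
    TensorProduct.map₂_apply_tmul, TensorProduct.map_tmul, LinearMap.mul_apply']
  rw [Finset.sum_comm]

theorem coactL_rmul_d_basis (s v t w : G) :
    Ω.coactL (Ω.rmul (Ω.d (basis s v)) (basis t w)) =
      ∑ x, ∑ y, (basis s x * basis t y) ⊗ₜ
        Ω.rmul (Ω.d (basis (x⁻¹ * s * x) (x⁻¹ * v))) (basis (y⁻¹ * t * y) (y⁻¹ * w)) := by
  simp only [Ω.coactL_rmul, coactL_d_basis, comul_basis, map_sum, LinearMap.sum_apply,
    TensorProduct.map₂_apply_tmul, TensorProduct.map_tmul, LinearMap.mul_apply']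
  rw [Finset.sum_comm]

theorem coactL_lmul_d_basis (s v t w : G) :
    Ω.coactL (Ω.lmul (basis t w) (Ω.d (basis s v))) =
      ∑ x, ∑ y, (basis t y * basis s x) ⊗ₜ
        Ω.lmul (basis (y⁻¹ * t * y) (y⁻¹ * w)) (Ω.d (basis (x⁻¹ * s * x) (x⁻¹ * v))) := by
  simp only [Ω.coactL_lmul, coactL_d_basis, comul_basis, map_sum, LinearMap.sum_apply,
    TensorProduct.map₂_apply_tmul, TensorProduct.map_tmul, LinearMap.mul_apply']

/-- In Sweedler notation `Δ_R ϖ(a) = d(a₍₁₎)S(a₍₄₎) ⊗ a₍₂₎S(a₍₃₎)`, and the last factor collapses to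
the counit. -/
theorem coactR_maurerCartan (a : Codouble k G) :
    Ω.coactR (Ω.maurerCartan a) = Ω.maurerCartan a ⊗ₜ 1 := by
  refine LinearMap.congr_fun (f := Ω.coactR ∘ₗ Ω.maurerCartan)
    (g := (TensorProduct.mk k _ _).flip 1 ∘ₗ Ω.maurerCartan) (hom_ext fun s u => ?_) a
  simp only [LinearMap.comp_apply, LinearMap.flip_apply, TensorProduct.mk_apply,
    maurerCartan_basis, map_sum, coactR_rmul_d_basis]
  rw [Finset.sum_comm]
  refine Finset.sum_congr rfl fun x _ => ?_
  -- The supports agree only for `y = u⁻¹x`, and then the two group elements are inverse to each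
  -- other.
  have key : ∀ v y : G, (basis (x⁻¹ * s * x) (x⁻¹ * v) *
      basis (y⁻¹ * (u⁻¹ * s⁻¹ * u) * y) (y⁻¹ * (u⁻¹ * v)) : Codouble k G) =
      if y = u⁻¹ * x then basis 1 (x⁻¹ * v) else 0 := by
    intro v y
    rw [basis_mul]
    by_cases h : y = u⁻¹ * x
    · subst h
      rw [if_pos (by group), if_pos rfl]
      congr 1; group
    · rw [if_neg, if_neg h]
      intro h'
      apply h
      rw [← mul_assoc, mul_left_inj, inv_eq_iff_eq_inv] at h'
      rw [h']; group
  simp only [key, TensorProduct.tmul_ite, Finset.sum_ite_eq',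
    Finset.mem_univ, if_true]
  rw [← TensorProduct.tmul_sum, one_eq]
  congr 1
  exact Fintype.sum_equiv (Equiv.mulLeft x⁻¹) _ _ fun w => rfl

/-- The left coaction on right-invariant forms is the adjoint one, `ϖ(a) ↦ a₍₁₎S(a₍₃₎) ⊗ ϖ(a₍₂₎)`.
-/
theorem coactL_maurerCartan (s u : G) :
    Ω.coactL (Ω.maurerCartan (basis s u)) =
      ∑ v, basis (s * u⁻¹ * s⁻¹ * u) v ⊗ₜ
        Ω.maurerCartan (basis (v⁻¹ * s * v) (v⁻¹ * u * v)) := by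
  simp only [maurerCartan_basis, map_sum, coactL_rmul_d_basis, TensorProduct.tmul_sum]
  rw [Finset.sum_comm]
  refine Finset.sum_congr rfl fun x _ => ?_
  simp only [basis_mul, TensorProduct.ite_tmul, Finset.sum_ite_eq,
    Finset.mem_univ, if_true]
  refine Fintype.sum_equiv (Equiv.mulLeft x⁻¹) _ _ fun w => ?_
  simp [mul_assoc]

theorem maurerCartan_one : Ω.maurerCartan 1 = 0 := by
  have h : (Coalgebra.comul (R := k) (1 : Codouble k G)) = 1 ⊗ₜ 1 := Bialgebra.comul_one
  simp [maurerCartan, h, Ω.d_one]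

/-- The product rule `ϖ(ab) = a₍₁₎·ϖ(b)·S(a₍₂₎) + ε(b) ϖ(a)`. -/
theorem maurerCartan_basis_mul (t w : G) (b : Codouble k G) :
    Ω.maurerCartan (basis t w * b) =
      ∑ v, Ω.rmul (Ω.lmul (basis t v) (Ω.maurerCartan b)) (basis (w⁻¹ * t⁻¹ * w) (w⁻¹ * v)) +
        (Coalgebra.counit b : k) • Ω.maurerCartan (basis t w) := by
  let F : Codouble k G →ₗ[k] Ω.Form := ∑ v, (Ω.rmul.flip (basis (w⁻¹ * t⁻¹ * w) (w⁻¹ * v))) ∘ₗ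
    Ω.lmul (basis t v) ∘ₗ Ω.maurerCartan
  suffices h : Ω.maurerCartan ∘ₗ LinearMap.mulLeft k (basis t w) = F +
      (Coalgebra.counit : Codouble k G →ₗ[k] k).smulRight (Ω.maurerCartan (basis t w)) by
    simpa [F] using LinearMap.congr_fun h b
  refine hom_ext fun s u => ?_
  simp only [F, LinearMap.comp_apply, LinearMap.mulLeft_apply, LinearMap.add_apply,
    LinearMap.sum_apply, LinearMap.flip_apply, LinearMap.smulRight_apply, counit_basis,
    maurerCartan_basis, map_sum, ← Ω.lmul_rmul, rmul_basis]
  -- The Leibniz rule splits each summand: the terms with `v = x` and `w = u` add up to `ϖ` of the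
  -- product, those with `x = w⁻¹v` and `u = 1` to the counit term.
  have key : ∀ v x : G, (if u⁻¹ * x = w⁻¹ * v then
      Ω.rmul (Ω.lmul (basis t v) (Ω.d (basis s x)))
        (basis (u⁻¹ * s⁻¹ * u * (w⁻¹ * t⁻¹ * w)) (u⁻¹ * x)) else 0) =
      (if v = x then (if w = u then
        Ω.rmul (Ω.d (basis (t * s) x)) (basis (u⁻¹ * (t * s)⁻¹ * u) (u⁻¹ * x)) else 0) else 0) -
      (if x = w⁻¹ * v then (if u = 1 then
        Ω.rmul (Ω.d (basis t v)) (basis (w⁻¹ * t⁻¹ * w) (w⁻¹ * v)) else 0) else 0) := by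
    intro v x
    rw [Ω.lmul_d, basis_mul, map_sub, LinearMap.sub_apply, rmul_basis]
    by_cases h : u⁻¹ * x = w⁻¹ * v
    · rw [if_pos h]
      have hx : x = u⁻¹ * x ↔ u = 1 := by
        rw [eq_inv_mul_iff_mul_eq, mul_eq_right]
      have hv : v = x → (w = u) := fun e => by
        subst e; simpa using h.symm
      congr 1
      · by_cases e : v = x
        · obtain rfl := hv e
          subst e
          simp [mul_assoc]
        · simp [e]
      · by_cases e : u = 1
        · subst e
          simp at h
          simp [h, mul_assoc]
        · simp [e, hx]
    · rw [if_neg h]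
      have h1 : v = x → ¬ w = u := by rintro rfl rfl; exact h rfl
      have h2 : x = w⁻¹ * v → ¬ u = 1 := by rintro rfl rfl; simp at h
      have e1 : ∀ y : Ω.Form, (if v = x then (if w = u then y else 0) else 0) = 0 := fun y => by
        split_ifs with e1 e2 <;> first | rfl | exact absurd e2 (h1 e1)
      have e2 : ∀ y : Ω.Form, (if x = w⁻¹ * v then (if u = 1 then y else 0) else 0) = 0 :=
        fun y => by split_ifs with e1 e2 <;> first | rfl | exact absurd e2 (h2 e1)
      rw [e1, e2, sub_zero]
  simp only [key, Finset.sum_sub_distrib, Finset.sum_ite_eq, Finset.sum_ite_eq', Finset.mem_univ,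
    if_true, basis_mul]
  have e1 : Ω.maurerCartan (if w = u then basis (t * s) w else 0) =
      if w = u then Ω.maurerCartan (basis (t * s) u) else 0 := by
    split_ifs with h
    · rw [h]
    · rw [map_zero]
  rw [e1, maurerCartan_basis]
  by_cases hw : w = u <;> simp only [hw, if_true, if_false, Finset.sum_const_zero]
  all_goals by_cases hu : u = 1 <;> simp only [hu, if_true, if_false, Finset.sum_const_zero,
    one_smul, zero_smul, sub_zero, add_zero, sub_add_cancel, zero_sub, neg_add_cancel]

/-! ### The invariant forms -/

theorem rightUnwind_tmul_basis (ω : Ω.Form) (s u : G) : Ω.rightUnwind (ω ⊗ₜ basis s u) =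
    ∑ v, Ω.rmul ω (basis (v⁻¹ * s⁻¹ * v) v⁻¹) ⊗ₜ basis (v⁻¹ * s * v) (v⁻¹ * u) := by
  simp [rightUnwind, comul_basis, TensorProduct.tmul_sum, antipode_basis]

theorem leftUnwind_basis_tmul (ω : Ω.Form) (s u : G) : Ω.leftUnwind (basis s u ⊗ₜ ω) =
    ∑ v, basis s v ⊗ₜ Ω.lmul (basis (u⁻¹ * s⁻¹ * u) (u⁻¹ * v)) ω := by
  simp [leftUnwind, comul_basis, TensorProduct.sum_tmul, antipode_basis]
  refine Finset.sum_congr rfl fun v _ => ?_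
  congr 3; group

theorem mem_rightInvariant {ω : Ω.Form} : ω ∈ Ω.rightInvariant ↔ Ω.coactR ω = ω ⊗ₜ 1 := Iff.rfl

theorem mem_leftInvariant {ω : Ω.Form} : ω ∈ Ω.leftInvariant ↔ Ω.coactL ω = 1 ⊗ₜ ω := Iff.rfl

/-- For invariant `ω` the coaction gives `ω·b₍₁₎ ⊗ b₍₂₎`, and unwinding gives `ω·b₍₁₎S(b₍₂₎) ⊗ b₍₃₎
= ω ⊗ b`. This makes the multiplication from invariant forms tensor `A` to all forms injective. -/
theorem rightUnwind_coactR {ω : Ω.Form} (hω : ω ∈ Ω.rightInvariant) (b : Codouble k G) :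
    Ω.rightUnwind (Ω.coactR (Ω.rmul ω b)) = ω ⊗ₜ b := by
  refine LinearMap.congr_fun (f := Ω.rightUnwind ∘ₗ Ω.coactR ∘ₗ Ω.rmul ω)
    (g := TensorProduct.mk k _ _ ω) (hom_ext fun s u => ?_) b
  simp only [LinearMap.comp_apply, Ω.coactR_rmul, Ω.mem_rightInvariant.1 hω, comul_basis, map_sum,
    TensorProduct.map₂_apply_tmul, TensorProduct.map_tmul, LinearMap.mul_apply', one_mul,
    rightUnwind_tmul_basis, rmul_basis, TensorProduct.mk_apply]
  rw [Finset.sum_comm]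
  have key : ∀ x y : G, (if y = x⁻¹ then Ω.rmul ω (basis (s * (x⁻¹ * (y⁻¹ * s * y)⁻¹ * x)) y) else 0)
    ⊗ₜ[k] (basis (x⁻¹ * (y⁻¹ * s * y) * x) (x⁻¹ * (y⁻¹ * u)) : Codouble k G) =
      if y = x⁻¹ then Ω.rmul ω (basis 1 y) ⊗ₜ basis s u else 0 := by
    intro x y
    split_ifs with h
    · subst h
      congr 2 <;> congr 1 <;> group
    · simp
  simp only [key, Finset.sum_ite_eq', Finset.mem_univ, if_true]
  rw [← TensorProduct.sum_tmul]
  congr 1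
  conv_rhs => rw [← Ω.sum_rmul_basis_one ω]
  exact Fintype.sum_equiv (Equiv.inv G) _ _ fun w => rfl

theorem leftUnwind_coactL {ω : Ω.Form} (hω : ω ∈ Ω.leftInvariant) (b : Codouble k G) :
    Ω.leftUnwind (Ω.coactL (Ω.lmul b ω)) = b ⊗ₜ ω := by
  refine LinearMap.congr_fun (f := Ω.leftUnwind ∘ₗ Ω.coactL ∘ₗ Ω.lmul.flip ω)
    (g := (TensorProduct.mk k _ _).flip ω) (hom_ext fun s u => ?_) b
  simp only [LinearMap.comp_apply, LinearMap.flip_apply, Ω.coactL_lmul, Ω.mem_leftInvariant.1 hω,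
    comul_basis, map_sum, LinearMap.sum_apply,
    TensorProduct.map₂_apply_tmul, TensorProduct.map_tmul, LinearMap.mul_apply', mul_one,
    leftUnwind_basis_tmul, lmul_basis, TensorProduct.mk_apply]
  rw [Finset.sum_comm]
  have key : ∀ x y : G, (basis s x : Codouble k G) ⊗ₜ[k]
      (if y⁻¹ * x = y⁻¹ * u then Ω.lmul (basis (y⁻¹ * s⁻¹ * y * (y⁻¹ * s * y)) (y⁻¹ * x)) ω else 0)
      = if x = u then basis s u ⊗ₜ Ω.lmul (basis 1 (y⁻¹ * u)) ω else 0 := by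
    intro x y
    by_cases h : x = u
    · subst h
      simp only [if_true]
      congr 4; group
    · simp [h]
  simp only [key]
  rw [Finset.sum_comm]
  simp only [Finset.sum_ite_eq', Finset.mem_univ, if_true]
  rw [← TensorProduct.tmul_sum]
  congr 1
  conv_rhs => rw [← Ω.sum_lmul_basis_one ω]
  exact Fintype.sum_equiv ((Equiv.inv G).trans (Equiv.mulRight u)) _ _ fun w => rfl

/-- The left-invariant Maurer-Cartan form `a ↦ S(a₍₁₎)·d(a₍₂₎)` on the basis. -/
noncomputable def leftMaurerCartan (s u : G) : Ω.Form :=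
  ∑ v, Ω.lmul (basis (v⁻¹ * s⁻¹ * v) v⁻¹) (Ω.d (basis (v⁻¹ * s * v) (v⁻¹ * u)))

/-- This is `d a = a₍₁₎·(S(a₍₂₎)·d(a₍₃₎))`; it shows that left-invariant forms generate `Ω¹` as a
left module. -/
theorem d_basis_eq_leftMaurerCartan (s u : G) : Ω.d (basis s u) =
    ∑ v, Ω.lmul (basis s v) (Ω.leftMaurerCartan (v⁻¹ * s * v) (v⁻¹ * u)) := by
  simp only [leftMaurerCartan, map_sum, lmul_basis]
  rw [Finset.sum_comm]
  conv_lhs => rw [← Ω.sum_lmul_basis_one (Ω.d (basis s u))]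
  rw [← Fintype.sum_equiv (Equiv.inv G) _ _ fun w => rfl]
  refine Finset.sum_congr rfl fun x _ => ?_
  simp only [Equiv.inv_apply, Finset.sum_ite_eq', Finset.mem_univ, if_true]
  congr 2
  · congr 2; group
  · congr 1 <;> group

theorem leftMaurerCartan_mem (s u : G) : Ω.leftMaurerCartan s u ∈ Ω.leftInvariant := by
  rw [mem_leftInvariant]
  have h : Ω.coactL (Ω.leftMaurerCartan s u) = ∑ v, ∑ x, (basis 1 x : Codouble k G) ⊗ₜ[k]
      Ω.lmul (basis ((v * x)⁻¹ * s⁻¹ * (v * x)) (v * x)⁻¹)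
        (Ω.d (basis ((v * x)⁻¹ * s * (v * x)) ((v * x)⁻¹ * u))) := by
    simp only [leftMaurerCartan, map_sum, coactL_lmul_d_basis, basis_mul, TensorProduct.ite_tmul,
      Finset.sum_ite_eq', Finset.mem_univ, if_true]
    refine Finset.sum_congr rfl fun v _ => Finset.sum_congr rfl fun x _ => ?_
    simp [mul_assoc]
  rw [h, Finset.sum_comm, one_eq, TensorProduct.sum_tmul]
  refine Finset.sum_congr rfl fun x _ => ?_
  rw [← TensorProduct.tmul_sum]
  congr 1
  exact Fintype.sum_equiv (Equiv.mulRight x) _ _ fun v => rfl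

theorem maurerCartan_mem (a : Codouble k G) : Ω.maurerCartan a ∈ Ω.rightInvariant :=
  Ω.coactR_maurerCartan a

/-- The triangular automorphism `a ⊗ b ↦ a₍₁₎ ⊗ a₍₂₎ b` of `A ⊗ A`. -/
noncomputable def comulMul (A : Type*) [Ring A] [HopfAlgebra k A] : A ⊗[k] A →ₗ[k] A ⊗[k] A :=
  (LinearMap.mul' k A).lTensor A ∘ₗ (TensorProduct.assoc k A A A).toLinearMap ∘ₗ
    (Coalgebra.comul (R := k) (A := A)).rTensor A

theorem comulMul_tmul_basis (s u : G) (b : Codouble k G) :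
    comulMul (k := k) (Codouble k G) (basis s u ⊗ₜ b) =
      ∑ v, basis s v ⊗ₜ (basis (v⁻¹ * s * v) (v⁻¹ * u) * b) := by
  simp [comulMul, comul_basis, TensorProduct.sum_tmul]

theorem tensor_hom_ext {M : Type*} [AddCommGroup M] [Module k M]
    {f g : Codouble k G ⊗[k] Codouble k G →ₗ[k] M}
    (h : ∀ s u t w, f (basis s u ⊗ₜ basis t w) = g (basis s u ⊗ₜ basis t w)) : f = g :=
  TensorProduct.ext (hom_ext fun s u => hom_ext fun t w => h s u t w)

/-- The inverse is `a ⊗ b ↦ a₍₁₎ ⊗ S(a₍₂₎)b`; the preimage given in the proof is its value at a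
basis element `a`. -/
theorem comulMul_surjective :
    Function.Surjective (comulMul (k := k) (Codouble k G)) := by
  rw [← LinearMap.range_eq_top, ← top_le_iff]
  rintro z -
  induction z with
  | zero => exact zero_mem _
  | add x y hx hy => exact add_mem hx hy
  | tmul a b =>
    rw [eq_sum a, TensorProduct.sum_tmul]
    refine sum_mem fun s _ => ?_
    rw [TensorProduct.sum_tmul]
    refine sum_mem fun u _ => ?_
    rw [← TensorProduct.smul_tmul']
    refine Submodule.smul_mem _ _ ⟨∑ v, basis s v ⊗ₜ (basis (u⁻¹ * s⁻¹ * u) (u⁻¹ * v) * b), ?_⟩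
    have h1 : ∑ v, basis 1 (u⁻¹ * v) = (1 : Codouble k G) := by
      rw [one_eq]
      exact Fintype.sum_equiv (Equiv.mulLeft u⁻¹) _ _ fun w => rfl
    have h2 : ∀ v w : G, (basis (w⁻¹ * s * w) (w⁻¹ * v) *
        (basis (u⁻¹ * s⁻¹ * u) (u⁻¹ * v) * b) : Codouble k G) =
        if w = u then basis 1 (u⁻¹ * v) * b else 0 := by
      intro v w
      rw [← mul_assoc, basis_mul]
      by_cases h : w = u
      · subst h
        rw [if_pos rfl, if_pos rfl]
        congr 2; group
      · simp [h]
    simp only [map_sum, comulMul_tmul_basis, h2, TensorProduct.tmul_ite,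
      Finset.sum_ite_eq', Finset.mem_univ, if_true]
    rw [← TensorProduct.tmul_sum, ← Finset.sum_mul, h1, one_mul]

/-- The multiplication `a ⊗ b ↦ ϖ(a)·b`. -/
noncomputable def ofTensorInvariant : Codouble k G ⊗[k] Codouble k G →ₗ[k] Ω.Form :=
  TensorProduct.lift (Ω.rmul ∘ₗ Ω.maurerCartan)

theorem ofTensorInvariant_comulMul (z : Codouble k G ⊗[k] Codouble k G) :
    Ω.ofTensorInvariant (comulMul (Codouble k G) z) = Ω.ofTensor z := by
  refine LinearMap.congr_fun (f := Ω.ofTensorInvariant ∘ₗ comulMul (Codouble k G))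
    (TensorProduct.ext (hom_ext fun s u => LinearMap.ext fun b => ?_)) z
  simp [comulMul_tmul_basis, ofTensorInvariant, d_basis, Ω.rmul_mul]

theorem rightUnwind_ofTensorInvariant (z : Codouble k G ⊗[k] Codouble k G) :
    Ω.rightUnwind (Ω.coactR (Ω.ofTensorInvariant z)) = Ω.maurerCartan.rTensor _ z := by
  induction z with
  | zero => simp
  | add x y hx hy => simp only [map_add, hx, hy]
  | tmul a b => exact Ω.rightUnwind_coactR (Ω.maurerCartan_mem a) b

/-- Since `d(a)·b = ϖ(a₍₁₎)·a₍₂₎b` and the product of invariant forms with `A` is free, the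
relations among the forms `d(a)·b` are controlled by `ϖ` alone. -/
theorem ofTensor_eq_zero_iff (z : Codouble k G ⊗[k] Codouble k G) :
    Ω.ofTensor z = 0 ↔ Ω.maurerCartan.rTensor _ (comulMul (Codouble k G) z) = 0 := by
  rw [← ofTensorInvariant_comulMul]
  refine ⟨fun h => by rw [← rightUnwind_ofTensorInvariant, h, map_zero, map_zero], fun h => ?_⟩
  have : Ω.ofTensorInvariant = TensorProduct.lift Ω.rmul ∘ₗ Ω.maurerCartan.rTensor _ :=
    TensorProduct.ext' fun a b => rfl
  rw [this, LinearMap.comp_apply, h, map_zero]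

theorem nonempty_hom_iff {Ω Ω' : BicovariantCalculus k (Codouble k G)} :
    Nonempty (Hom Ω Ω') ↔
      LinearMap.ker Ω.maurerCartan ≤ LinearMap.ker Ω'.maurerCartan := by
  constructor
  · rintro ⟨f⟩ a ha
    rw [LinearMap.mem_ker, ← f.map_maurerCartan, LinearMap.mem_ker.1 ha, map_zero]
  · intro h
    refine Ω.exists_hom_of_ker_le fun z hz => ?_
    -- `ϖ'` factors through the image of `ϖ`; the factor is extended arbitrarily to all forms. The
    -- extension is merely linear, which suffices to transfer the vanishing of `(ϖ ⊗ id)`.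
    obtain ⟨g, hg⟩ : ∃ g : Ω.Form →ₗ[k] Ω'.Form, g ∘ₗ Ω.maurerCartan = Ω'.maurerCartan := by
      obtain ⟨g, hg⟩ := ((LinearMap.ker Ω.maurerCartan).liftQ Ω'.maurerCartan h ∘ₗ
        (Ω.maurerCartan.quotKerEquivRange).symm.toLinearMap).exists_extend
      refine ⟨g, LinearMap.ext fun a => ?_⟩
      have := LinearMap.congr_fun hg (Ω.maurerCartan.quotKerEquivRange (Submodule.Quotient.mk a))
      simpa using this
    rw [LinearMap.mem_ker, ofTensor_eq_zero_iff] at hz ⊢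
    rw [← hg, LinearMap.rTensor_comp, LinearMap.comp_apply, hz, map_zero]

theorem Hom.bijective_of_ker_le {Ω Ω' : BicovariantCalculus k (Codouble k G)} (f : Hom Ω Ω')
    (h : LinearMap.ker Ω'.maurerCartan ≤ LinearMap.ker Ω.maurerCartan) :
    Function.Bijective f.toLinearMap := by
  refine ⟨?_, f.surjective⟩
  obtain ⟨g⟩ := nonempty_hom_iff.2 h
  refine Function.HasLeftInverse.injective ⟨g.toLinearMap, fun ω => ?_⟩
  obtain ⟨z, rfl⟩ := Ω.ofTensor_surjective ω
  rw [f.map_ofTensor, g.map_ofTensor]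

theorem isomorphic_iff {Ω Ω' : BicovariantCalculus k (Codouble k G)} :
    Ω.Isomorphic Ω' ↔ LinearMap.ker Ω.maurerCartan = LinearMap.ker Ω'.maurerCartan := by
  constructor
  · rintro ⟨f, hf⟩
    refine le_antisymm (nonempty_hom_iff.1 ⟨f⟩) fun a ha => hf.1 ?_
    rw [f.map_maurerCartan, LinearMap.mem_ker.1 ha, map_zero]
  · intro h
    obtain ⟨f⟩ := nonempty_hom_iff.2 h.le
    exact ⟨f, f.bijective_of_ker_le h.ge⟩

theorem subsingleton_form_iff :
    Subsingleton Ω.Form ↔ LinearMap.ker Ω.maurerCartan = ⊤ := by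
  constructor
  · intro h
    exact LinearMap.ker_eq_top.2 (LinearMap.ext fun a => Subsingleton.elim _ _)
  · intro h
    rw [LinearMap.ker_eq_top] at h
    refine subsingleton_of_forall_eq 0 fun ω => ?_
    obtain ⟨z, rfl⟩ := Ω.ofTensor_surjective ω
    rw [ofTensor_eq_zero_iff, h, LinearMap.rTensor_zero, LinearMap.zero_apply]

instance : FiniteDimensional k (Codouble k G) :=
  inferInstanceAs (FiniteDimensional k (G → MonoidAlgebra k G))

instance : FiniteDimensional k Ω.Form := Module.Finite.of_surjective _ Ω.ofTensor_surjective

instance : Nontrivial (Codouble k G) := inferInstanceAs (Nontrivial (G → MonoidAlgebra k G))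

/-- The structure theorem for Hopf modules: multiplication identifies invariant forms tensor `A`
with `Ω¹`. -/
theorem finrank_rightInvariant_mul : Module.finrank k Ω.rightInvariant *
    Module.finrank k (Codouble k G) = Module.finrank k Ω.Form := by
  let F : Ω.rightInvariant ⊗[k] Codouble k G →ₗ[k] Ω.Form :=
    TensorProduct.lift (Ω.rmul ∘ₗ Ω.rightInvariant.subtype)
  have hF : Function.Bijective F := by
    constructor
    · refine Function.Injective.of_comp (f := Ω.rightUnwind ∘ₗ Ω.coactR) ?_
      have : (Ω.rightUnwind ∘ₗ Ω.coactR) ∘ₗ F = Ω.rightInvariant.subtype.rTensor _ :=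
        TensorProduct.ext' fun ω b => Ω.rightUnwind_coactR ω.2 b
      rw [← LinearMap.coe_comp, this]
      exact Module.Flat.rTensor_preserves_injective_linearMap _ (Submodule.subtype_injective _)
    · intro ω
      obtain ⟨z, rfl⟩ := Ω.ofTensor_surjective ω
      refine ⟨(Ω.maurerCartan.codRestrict _ Ω.maurerCartan_mem).rTensor _
        (comulMul (Codouble k G) z), ?_⟩
      rw [← ofTensorInvariant_comulMul]
      exact LinearMap.congr_fun (f := F ∘ₗ (Ω.maurerCartan.codRestrict _
        Ω.maurerCartan_mem).rTensor _) (g := Ω.ofTensorInvariant)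
        (TensorProduct.ext' fun a b => rfl) _
  rw [← (LinearEquiv.ofBijective F hF).finrank_eq, Module.finrank_tensorProduct]

theorem finrank_leftInvariant_mul : Module.finrank k Ω.leftInvariant *
    Module.finrank k (Codouble k G) = Module.finrank k Ω.Form := by
  let F : Codouble k G ⊗[k] Ω.leftInvariant →ₗ[k] Ω.Form :=
    TensorProduct.lift ((Ω.lmul.flip ∘ₗ Ω.leftInvariant.subtype).flip)
  have hF : Function.Bijective F := by
    constructor
    · refine Function.Injective.of_comp (f := Ω.leftUnwind ∘ₗ Ω.coactL) ?_
      have : (Ω.leftUnwind ∘ₗ Ω.coactL) ∘ₗ F = Ω.leftInvariant.subtype.lTensor _ :=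
        TensorProduct.ext' fun b ω => Ω.leftUnwind_coactL ω.2 b
      rw [← LinearMap.coe_comp, this]
      exact Module.Flat.lTensor_preserves_injective_linearMap _ (Submodule.subtype_injective _)
    · rw [← LinearMap.range_eq_top, ← top_le_iff, ← Ω.span_eq_top, Submodule.span_le]
      rintro _ ⟨a, b, rfl⟩
      change _ ∈ LinearMap.range F
      rw [eq_sum b]
      simp only [map_sum, map_smul, d_basis_eq_leftMaurerCartan, ← Ω.mul_lmul]
      refine sum_mem fun s _ => sum_mem fun u _ => Submodule.smul_mem _ _ (sum_mem fun v _ => ?_)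
      exact ⟨(a * basis s v) ⊗ₜ ⟨_, Ω.leftMaurerCartan_mem _ _⟩, rfl⟩
  rw [← (LinearEquiv.ofBijective F hF).finrank_eq, Module.finrank_tensorProduct, mul_comm]

/-- Both dimensions are `dim Ω¹ / dim A`. -/
theorem finrank_leftInvariant :
    Module.finrank k Ω.leftInvariant = Module.finrank k Ω.rightInvariant :=
  Nat.eq_of_mul_eq_mul_right (Module.finrank_pos (R := k) (M := Codouble k G))
    (Ω.finrank_leftInvariant_mul.trans Ω.finrank_rightInvariant_mul.symm)

/-- The right-invariant forms are the values of the Maurer-Cartan form. -/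
theorem range_maurerCartan : LinearMap.range Ω.maurerCartan = Ω.rightInvariant := by
  refine Submodule.eq_of_le_of_finrank_le ?_ ?_
  · rintro _ ⟨a, rfl⟩
    exact Ω.maurerCartan_mem a
  -- Already the image of `ϖ`, tensored with `A`, surjects onto `Ω¹`, so its dimension is at least
  -- `dim Ω¹ / dim A`.
  · refine Nat.le_of_mul_le_mul_right ?_ (Module.finrank_pos (R := k) (M := Codouble k G))
    rw [finrank_rightInvariant_mul, ← Module.finrank_tensorProduct]
    refine LinearMap.finrank_le_finrank_of_surjective (f := TensorProduct.lift
      (Ω.rmul ∘ₗ (LinearMap.range Ω.maurerCartan).subtype)) fun ω => ?_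
    obtain ⟨z, rfl⟩ := Ω.ofTensor_surjective ω
    refine ⟨Ω.maurerCartan.rangeRestrict.rTensor _ (comulMul (Codouble k G) z), ?_⟩
    rw [← ofTensorInvariant_comulMul]
    exact LinearMap.congr_fun (f := TensorProduct.lift
      (Ω.rmul ∘ₗ (LinearMap.range Ω.maurerCartan).subtype) ∘ₗ
        Ω.maurerCartan.rangeRestrict.rTensor _) (g := Ω.ofTensorInvariant)
      (TensorProduct.ext' fun a b => rfl) _

end Codouble

end BicovariantCalculus

/-! ### Bicovariant calculi presented by the tensor square. -/

namespace BicovariantCalculus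

section Universal

variable (k : Type u) (A : Type v) [Field k] [Ring A] [HopfAlgebra k A]

/-- The left coaction `a ⊗ b ↦ a₍₁₎b₍₁₎ ⊗ (a₍₂₎ ⊗ b₍₂₎)` on the tensor square. -/
noncomputable def tensorCoactL : A ⊗[k] A →ₗ[k] A ⊗[k] (A ⊗[k] A) :=
  (LinearMap.mul' k A).rTensor _ ∘ₗ Coalgebra.comul

/-- The right coaction `a ⊗ b ↦ (a₍₁₎ ⊗ b₍₁₎) ⊗ a₍₂₎b₍₂₎` on the tensor square. -/
noncomputable def tensorCoactR : A ⊗[k] A →ₗ[k] (A ⊗[k] A) ⊗[k] A :=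
  (LinearMap.mul' k A).lTensor _ ∘ₗ Coalgebra.comul

variable {k A}

theorem tensorCoactL_tmul (a b : A) : tensorCoactL k A (a ⊗ₜ b) =
    TensorProduct.map₂ (LinearMap.mul k A) (TensorProduct.mk k A A) (Coalgebra.comul a)
      (Coalgebra.comul b) := by
  simp only [tensorCoactL, LinearMap.comp_apply, TensorProduct.comul_tmul]
  induction (Coalgebra.comul (R := k) a) with
  | zero => simp
  | add x y hx hy => simp only [map_add, TensorProduct.add_tmul, hx, hy, LinearMap.add_apply]
  | tmul a a' =>
    induction (Coalgebra.comul (R := k) b) with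
    | zero => simp
    | add x y hx hy => simp only [map_add, TensorProduct.tmul_add, hx, hy]
    | tmul b b' => simp

theorem tensorCoactR_tmul (a b : A) : tensorCoactR k A (a ⊗ₜ b) =
    TensorProduct.map₂ (TensorProduct.mk k A A) (LinearMap.mul k A) (Coalgebra.comul a)
      (Coalgebra.comul b) := by
  simp only [tensorCoactR, LinearMap.comp_apply, TensorProduct.comul_tmul]
  induction (Coalgebra.comul (R := k) a) with
  | zero => simp
  | add x y hx hy => simp only [map_add, TensorProduct.add_tmul, hx, hy, LinearMap.add_apply]
  | tmul a a' =>
    induction (Coalgebra.comul (R := k) b) with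
    | zero => simp
    | add x y hx hy => simp only [map_add, TensorProduct.tmul_add, hx, hy]
    | tmul b b' => simp

variable {C D : Type*} [AddCommGroup C] [Module k C] [Coalgebra k C] [AddCommGroup D] [Module k D]
  [Coalgebra k D]

/-- A coalgebra map `f : C → D` makes `C` a `D`-bicomodule by `(f ⊗ id)Δ` and `(id ⊗ f)Δ`. With `C =
A ⊗ A` and `f` the multiplication, a coalgebra map because `A` is a bialgebra, these are
`tensorCoactL` and `tensorCoactR`. -/
theorem _root_.CoalgHom.coassoc_left (f : C →ₗc[k] D) :
    (TensorProduct.assoc k D D C).toLinearMap ∘ₗ (Coalgebra.comul (R := k) (A := D)).rTensor C ∘ₗ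
      f.toLinearMap.rTensor C ∘ₗ Coalgebra.comul =
    (f.toLinearMap.rTensor C ∘ₗ Coalgebra.comul).lTensor D ∘ₗ f.toLinearMap.rTensor C ∘ₗ
      Coalgebra.comul := by
  have h := f.map_comp_comul
  simp only [coassoc_simps] at h ⊢
  rw [← h]
  simp only [coassoc_simps]

theorem _root_.CoalgHom.counit_left (f : C →ₗc[k] D) :
    (Coalgebra.counit (R := k) (A := D)).rTensor C ∘ₗ f.toLinearMap.rTensor C ∘ₗ Coalgebra.comul =
      TensorProduct.mk k k C 1 := by
  rw [← LinearMap.comp_assoc, ← LinearMap.rTensor_comp, f.counit_comp]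
  exact Coalgebra.rTensor_counit_comp_comul

theorem _root_.CoalgHom.coassoc_right (f : C →ₗc[k] D) :
    (TensorProduct.assoc k C D D).toLinearMap ∘ₗ
      (f.toLinearMap.lTensor C ∘ₗ Coalgebra.comul).rTensor D ∘ₗ f.toLinearMap.lTensor C ∘ₗ
      Coalgebra.comul =
    (Coalgebra.comul (R := k) (A := D)).lTensor C ∘ₗ f.toLinearMap.lTensor C ∘ₗ
      Coalgebra.comul := by
  have h := f.map_comp_comul
  simp only [coassoc_simps] at h ⊢
  rw [h]

theorem _root_.CoalgHom.counit_right (f : C →ₗc[k] D) :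
    (Coalgebra.counit (R := k) (A := D)).lTensor C ∘ₗ f.toLinearMap.lTensor C ∘ₗ Coalgebra.comul =
      (TensorProduct.mk k C k).flip 1 := by
  rw [← LinearMap.comp_assoc, ← LinearMap.lTensor_comp, f.counit_comp]
  exact Coalgebra.lTensor_counit_comp_comul

theorem _root_.CoalgHom.coassoc_middle (f g : C →ₗc[k] D) :
    (TensorProduct.assoc k D C D).toLinearMap ∘ₗ
      (f.toLinearMap.rTensor C ∘ₗ Coalgebra.comul).rTensor D ∘ₗ g.toLinearMap.lTensor C ∘ₗ
      Coalgebra.comul =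
    (g.toLinearMap.lTensor C ∘ₗ Coalgebra.comul).lTensor D ∘ₗ f.toLinearMap.rTensor C ∘ₗ
      Coalgebra.comul := by
  simp only [coassoc_simps]

variable {F : Type v} [AddCommGroup F] [Module k F] (Φ : A ⊗[k] A →ₗ[k] F)
  (lm : A →ₗ[k] F →ₗ[k] F) (rm : F →ₗ[k] A →ₗ[k] F) (cL : F →ₗ[k] A ⊗[k] F)
  (cR : F →ₗ[k] F ⊗[k] A)

/-- Compatibility of the left coaction with the left action. Arbitrary tensors `x`, `y`, `z` replace
the coproducts of `c`, `a`, `b`: the identity is then trilinear and can be checked on pure tensors.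
-/
theorem map₂_lmul_tensor (hlm : ∀ c a b, lm c (Φ (a ⊗ₜ b)) = Φ ((c * a) ⊗ₜ b) - Φ (c ⊗ₜ (a * b)))
    (x y z : A ⊗[k] A) :
    Φ.lTensor A (TensorProduct.map₂ (LinearMap.mul k A) (TensorProduct.mk k A A) (x * y) z) -
      Φ.lTensor A (TensorProduct.map₂ (LinearMap.mul k A) (TensorProduct.mk k A A) x (y * z)) =
    TensorProduct.map₂ (LinearMap.mul k A) lm x (Φ.lTensor A
      (TensorProduct.map₂ (LinearMap.mul k A) (TensorProduct.mk k A A) y z)) := by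
  induction x with
  | zero => simp
  | add x x' hx hx' =>
    simp only [map_add, add_mul, LinearMap.add_apply, ← hx, ← hx']; abel
  | tmul c c' =>
  induction y with
  | zero => simp
  | add x x' hx hx' =>
    simp only [map_add, add_mul, mul_add, LinearMap.add_apply, ← hx, ← hx']; abel
  | tmul a a' =>
  induction z with
  | zero => simp
  | add x x' hx hx' => simp only [map_add, mul_add, ← hx, ← hx']; abel
  | tmul b b' => simp [hlm, TensorProduct.tmul_sub, mul_assoc]

theorem map₂_rmul_tensor (hrm : ∀ a b c, rm (Φ (a ⊗ₜ b)) c = Φ (a ⊗ₜ (b * c)))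
    (x y z : A ⊗[k] A) :
    Φ.lTensor A (TensorProduct.map₂ (LinearMap.mul k A) (TensorProduct.mk k A A) x (y * z)) =
    TensorProduct.map₂ (LinearMap.mul k A) rm (Φ.lTensor A
      (TensorProduct.map₂ (LinearMap.mul k A) (TensorProduct.mk k A A) x y)) z := by
  induction x with
  | zero => simp
  | add x x' hx hx' => simp only [map_add, LinearMap.add_apply, ← hx, ← hx']
  | tmul c c' =>
  induction y with
  | zero => simp
  | add x x' hx hx' => simp only [map_add, add_mul, LinearMap.add_apply, ← hx, ← hx']
  | tmul a a' =>
  induction z with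
  | zero => simp
  | add x x' hx hx' => simp only [map_add, mul_add, ← hx, ← hx']
  | tmul b b' => simp [hrm, mul_assoc]

theorem map₂_tensor_lmul (hlm : ∀ c a b, lm c (Φ (a ⊗ₜ b)) = Φ ((c * a) ⊗ₜ b) - Φ (c ⊗ₜ (a * b)))
    (x y z : A ⊗[k] A) :
    Φ.rTensor A (TensorProduct.map₂ (TensorProduct.mk k A A) (LinearMap.mul k A) (x * y) z) -
      Φ.rTensor A (TensorProduct.map₂ (TensorProduct.mk k A A) (LinearMap.mul k A) x (y * z)) =
    TensorProduct.map₂ lm (LinearMap.mul k A) x (Φ.rTensor A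
      (TensorProduct.map₂ (TensorProduct.mk k A A) (LinearMap.mul k A) y z)) := by
  induction x with
  | zero => simp
  | add x x' hx hx' =>
    simp only [map_add, add_mul, LinearMap.add_apply, ← hx, ← hx']; abel
  | tmul c c' =>
  induction y with
  | zero => simp
  | add x x' hx hx' =>
    simp only [map_add, add_mul, mul_add, LinearMap.add_apply, ← hx, ← hx']; abel
  | tmul a a' =>
  induction z with
  | zero => simp
  | add x x' hx hx' => simp only [map_add, mul_add, ← hx, ← hx']; abel
  | tmul b b' => simp [hlm, TensorProduct.sub_tmul, mul_assoc]

theorem map₂_tensor_rmul (hrm : ∀ a b c, rm (Φ (a ⊗ₜ b)) c = Φ (a ⊗ₜ (b * c)))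
    (x y z : A ⊗[k] A) :
    Φ.rTensor A (TensorProduct.map₂ (TensorProduct.mk k A A) (LinearMap.mul k A) x (y * z)) =
    TensorProduct.map₂ rm (LinearMap.mul k A) (Φ.rTensor A
      (TensorProduct.map₂ (TensorProduct.mk k A A) (LinearMap.mul k A) x y)) z := by
  induction x with
  | zero => simp
  | add x x' hx hx' => simp only [map_add, LinearMap.add_apply, ← hx, ← hx']
  | tmul c c' =>
  induction y with
  | zero => simp
  | add x x' hx hx' => simp only [map_add, add_mul, LinearMap.add_apply, ← hx, ← hx']
  | tmul a a' =>
  induction z with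
  | zero => simp
  | add x x' hx hx' => simp only [map_add, mul_add, ← hx, ← hx']
  | tmul b b' => simp [hrm, mul_assoc]

variable {Φ lm rm cL cR}

theorem tensor_surjective_induction (hΦ : Function.Surjective Φ) {p : F → Prop} (zero : p 0)
    (add : ∀ x y, p x → p y → p (x + y)) (tmul : ∀ a b, p (Φ (a ⊗ₜ b))) (ω : F) : p ω := by
  obtain ⟨z, rfl⟩ := hΦ ω
  induction z with
  | zero => simpa using zero
  | add x y hx hy => simpa using add _ _ hx hy
  | tmul a b => exact tmul a b

/-- A surjection `Φ : A ⊗ A → F`, thought of as `a ⊗ b ↦ d(a)·b`, which is compatible with the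
structure maps of the universal calculus makes `F` into a bicovariant calculus. -/
noncomputable def ofPresentation (hΦ : Function.Surjective Φ) (hone : ∀ b, Φ (1 ⊗ₜ b) = 0)
    (hlm : ∀ c a b, lm c (Φ (a ⊗ₜ b)) = Φ ((c * a) ⊗ₜ b) - Φ (c ⊗ₜ (a * b)))
    (hrm : ∀ a b c, rm (Φ (a ⊗ₜ b)) c = Φ (a ⊗ₜ (b * c)))
    (hcL : cL ∘ₗ Φ = Φ.lTensor A ∘ₗ tensorCoactL k A)
    (hcR : cR ∘ₗ Φ = Φ.rTensor A ∘ₗ tensorCoactR k A) : BicovariantCalculus k A where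
  Form := F
  lmul := lm
  rmul := rm
  one_lmul := tensor_surjective_induction hΦ (by simp) (fun x y hx hy => by simp [hx, hy])
    fun a b => by rw [hlm, hone]; simp
  mul_lmul c c' := tensor_surjective_induction hΦ (by simp) (fun x y hx hy => by simp [hx, hy])
    fun a b => by simp [hlm, mul_assoc]
  rmul_one := tensor_surjective_induction hΦ (by simp) (fun x y hx hy => by simp [hx, hy])
    fun a b => by simp [hrm]
  rmul_mul := tensor_surjective_induction hΦ (by simp) (fun x y hx hy c c' => by simp [hx, hy])
    fun a b => by simp [hrm, mul_assoc]
  lmul_rmul c ω c' := by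
    induction ω using tensor_surjective_induction hΦ with
    | zero => simp
    | add x y hx hy => simp [hx, hy]
    | tmul a b => simp [hrm, hlm, mul_assoc]
  d := Φ ∘ₗ (TensorProduct.mk k A A).flip 1
  leibniz a b := by simp [hrm, hlm]
  span_eq_top := by
    rw [← top_le_iff]
    rintro ω -
    induction ω using tensor_surjective_induction hΦ with
    | zero => exact zero_mem _
    | add x y hx hy => exact add_mem hx hy
    | tmul a b =>
      -- The Leibniz rule read backwards: `d(a)·b = d(ab) - a·d(b)`.
      have h : Φ (a ⊗ₜ b) = lm 1 (Φ ((a * b) ⊗ₜ 1)) - lm a (Φ (b ⊗ₜ 1)) := by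
        simp [hlm, hone]
      rw [h]
      exact sub_mem (Submodule.subset_span ⟨1, a * b, rfl⟩) (Submodule.subset_span ⟨a, b, rfl⟩)
  coactL := cL
  coactR := cR
  coactL_coassoc := by
    -- As `Φ` is surjective and intertwines the coactions, each comodule axiom on `F` follows from
    -- the same axiom on `A ⊗ A`.
    rw [← LinearMap.cancel_right hΦ]
    have h : (TensorProduct.assoc k A A F).toLinearMap ∘ₗ Coalgebra.comul.rTensor F ∘ₗ
        Φ.lTensor A = (Φ.lTensor A).lTensor A ∘ₗ (TensorProduct.assoc k A A (A ⊗[k] A)).toLinearMap ∘ₗ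
          Coalgebra.comul.rTensor (A ⊗[k] A) := by simp only [coassoc_simps]
    have h' := (Bialgebra.mulCoalgHom k A).coassoc_left
    change _ ∘ₗ _ ∘ₗ tensorCoactL k A = (tensorCoactL k A).lTensor A ∘ₗ tensorCoactL k A at h'
    have e : cL.lTensor A ∘ₗ Φ.lTensor A = (Φ.lTensor A).lTensor A ∘ₗ (tensorCoactL k A).lTensor A := by
      rw [← LinearMap.lTensor_comp, hcL, LinearMap.lTensor_comp]
    refine LinearMap.ext fun z => ?_
    have hcL := LinearMap.congr_fun hcL
    have h := LinearMap.congr_fun h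
    have h' := LinearMap.congr_fun h'
    have e := LinearMap.congr_fun e
    simp only [LinearMap.comp_apply] at hcL h h' e ⊢
    rw [hcL, h, h', e]
  coactL_counit := by
    rw [← LinearMap.cancel_right hΦ, LinearMap.comp_assoc, hcL, ← LinearMap.comp_assoc]
    have h' := (Bialgebra.mulCoalgHom k A).counit_left
    change _ ∘ₗ tensorCoactL k A = _ at h'
    rw [LinearMap.rTensor_comp_lTensor, ← LinearMap.lTensor_comp_rTensor, LinearMap.comp_assoc, h']
    rfl
  coactR_coassoc := by
    rw [← LinearMap.cancel_right hΦ]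
    have h : (TensorProduct.assoc k F A A).toLinearMap ∘ₗ (Φ.rTensor A).rTensor A =
        Φ.rTensor (A ⊗[k] A) ∘ₗ (TensorProduct.assoc k (A ⊗[k] A) A A).toLinearMap := by
      simp only [coassoc_simps]
    have h' := (Bialgebra.mulCoalgHom k A).coassoc_right
    change _ ∘ₗ (tensorCoactR k A).rTensor A ∘ₗ tensorCoactR k A = _ ∘ₗ tensorCoactR k A at h'
    have e : cR.rTensor A ∘ₗ Φ.rTensor A = (Φ.rTensor A).rTensor A ∘ₗ (tensorCoactR k A).rTensor A := by
      rw [← LinearMap.rTensor_comp, hcR, LinearMap.rTensor_comp]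
    have e' : Coalgebra.comul.lTensor F ∘ₗ Φ.rTensor A =
        Φ.rTensor (A ⊗[k] A) ∘ₗ Coalgebra.comul.lTensor (A ⊗[k] A) := by
      rw [LinearMap.rTensor_comp_lTensor, LinearMap.lTensor_comp_rTensor]
    refine LinearMap.ext fun z => ?_
    have hcR := LinearMap.congr_fun hcR
    have h := LinearMap.congr_fun h
    have h' := LinearMap.congr_fun h'
    have e := LinearMap.congr_fun e
    have e' := LinearMap.congr_fun e'
    simp only [LinearMap.comp_apply] at hcR h h' e e' ⊢
    rw [hcR, e, h, h', e']
  coactR_counit := by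
    rw [← LinearMap.cancel_right hΦ, LinearMap.comp_assoc, hcR, ← LinearMap.comp_assoc]
    have h' := (Bialgebra.mulCoalgHom k A).counit_right
    change _ ∘ₗ tensorCoactR k A = _ at h'
    rw [LinearMap.lTensor_comp_rTensor, ← LinearMap.rTensor_comp_lTensor, LinearMap.comp_assoc, h']
    rfl
  coactL_coactR := by
    rw [← LinearMap.cancel_right hΦ]
    have h : (TensorProduct.assoc k A F A).toLinearMap ∘ₗ (Φ.lTensor A).rTensor A =
        (Φ.rTensor A).lTensor A ∘ₗ (TensorProduct.assoc k A (A ⊗[k] A) A).toLinearMap := by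
      simp only [coassoc_simps]
    have h' := (Bialgebra.mulCoalgHom k A).coassoc_middle (Bialgebra.mulCoalgHom k A)
    change _ ∘ₗ (tensorCoactL k A).rTensor A ∘ₗ tensorCoactR k A =
      (tensorCoactR k A).lTensor A ∘ₗ tensorCoactL k A at h'
    have e : cL.rTensor A ∘ₗ Φ.rTensor A = (Φ.lTensor A).rTensor A ∘ₗ (tensorCoactL k A).rTensor A := by
      rw [← LinearMap.rTensor_comp, hcL, LinearMap.rTensor_comp]
    have e' : cR.lTensor A ∘ₗ Φ.lTensor A = (Φ.rTensor A).lTensor A ∘ₗ (tensorCoactR k A).lTensor A := by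
      rw [← LinearMap.lTensor_comp, hcR, LinearMap.lTensor_comp]
    refine LinearMap.ext fun z => ?_
    have hcL := LinearMap.congr_fun hcL
    have hcR := LinearMap.congr_fun hcR
    have h := LinearMap.congr_fun h
    have h' := LinearMap.congr_fun h'
    have e := LinearMap.congr_fun e
    have e' := LinearMap.congr_fun e'
    simp only [LinearMap.comp_apply] at hcL hcR h h' e e' ⊢
    rw [hcR, e, h, h', hcL, e']
  coactL_lmul c ω := by
    induction ω using tensor_surjective_induction hΦ with
    | zero => simp
    | add x y hx hy => simp only [map_add, hx, hy]
    | tmul a b =>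
      have h := fun z => LinearMap.congr_fun hcL z
      simp only [LinearMap.comp_apply] at h
      simp only [hlm, map_sub, h, tensorCoactL_tmul, Bialgebra.comul_mul, ← map₂_lmul_tensor Φ lm hlm]
  coactL_rmul ω c := by
    induction ω using tensor_surjective_induction hΦ with
    | zero => simp
    | add x y hx hy => simp only [map_add, hx, hy, LinearMap.add_apply]
    | tmul a b =>
      have h := fun z => LinearMap.congr_fun hcL z
      simp only [LinearMap.comp_apply] at h
      simp only [hrm, h, tensorCoactL_tmul, Bialgebra.comul_mul, map₂_rmul_tensor Φ rm hrm]
  coactR_lmul c ω := by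
    induction ω using tensor_surjective_induction hΦ with
    | zero => simp
    | add x y hx hy => simp only [map_add, hx, hy]
    | tmul a b =>
      have h := fun z => LinearMap.congr_fun hcR z
      simp only [LinearMap.comp_apply] at h
      simp only [hlm, map_sub, h, tensorCoactR_tmul, Bialgebra.comul_mul, ← map₂_tensor_lmul Φ lm hlm]
  coactR_rmul ω c := by
    induction ω using tensor_surjective_induction hΦ with
    | zero => simp
    | add x y hx hy => simp only [map_add, hx, hy, LinearMap.add_apply]
    | tmul a b =>
      have h := fun z => LinearMap.congr_fun hcR z
      simp only [LinearMap.comp_apply] at h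
      simp only [hrm, h, tensorCoactR_tmul, Bialgebra.comul_mul, map₂_tensor_rmul Φ rm hrm]
  coactL_d := by
    ext a
    have h := fun z => LinearMap.congr_fun hcL z
    simp only [LinearMap.comp_apply, LinearMap.flip_apply, TensorProduct.mk_apply] at h ⊢
    rw [h, tensorCoactL_tmul, Bialgebra.comul_one, Algebra.TensorProduct.one_def]
    induction (Coalgebra.comul (R := k) a) with
    | zero => simp
    | add x y hx hy => simp only [map_add, LinearMap.add_apply, hx, hy]
    | tmul a a' => simp
  coactR_d := by
    ext a
    have h := fun z => LinearMap.congr_fun hcR z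
    simp only [LinearMap.comp_apply, LinearMap.flip_apply, TensorProduct.mk_apply] at h ⊢
    rw [h, tensorCoactR_tmul, Bialgebra.comul_one, Algebra.TensorProduct.one_def]
    induction (Coalgebra.comul (R := k) a) with
    | zero => simp
    | add x y hx hy => simp only [map_add, LinearMap.add_apply, hx, hy]
    | tmul a a' => simp

end Universal
end BicovariantCalculus

/-! ### The calculus with a prescribed kernel of the Maurer–Cartan form. -/

namespace BicovariantCalculus

section Quotient

variable {k : Type u} {A : Type v} [Field k] [Ring A] [HopfAlgebra k A] (K : Submodule k A)

theorem comulMul_tmul (a b : A) :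
    comulMul (k := k) A (a ⊗ₜ b) = Coalgebra.comul (R := k) a * (1 ⊗ₜ b) := by
  simp only [comulMul, LinearMap.comp_apply, LinearMap.rTensor_tmul]
  induction (Coalgebra.comul (R := k) a) with
  | zero => simp
  | add x y hx hy => simp only [map_add, TensorProduct.add_tmul, add_mul, hx, hy]
  | tmul a a' => simp

/-- The action `c ▷ [a] = [ca - ε(a)c]` on the quotient by the kernel of a Maurer-Cartan form. -/
noncomputable def quotientAct
    (hl : ∀ a ∈ K, ∀ c, c * a - (Coalgebra.counit (R := k) a) • c ∈ K) :
    A →ₗ[k] (A ⧸ K) →ₗ[k] (A ⧸ K) :=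
  (K.liftQ (((LinearMap.mul k A).flip - LinearMap.lsmul k A ∘ₗ Coalgebra.counit).compr₂ K.mkQ)
    fun a ha => LinearMap.ext fun c => (Submodule.Quotient.mk_eq_zero K).2 (hl a ha c)).flip

variable {K}

theorem quotientAct_mk (hl : ∀ a ∈ K, ∀ c, c * a - (Coalgebra.counit (R := k) a) • c ∈ K)
    (c a : A) : quotientAct K hl c (K.mkQ a) =
      K.mkQ (c * a) - (Coalgebra.counit (R := k) a) • K.mkQ c := rfl

variable (K) in
/-- The presentation `a ⊗ b ↦ [a₍₁₎] ⊗ a₍₂₎b` of the space of forms `(A ⧸ K) ⊗ A`. -/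
noncomputable def quotientPresentation : A ⊗[k] A →ₗ[k] (A ⧸ K) ⊗[k] A :=
  K.mkQ.rTensor A ∘ₗ comulMul A

/-- The left action `c·([a] ⊗ b) = c₍₁₎▷[a] ⊗ c₍₂₎b` on `(A ⧸ K) ⊗ A` satisfies the rule `c·(d(a)·b)
= d(ca)·b - d(c)·ab` demanded of a presentation. -/
theorem map₂_quotientAct (hl : ∀ a ∈ K, ∀ c, c * a - (Coalgebra.counit (R := k) a) • c ∈ K)
    (c a b : A) :
    TensorProduct.map₂ (quotientAct K hl) (LinearMap.mul k A) (Coalgebra.comul c)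
      (quotientPresentation K (a ⊗ₜ b)) =
    quotientPresentation K ((c * a) ⊗ₜ b) - quotientPresentation K (c ⊗ₜ (a * b)) := by
  -- Here `y` and `x` stand for the coproducts of `c` and `a`; only at the end does `ε(a₍₁₎)a₍₂₎ =
  -- a` enter.
  have key : ∀ y x : A ⊗[k] A, TensorProduct.map₂ (quotientAct K hl) (LinearMap.mul k A) y
      (K.mkQ.rTensor A (x * (1 ⊗ₜ b))) = K.mkQ.rTensor A (y * x * (1 ⊗ₜ b)) -
        K.mkQ.rTensor A (y * (1 ⊗ₜ (TensorProduct.lid k A (Coalgebra.counit.rTensor A x) * b))) := by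
    intro y x
    induction y with
    | zero => simp
    | add y y' hy hy' => simp only [map_add, LinearMap.add_apply, add_mul, hy, hy']; abel
    | tmul c c' =>
    induction x with
    | zero => simp
    | add x x' hx hx' =>
      simp only [map_add, add_mul, mul_add, TensorProduct.tmul_add, hx, hx']; abel
    | tmul a a' =>
      simp only [Algebra.TensorProduct.tmul_mul_tmul, mul_one, LinearMap.rTensor_tmul,
        TensorProduct.map₂_apply_tmul, TensorProduct.map_tmul, quotientAct_mk,
        LinearMap.mul_apply', TensorProduct.lid_tmul, smul_mul_assoc, TensorProduct.sub_tmul,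
        mul_assoc, mul_smul_comm, TensorProduct.tmul_smul, TensorProduct.smul_tmul', map_smul]
  simp only [quotientPresentation, LinearMap.comp_apply, comulMul_tmul, key, Bialgebra.comul_mul]
  congr 3
  have := Coalgebra.rTensor_counit_comul (R := k) a
  rw [this]
  simp

end Quotient

section Codouble

open _root_.Codouble

variable {k : Type u} {G : Type v} [Field k] [Group G] [Fintype G] [DecidableEq G]

/-- The left adjoint coaction `a ↦ a₍₁₎S(a₍₃₎) ⊗ a₍₂₎` of the codouble. -/
noncomputable def adCoact : Codouble k G →ₗ[k] Codouble k G ⊗[k] Codouble k G :=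
  Codouble.lift fun s u => ∑ v, basis (s * u⁻¹ * s⁻¹ * u) v ⊗ₜ basis (v⁻¹ * s * v) (v⁻¹ * u * v)

theorem adCoact_basis (s u : G) : adCoact (basis s u : Codouble k G) =
    ∑ v, basis (s * u⁻¹ * s⁻¹ * u) v ⊗ₜ basis (v⁻¹ * s * v) (v⁻¹ * u * v) :=
  lift_basis _ s u

theorem coactL_maurerCartan_eq (Ω : BicovariantCalculus k (Codouble k G)) (a : Codouble k G) :
    Ω.coactL (Ω.maurerCartan a) = Ω.maurerCartan.lTensor _ (adCoact a) := by
  refine LinearMap.congr_fun (f := Ω.coactL ∘ₗ Ω.maurerCartan)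
    (g := Ω.maurerCartan.lTensor _ ∘ₗ adCoact) (hom_ext fun s u => ?_) a
  simp [coactL_maurerCartan, adCoact_basis]

variable {K : Submodule k (Codouble k G)}

theorem quotientPresentation_basis (s u t w : G) :
    quotientPresentation K (basis s u ⊗ₜ basis t w) =
      K.mkQ (basis s (u * w⁻¹)) ⊗ₜ basis ((u * w⁻¹)⁻¹ * s * (u * w⁻¹) * t) w := by
  have h : ∀ v : G, (basis (v⁻¹ * s * v) (v⁻¹ * u) * basis t w : Codouble k G) =
      if v = u * w⁻¹ then basis ((u * w⁻¹)⁻¹ * s * (u * w⁻¹) * t) w else 0 := by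
    intro v
    rw [basis_mul]
    by_cases hv : v = u * w⁻¹
    · subst hv
      rw [if_pos (by group), if_pos rfl]
      congr 1; group
    · rw [if_neg, if_neg hv]
      rintro rfl
      simp at hv
  simp [quotientPresentation, comulMul_tmul_basis, h, TensorProduct.tmul_ite]

/-- A calculus with a prescribed kernel `K` of the Maurer-Cartan form exists as soon as `K` has the
evident properties of such a kernel. -/
theorem exists_ker_maurerCartan_eq (h1 : 1 ∈ K)
    (hl : ∀ a ∈ K, ∀ c, c * a - (Coalgebra.counit (R := k) a) • c ∈ K)
    (had : ∀ a ∈ K, K.mkQ.lTensor _ (adCoact a) = 0) :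
    ∃ Ω : BicovariantCalculus k (Codouble k G), LinearMap.ker Ω.maurerCartan = K := by
  let δ : (Codouble k G ⧸ K) →ₗ[k] Codouble k G ⊗[k] (Codouble k G ⧸ K) :=
    K.liftQ (K.mkQ.lTensor _ ∘ₗ adCoact) fun a ha => had a ha
  have hδ : ∀ a, δ (K.mkQ a) = K.mkQ.lTensor _ (adCoact a) := fun a => rfl
  -- The forms are `(A ⧸ K) ⊗ A` with `A ⧸ K` as the right-invariant ones: the left coaction
  -- combines the adjoint coaction `δ` with `Δ`, whereas the right coaction and the right action
  -- touch only the factor `A`.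
  let cL : (Codouble k G ⧸ K) ⊗[k] Codouble k G →ₗ[k]
      Codouble k G ⊗[k] ((Codouble k G ⧸ K) ⊗[k] Codouble k G) :=
    TensorProduct.lift ((TensorProduct.map₂ (LinearMap.mul k (Codouble k G))
      (TensorProduct.mk k _ _)).compl₁₂ δ Coalgebra.comul)
  let cR : (Codouble k G ⧸ K) ⊗[k] Codouble k G →ₗ[k]
      ((Codouble k G ⧸ K) ⊗[k] Codouble k G) ⊗[k] Codouble k G :=
    (TensorProduct.assoc k _ _ _).symm.toLinearMap ∘ₗ Coalgebra.comul.lTensor _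
  have hsurj : Function.Surjective (quotientPresentation K) :=
    (LinearMap.rTensor_surjective _ K.mkQ_surjective).comp comulMul_surjective
  let rm : (Codouble k G ⧸ K) ⊗[k] Codouble k G →ₗ[k] Codouble k G →ₗ[k]
      (Codouble k G ⧸ K) ⊗[k] Codouble k G :=
    ((LinearMap.lTensorHom (Codouble k G ⧸ K)) ∘ₗ (LinearMap.mul k _).flip).flip
  have hrm : ∀ a b c, rm (quotientPresentation K (a ⊗ₜ b)) c =
      quotientPresentation K (a ⊗ₜ (b * c)) := fun a b c => by
    have : (1 : Codouble k G) ⊗ₜ[k] (b * c) = (1 ⊗ₜ b) * (1 ⊗ₜ c) := by simp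
    simp only [quotientPresentation, LinearMap.comp_apply, comulMul_tmul, this, ← mul_assoc]
    induction Coalgebra.comul (R := k) a * (1 ⊗ₜ b) with
    | zero => simp
    | add x y hx hy => simp only [map_add, add_mul, hx, hy, LinearMap.add_apply]
    | tmul x y => simp [rm]
  have hcL : cL ∘ₗ quotientPresentation K = (quotientPresentation K).lTensor _ ∘ₗ
      tensorCoactL k (Codouble k G) := by
    refine tensor_hom_ext fun s u t w => ?_
    simp only [LinearMap.comp_apply, quotientPresentation_basis, tensorCoactL_tmul, cL,
      TensorProduct.lift.tmul, LinearMap.compl₁₂_apply, hδ, adCoact_basis, comul_basis, map_sum,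
      LinearMap.sum_apply, LinearMap.lTensor_tmul, TensorProduct.map₂_apply_tmul,
      TensorProduct.map_tmul, TensorProduct.mk_apply, LinearMap.mul_apply', basis_mul,
      TensorProduct.ite_tmul, Finset.sum_ite_eq', Finset.mem_univ, if_true]
    refine Finset.sum_congr rfl fun x _ => ?_
    simp [mul_assoc]
  have hcR : cR ∘ₗ quotientPresentation K = (quotientPresentation K).rTensor _ ∘ₗ
      tensorCoactR k (Codouble k G) := by
    refine tensor_hom_ext (M := ((Codouble k G ⧸ K) ⊗[k] Codouble k G) ⊗[k] Codouble k G)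
      fun s u t w => ?_
    have key : ∀ v x : G, (basis (v⁻¹ * s * v) (v⁻¹ * u) * basis (x⁻¹ * t * x) (x⁻¹ * w) :
        Codouble k G) = if v = u * w⁻¹ * x then
          basis ((u * w⁻¹ * x)⁻¹ * s * (u * w⁻¹ * x) * (x⁻¹ * t * x)) (x⁻¹ * w) else 0 := by
      intro v x
      rw [basis_mul]
      by_cases h : v = u * w⁻¹ * x
      · subst h
        rw [if_pos (by group), if_pos rfl]
        congr 1; group
      · rw [if_neg, if_neg h]
        intro h'
        apply h
        rw [← inv_inj, eq_mul_inv_of_mul_eq h']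
        group
    simp only [LinearMap.comp_apply, quotientPresentation_basis, tensorCoactR_tmul, cR,
      LinearMap.lTensor_tmul, comul_basis, map_sum, TensorProduct.tmul_sum,
      LinearEquiv.coe_coe, TensorProduct.assoc_symm_tmul, LinearMap.sum_apply,
      TensorProduct.map₂_apply_tmul, LinearMap.rTensor_tmul,
      TensorProduct.map_tmul, TensorProduct.mk_apply, LinearMap.mul_apply', key,
      TensorProduct.tmul_ite, Finset.sum_ite_eq', Finset.mem_univ, if_true]
    refine Finset.sum_congr rfl fun x _ => ?_
    simp [mul_assoc]
  let Ω : BicovariantCalculus k (Codouble k G) := ofPresentation (Φ := quotientPresentation K)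
    (lm := TensorProduct.map₂ (quotientAct K hl) (LinearMap.mul k _) ∘ₗ Coalgebra.comul)
    (rm := rm)
    (cL := cL) (cR := cR) hsurj
    (fun b => by
      have : K.mkQ 1 = 0 := (Submodule.Quotient.mk_eq_zero K).2 h1
      rw [quotientPresentation, LinearMap.comp_apply, comulMul_tmul, Bialgebra.comul_one, one_mul,
        LinearMap.rTensor_tmul, this, TensorProduct.zero_tmul])
    (fun c a b => map₂_quotientAct hl c a b)
    hrm hcL hcR
  have hd : ∀ a b, Ω.rmul (Ω.d a) b = quotientPresentation K (a ⊗ₜ b) := fun a b =>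
    (hrm a 1 b).trans (by rw [one_mul])
  -- So `ϖ(a)` is the class of `a`; applying the counit to the second factor then recovers this
  -- class and shows that the kernel is `K`.
  have hΩ : ∀ a, Ω.maurerCartan a = K.mkQ a ⊗ₜ[k] (1 : Codouble k G) := fun a => by
    refine LinearMap.congr_fun (f := Ω.maurerCartan)
      (g := (TensorProduct.mk k (Codouble k G ⧸ K) (Codouble k G)).flip 1 ∘ₗ K.mkQ)
      (hom_ext fun s u => ?_) a
    rw [maurerCartan_basis]
    refine (Finset.sum_congr rfl fun v _ => hd _ _).trans ?_
    change ∑ v, quotientPresentation K (basis s v ⊗ₜ basis (u⁻¹ * s⁻¹ * u) (u⁻¹ * v)) =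
      K.mkQ (basis s u) ⊗ₜ (1 : Codouble k G)
    simp only [quotientPresentation_basis, one_eq, TensorProduct.tmul_sum]
    refine Fintype.sum_equiv (Equiv.mulLeft u⁻¹) _ _ fun v => ?_
    simp [mul_assoc]
  refine ⟨Ω, ?_⟩
  ext a
  rw [LinearMap.mem_ker, hΩ]
  constructor
  · intro h
    have h' : K.mkQ a ⊗ₜ[k] (1 : Codouble k G) = 0 := h
    have := congrArg
      ((TensorProduct.rid k _).toLinearMap ∘ₗ Coalgebra.counit.lTensor (Codouble k G ⧸ K)) h'
    simpa [Bialgebra.counit_one] using this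
  · intro h
    have : K.mkQ a = 0 := (Submodule.Quotient.mk_eq_zero K).2 h
    rw [this, TensorProduct.zero_tmul]
    rfl

end Codouble

end BicovariantCalculus

/-! ### Simple modules and two-sided ideals. -/

section SimpleModule

/-- A two-sided ideal which does not annihilate a finite-dimensional simple module acts on it
by the same operators as the whole algebra. -/
theorem IsSimpleModule.exists_mem_smul_eq (k : Type*) {H W : Type*} [Field k] [Ring H] [Algebra k H]
    [AddCommGroup W] [Module k W] [Module H W] [IsScalarTower k H W] [IsSimpleModule H W]
    [FiniteDimensional k W]
    (J : Ideal H) [J.IsTwoSided]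
    (hJ : ∃ j ∈ J, ∃ w : W, j • w ≠ 0) (h : H) : ∃ j ∈ J, ∀ w : W, j • w = h • w := by
  -- With the basis as one vector `b` of the semisimple module `Wⁿ`, split `b = j·b + x` along `J·b`
  -- and a complement `X`. The goal is `x = 0`: then `j` acts as the identity of `W` and `h * j`
  -- acts as `h`.
  let b := Module.finBasis k W
  let ev : H →ₗ[H] (Fin (Module.finrank k W) → W) := LinearMap.toSpanSingleton H _ b
  obtain ⟨X, hX⟩ := exists_isCompl (Submodule.map ev J)
  obtain ⟨y, hy, x, hx, hyx⟩ := Submodule.mem_sup.1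
    (hX.sup_eq_top.ge (Submodule.mem_top (x := (b : Fin (Module.finrank k W) → W))))
  obtain ⟨j, hj, rfl⟩ := hy
  -- `j'x = (j' - j'j)b` lies in `J·b` and in `X`.
  have hx0 : ∀ j' ∈ J, j' • x = 0 := by
    intro j' hj'
    have h1 : j' • x ∈ Submodule.map ev J := by
      refine ⟨j' - j' * j, sub_mem hj' (J.mul_mem_left _ hj), ?_⟩
      simp only [ev, LinearMap.toSpanSingleton_apply] at hyx ⊢
      rw [sub_smul, mul_smul, ← smul_sub]
      congr 1
      exact sub_eq_iff_eq_add'.2 hyx.symm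
    exact (Submodule.disjoint_def.1 hX.disjoint) _ h1 (X.smul_mem _ hx)
  -- The vectors killed by `J` form a submodule because `J` is also a right ideal; it contains the
  -- coordinates of `x`.
  let N : Submodule H W :=
    { carrier := {w | ∀ j ∈ J, j • w = 0}
      zero_mem' := fun j _ => smul_zero j
      add_mem' := fun ha hb j hj => by rw [smul_add, ha j hj, hb j hj, add_zero]
      smul_mem' := fun c w hw j hj => by rw [← mul_smul]; exact hw _ (J.mul_mem_right _ hj) }
  have hN : N = ⊥ := (eq_bot_or_eq_top N).resolve_right fun hN => by
    obtain ⟨j, hj, w, hw⟩ := hJ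
    exact hw ((hN.ge (Submodule.mem_top (x := w))) j hj)
  have hx' : x = 0 := by
    funext i
    have : x i ∈ N := fun j hj => congrFun (hx0 j hj) i
    rwa [hN, Submodule.mem_bot] at this
  have hjb : ∀ i, j • b i = b i := fun i => by
    rw [hx', add_zero] at hyx
    exact congrFun hyx i
  have hj1 : ∀ w : W, j • w = w := by
    have : Algebra.lsmul k k W j = LinearMap.id := b.ext fun i => hjb i
    exact fun w => LinearMap.congr_fun this w
  exact ⟨h * j, J.mul_mem_left _ hj, fun w => by rw [mul_smul, hj1]⟩

/-- The dimension formula for the image of an algebra in the endomorphisms of a simple module. -/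
theorem IsSimpleModule.finrank_range_lsmul_mul (k H W : Type*) [Field k] [Ring H] [Algebra k H]
    [AddCommGroup W] [Module k W] [Module H W] [IsScalarTower k H W] [IsSimpleModule H W]
    [FiniteDimensional k W] :
    Module.finrank k (LinearMap.range (Algebra.lsmul k k W (A := H)).toLinearMap) *
      Module.finrank k (Module.End H W) = Module.finrank k W ^ 2 := by
  classical
  let D := Module.End H W
  have : IsScalarTower k D W := ⟨fun c f w => rfl⟩
  have : Module.Finite D W := Module.Finite.of_restrictScalars_finite k D W
  let res : Module.End D W →ₗ[k] Module.End k W :=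
    LinearMap.restrictScalarsₗ k D W W k
  have hres : Function.Injective res := LinearMap.restrictScalars_injective k
  have hrange : LinearMap.range res =
      LinearMap.range (Algebra.lsmul k k W (A := H)).toLinearMap := by
    ext f
    constructor
    · rintro ⟨f, rfl⟩
      -- Jacobson density: as `W` is finite over `D`, the image of `H` is all of `End_D(W)`.
      obtain ⟨h, rfl⟩ := Module.Finite.toModuleEnd_moduleEnd_surjective (R := H) (M := W) f
      exact ⟨h, rfl⟩
    · rintro ⟨h, rfl⟩
      exact ⟨Module.toModuleEnd D (S := H) W h, rfl⟩
  rw [← hrange, LinearMap.finrank_range_of_inj hres]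
  -- With `n = dim_D W`, `End_D(W) ≅ Wⁿ` has dimension `n · dim_k W`, while `dim_k D · n = dim_k W`.
  let b := Module.finBasis D W
  rw [← (b.constr k (M' := W)).finrank_eq, Module.finrank_pi_fintype, Finset.sum_const,
    Finset.card_univ, Fintype.card_fin, smul_eq_mul]
  have := Module.finrank_mul_finrank k D W
  nlinarith

/-- Two simple modules are isomorphic if a two-sided ideal acts nontrivially on the second, and
its elements annihilating the first annihilate the second. -/
theorem IsSimpleModule.nonempty_linearEquiv (k : Type*) {H W : Type*} [Field k] [Ring H] [Algebra k H]
    [AddCommGroup W] [Module k W] [Module H W] [IsScalarTower k H W] [IsSimpleModule H W]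
    [FiniteDimensional k W]
    {W' : Type*} [AddCommGroup W'] [Module H W']
    [IsSimpleModule H W'] (J : Ideal H) (hJ : ∃ j ∈ J, ∃ w : W', j • w ≠ 0)
    (hle : ∀ j ∈ J, (∀ w : W, j • w = 0) → ∀ w : W', j • w = 0) : Nonempty (W ≃ₗ[H] W') := by
  obtain ⟨j₀, hj₀, y, hy⟩ := hJ
  let b := Module.finBasis k W
  -- The map `j ↦ j·y` into `W'` factors through `j ↦ j·b` in `Wⁿ`, since `j·b = 0` means that `j`
  -- annihilates `W`. By semisimplicity the factor extends to `Wⁿ`, and some coordinate `W → W'` is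
  -- nonzero, hence an isomorphism by Schur's lemma.
  let f : J →ₗ[H] (Fin (Module.finrank k W) → W) :=
    (LinearMap.toSpanSingleton H _ (b : Fin (Module.finrank k W) → W)) ∘ₗ J.subtype
  let g : J →ₗ[H] W' := (LinearMap.toSpanSingleton H _ y) ∘ₗ J.subtype
  have hfg : LinearMap.ker f ≤ LinearMap.ker g := by
    intro j hj
    refine hle j j.2 (fun w => ?_) y
    have : Algebra.lsmul k k W (j : H) = 0 := b.ext fun i => congrFun hj i
    exact LinearMap.congr_fun this w
  obtain ⟨F, hF⟩ := IsSemisimpleModule.extension_property (LinearMap.range f).subtype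
    (Submodule.subtype_injective _)
    ((LinearMap.ker f).liftQ g hfg ∘ₗ f.quotKerEquivRange.symm.toLinearMap)
  have hF0 : F (f ⟨j₀, hj₀⟩) ≠ 0 := by
    have h := LinearMap.congr_fun hF (f.quotKerEquivRange (Submodule.Quotient.mk ⟨j₀, hj₀⟩))
    simp only [LinearMap.comp_apply, LinearEquiv.coe_coe, LinearEquiv.symm_apply_apply] at h
    intro h0
    exact hy (h.symm.trans h0)
  obtain ⟨i, hi⟩ : ∃ i, F ∘ₗ LinearMap.single H (fun _ => W) i ≠ 0 := by
    by_contra! hcon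
    refine hF0 ?_
    have : F = 0 := LinearMap.pi_ext' hcon
    rw [this, LinearMap.zero_apply]
  exact ⟨LinearEquiv.ofBijective _ (LinearMap.bijective_of_ne_zero hi)⟩

end SimpleModule

/-- The quantum double `D(G)`, realized on the space of the codouble through the quantum Killing
form: the element `s ⊗ δ_u` of `D^*(G)` stands for `δ_{sus⁻¹} ⊗ s`. -/
def Double (k : Type u) (G : Type v) [Field k] [Group G] : Type (max u v) := Codouble k G

/-! ### The algebra structure of the quantum double. -/

namespace Double

variable {k : Type u} {G : Type v} [Field k] [Group G]

noncomputable instance : AddCommGroup (Double k G) := inferInstanceAs (AddCommGroup (Codouble k G))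

noncomputable instance : Module k (Double k G) := inferInstanceAs (Module k (Codouble k G))

/-- The identification of the codouble with the double given by the quantum Killing form. -/
noncomputable def ofCodouble : Codouble k G ≃ₗ[k] Double k G := LinearEquiv.refl k _

variable [DecidableEq G] 

/-- The element of the double which corresponds to `s ⊗ δ_u`. -/
noncomputable def basis (s u : G) : Double k G := ofCodouble (Codouble.basis s u)

theorem ofCodouble_basis (s u : G) :
    ofCodouble (Codouble.basis s u : Codouble k G) = basis s u := rfl

variable [Fintype G]

theorem hom_ext {M : Type*} [AddCommGroup M] [Module k M] {f g : Double k G →ₗ[k] M}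
    (h : ∀ s u, f (basis s u) = g (basis s u)) : f = g :=
  Codouble.hom_ext (f := f ∘ₗ ofCodouble.toLinearMap) (g := g ∘ₗ ofCodouble.toLinearMap) h

theorem induction_basis {p : Double k G → Prop} (zero : p 0) (add : ∀ x y, p x → p y → p (x + y))
    (smul : ∀ (c : k) x, p x → p (c • x)) (basis : ∀ s u, p (basis s u)) (x : Double k G) : p x := by
  obtain ⟨a, rfl⟩ := ofCodouble.surjective x
  rw [Codouble.eq_sum a]
  simp only [map_sum, map_smul]
  exact Finset.sum_induction _ p add zero fun s _ =>
    Finset.sum_induction _ p add zero fun u _ => smul _ _ (basis s u)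

variable (k G) in
/-- The product of the double as a bilinear map. -/
noncomputable def mulHom : Double k G →ₗ[k] Double k G →ₗ[k] Double k G :=
  Codouble.lift (fun s u => Codouble.lift (fun t v =>
    if u = t * v * t⁻¹ then basis (s * t) v else 0) ∘ₗ ofCodouble.symm.toLinearMap) ∘ₗ
      ofCodouble.symm.toLinearMap

/-- With `basis s u` read as `s·δ_u = δ_{sus⁻¹}·s`, this is the cross relation `δ_u·t =
t·δ_{t⁻¹ut}`. -/
theorem mulHom_basis (s u t v : G) : mulHom k G (basis s u) (basis t v) =
    if u = t * v * t⁻¹ then basis (s * t) v else 0 := by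
  simp only [mulHom, basis, LinearMap.comp_apply, LinearEquiv.coe_coe, LinearEquiv.symm_apply_apply,
    Codouble.lift_basis]

variable (k) in
/-- The group element `s` in the double. -/
noncomputable def of (s : G) : Double k G := ∑ u, basis s u

theorem mulHom_assoc (x y z : Double k G) :
    mulHom k G (mulHom k G x y) z = mulHom k G x (mulHom k G y z) := by
  induction x using induction_basis with
  | zero => simp
  | add x x' h h' => simp only [map_add, LinearMap.add_apply, h, h']
  | smul c x h => simp only [map_smul, LinearMap.smul_apply, h]
  | basis s u =>
  induction y using induction_basis with
  | zero => simp
  | add x x' h h' => simp only [map_add, LinearMap.add_apply, h, h']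
  | smul c x h => simp only [map_smul, LinearMap.smul_apply, h]
  | basis t v =>
  induction z using induction_basis with
  | zero => simp
  | add x x' h h' => simp only [map_add, h, h']
  | smul c x h => simp only [map_smul, h]
  | basis r w =>
    rw [mulHom_basis, mulHom_basis]
    by_cases h : v = r * w * r⁻¹
    · rw [if_pos h, mulHom_basis]
      subst h
      have : u = t * (r * w * r⁻¹) * t⁻¹ ↔ u = t * r * w * (t * r)⁻¹ := by
        rw [mul_inv_rev]; simp only [mul_assoc]
      by_cases h' : u = t * r * w * (t * r)⁻¹
      · rw [if_pos (this.2 h'), if_pos h', mulHom_basis, if_pos rfl, mul_assoc]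
      · rw [if_neg (mt this.1 h'), if_neg h', map_zero, LinearMap.zero_apply]
    · rw [if_neg h, map_zero]
      split_ifs
      · rw [mulHom_basis, if_neg h]
      · rw [map_zero, LinearMap.zero_apply]

theorem one_mulHom (x : Double k G) : mulHom k G (of k 1) x = x := by
  refine LinearMap.congr_fun (f := mulHom k G (of k 1)) (g := LinearMap.id)
    (hom_ext fun s u => ?_) x
  simp [of, mulHom_basis]

theorem mulHom_one (x : Double k G) : mulHom k G x (of k 1) = x := by
  refine LinearMap.congr_fun (f := (mulHom k G).flip (of k 1)) (g := LinearMap.id)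
    (hom_ext fun s u => ?_) x
  simp [of, mulHom_basis]

noncomputable instance : Ring (Double k G) where
  __ := (inferInstance : AddCommGroup (Double k G))
  mul x y := mulHom k G x y
  one := of k 1
  mul_assoc := mulHom_assoc
  one_mul := one_mulHom
  mul_one := mulHom_one
  left_distrib x y z := map_add (mulHom k G x) y z
  right_distrib x y z := by
    change mulHom k G (x + y) z = mulHom k G x z + mulHom k G y z
    rw [map_add, LinearMap.add_apply]
  zero_mul x := by
    change mulHom k G 0 x = 0
    rw [map_zero, LinearMap.zero_apply]
  mul_zero x := map_zero (mulHom k G x)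

noncomputable instance : Algebra k (Double k G) :=
  Algebra.ofModule (fun c x y => by
    change mulHom k G (c • x) y = c • mulHom k G x y
    rw [map_smul, LinearMap.smul_apply]) fun c x y => map_smul (mulHom k G x) c y

theorem basis_mul_basis (s u t v : G) : (basis s u * basis t v : Double k G) =
    if u = t * v * t⁻¹ then basis (s * t) v else 0 := mulHom_basis s u t v

theorem one_eq : (1 : Double k G) = ∑ u, basis 1 u := rfl

theorem ofCodouble_one : ofCodouble (1 : Codouble k G) = 1 := by
  rw [Codouble.one_eq, map_sum]; rfl

theorem of_one : of k (1 : G) = 1 := rfl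

theorem of_mul_basis (s t u : G) : of k s * basis t u = basis (s * t) u := by
  simp [of, Finset.sum_mul, basis_mul_basis]

theorem basis_mul_of (s u t : G) : basis s u * of k t = basis (s * t) (t⁻¹ * u * t) := by
  have h : ∀ v, u = t * v * t⁻¹ ↔ v = t⁻¹ * u * t := fun v => by
    constructor <;> rintro rfl <;> group
  simp [of, Finset.mul_sum, basis_mul_basis, h]

theorem of_mul_of (s t : G) : of k s * of k t = of k (s * t) := by
  rw [of, of, Finset.mul_sum]
  exact Finset.sum_congr rfl fun u _ => of_mul_basis s t u

theorem basis_one_mul_basis (t s u : G) :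
    (basis 1 t * basis s u : Double k G) = if t = s * u * s⁻¹ then basis s u else 0 := by
  rw [basis_mul_basis, one_mul]

theorem basis_mul_basis_one (t s u : G) :
    (basis s u * basis 1 t : Double k G) = if u = t then basis s u else 0 := by
  rw [basis_mul_basis, mul_one, one_mul, inv_one, mul_one]
  split_ifs with h
  · rw [h]
  · rfl

theorem of_mul_basis_one (s u : G) : of k s * basis 1 u = basis s u := by
  rw [of_mul_basis, mul_one]

theorem basis_one_mul_of (s u : G) : basis 1 (s * u * s⁻¹) * of k s = basis s u := by
  rw [basis_mul_of, one_mul]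
  congr 1; group

variable (k G) in
/-- The counit of the double. -/
noncomputable def counit : Double k G →ₐ[k] k :=
  AlgHom.ofLinearMap (Coalgebra.counit ∘ₗ ofCodouble.symm.toLinearMap)
    (by
      rw [← ofCodouble_one, LinearMap.comp_apply, LinearEquiv.coe_coe,
        LinearEquiv.symm_apply_apply, Bialgebra.counit_one])
    (fun x y => by
      have hb : ∀ s u : G, (Coalgebra.counit ∘ₗ ofCodouble.symm.toLinearMap) (basis s u) =
        (if u = 1 then 1 else 0 : k) := Codouble.counit_basis
      induction x using induction_basis with
      | zero => simp
      | add x x' h h' => simp only [map_add, add_mul, h, h']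
      | smul c x h => simp only [map_smul, smul_mul_assoc, h]
      | basis s u =>
      induction y using induction_basis with
      | zero => simp
      | add x x' h h' => simp only [map_add, mul_add, h, h']
      | smul c x h => simp only [map_smul, mul_smul_comm, h]
      | basis t v =>
        rw [basis_mul_basis, hb, hb]
        by_cases hv : v = 1
        · subst hv
          by_cases hu : u = 1 <;> simp [hu, hb]
        · by_cases hu : u = t * v * t⁻¹ <;> simp [hu, hb, hv])

theorem counit_ofCodouble (a : Codouble k G) : counit k G (ofCodouble a) = Coalgebra.counit a := rfl

theorem counit_basis (s u : G) : counit k G (basis s u) = if u = 1 then 1 else 0 :=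
  Codouble.counit_basis s u

end Double

/-! ### Bicovariant calculi and two-sided ideals of the double -/

namespace BicovariantCalculus

open Double (ofCodouble of)

variable {k : Type u} {G : Type v} [Field k] [Group G] [Fintype G] [DecidableEq G]

/-- Group elements and functions commute in the codouble, so in the double the factor `t` can be
read on the left and `δ_w` on the right. This gives half of the two-sided ideal property. -/
theorem ofCodouble_basis_mul (t w : G) (b : Codouble k G) :
    ofCodouble (Codouble.basis t w * b) = of k t * ofCodouble b * Double.basis 1 w := by
  refine LinearMap.congr_fun (f := ofCodouble.toLinearMap ∘ₗ LinearMap.mulLeft k _)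
    (g := LinearMap.mulRight k _ ∘ₗ LinearMap.mulLeft k _ ∘ₗ ofCodouble.toLinearMap)
    (Codouble.hom_ext fun s u => ?_) b
  simp only [LinearMap.comp_apply, LinearMap.mulLeft_apply, LinearMap.mulRight_apply,
    LinearEquiv.coe_coe, Codouble.basis_mul, Double.ofCodouble_basis, Double.of_mul_basis,
    Double.basis_mul_basis_one, eq_comm (a := w)]
  split_ifs with h
  · rw [h, Double.ofCodouble_basis]
  · rw [map_zero]

/-- The component of a double element of degree `x` for the grading of `δ_t a δ_u` by `t⁻¹u`. -/
noncomputable def gradedPart (x : G) : Double k G →ₗ[k] Double k G :=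
  ∑ t, LinearMap.mulRight k (Double.basis 1 (t * x)) ∘ₗ LinearMap.mulLeft k (Double.basis 1 t)

theorem gradedPart_apply (x : G) (b : Double k G) :
    gradedPart x b = ∑ t, Double.basis 1 t * b * Double.basis 1 (t * x) := by
  simp [gradedPart]

/-- As `s·δ_u = δ_{sus⁻¹}·s·δ_u`, its degree is `(sus⁻¹)⁻¹u`, the very group element appearing in
the adjoint coaction of `s ⊗ δ_u`. -/
theorem gradedPart_basis (x s u : G) : gradedPart x (Double.basis s u : Double k G) =
    if x = s * u⁻¹ * s⁻¹ * u then Double.basis s u else 0 := by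
  have h : u = s * u * s⁻¹ * x ↔ x = s * u⁻¹ * s⁻¹ * u := by
    constructor
    · intro h
      calc x = (s * u * s⁻¹)⁻¹ * (s * u * s⁻¹ * x) := by group
        _ = _ := by rw [← h]; group
    · rintro rfl; group
  simp [gradedPart_apply, Double.basis_one_mul_basis, ite_mul, Double.basis_mul_basis_one, h]

theorem sum_gradedPart (b : Double k G) : ∑ x, gradedPart x b = b := by
  refine LinearMap.congr_fun (f := ∑ x, gradedPart x) (g := LinearMap.id)
    (Double.hom_ext fun s u => ?_) b |> fun h => by simpa using h
  simp [gradedPart_basis]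

/-- Once `δ_u` is fixed on the right, the degree determines the `δ_w` on the left. Thus left
multiplication by `δ_w` is recovered from graded parts and right multiplications. -/
theorem gradedPart_mul_basis_one (w u : G) (b : Double k G) :
    gradedPart (w⁻¹ * u) b * Double.basis 1 u = Double.basis 1 w * b * Double.basis 1 u := by
  have h : ∀ t, t * (w⁻¹ * u) = u ↔ t = w := fun t => by
    rw [← mul_assoc, mul_eq_right, mul_inv_eq_one]
  have h' : ∀ t : G, Double.basis 1 (t * (w⁻¹ * u)) * Double.basis 1 u =
      if t = w then (Double.basis 1 u : Double k G) else 0 := fun t => by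
    rw [Double.basis_mul_basis_one]
    by_cases e : t = w
    · subst e; simp
    · rw [if_neg (mt (h t).1 e), if_neg e]
  simp [gradedPart_apply, Finset.sum_mul, mul_assoc, h']

/-- The components of the adjoint coaction. -/
theorem adCoact_eq_sum (b : Codouble k G) : adCoact b = ∑ v, ∑ x, Codouble.basis x v ⊗ₜ
    ofCodouble.symm (of k v⁻¹ * gradedPart x (ofCodouble b) * of k v) := by
  let F : G → G → Codouble k G →ₗ[k] Codouble k G := fun v x => ofCodouble.symm.toLinearMap ∘ₗ
    LinearMap.mulRight k (of k v) ∘ₗ LinearMap.mulLeft k (of k v⁻¹) ∘ₗ gradedPart x ∘ₗ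
      ofCodouble.toLinearMap
  have hF : ∀ v x s u, F v x (Codouble.basis s u) = if x = s * u⁻¹ * s⁻¹ * u then
      Codouble.basis (v⁻¹ * s * v) (v⁻¹ * u * v) else 0 := by
    intro v x s u
    simp only [F, LinearMap.comp_apply, LinearMap.mulLeft_apply, LinearMap.mulRight_apply,
      LinearEquiv.coe_coe, Double.ofCodouble_basis, gradedPart_basis]
    split_ifs
    · rw [Double.of_mul_basis, Double.basis_mul_of, ← Double.ofCodouble_basis,
        LinearEquiv.symm_apply_apply]
    · simp
  refine LinearMap.congr_fun (f := adCoact)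
    (g := ∑ v, ∑ x, TensorProduct.mk k _ _ (Codouble.basis x v) ∘ₗ F v x)
    (Codouble.hom_ext fun s u => ?_) b |> fun h => by simpa [F] using h
  simp [adCoact_basis, hF, TensorProduct.tmul_ite]

theorem sum_tmul_basis_eq_zero {M : Type*} [AddCommGroup M] [Module k M] (m : G → G → M)
    (h : ∑ v, ∑ x, (Codouble.basis x v : Codouble k G) ⊗ₜ[k] m v x = 0) (v x : G) : m v x = 0 := by
  have := congrArg (TensorProduct.lid k M ∘ (Codouble.coeff x v).rTensor M) h
  simpa [Codouble.coeff_basis, ite_and] using this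

/-- `Δ_L ϖ(b)` vanishes with `ϖ(b)`, hence so does each of its coefficients along the basis of the
first tensor factor. This is where left covariance enters. -/
theorem maurerCartan_adCoact (Ω : BicovariantCalculus k (Codouble k G)) {b : Codouble k G}
    (hb : Ω.maurerCartan b = 0) (v x : G) : Ω.maurerCartan
      (ofCodouble.symm (of k v⁻¹ * gradedPart x (ofCodouble b) * of k v)) = 0 := by
  have h := Ω.coactL_maurerCartan_eq b
  rw [hb, map_zero, adCoact_eq_sum] at h
  simp only [map_sum, LinearMap.lTensor_tmul] at h
  exact sum_tmul_basis_eq_zero (fun v x => Ω.maurerCartan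
      (ofCodouble.symm (of k v⁻¹ * gradedPart x (ofCodouble b) * of k v))) h.symm v x

/-- The kernel of the Maurer-Cartan form in the augmentation ideal, as a subspace of the double. -/
noncomputable def idealSubmodule (Ω : BicovariantCalculus k (Codouble k G)) :
    Submodule k (Double k G) :=
  LinearMap.ker (Ω.maurerCartan ∘ₗ ofCodouble.symm.toLinearMap) ⊓
    LinearMap.ker (Double.counit k G).toLinearMap

variable (Ω : BicovariantCalculus k (Codouble k G))

theorem mem_idealSubmodule {b : Double k G} : b ∈ Ω.idealSubmodule ↔
    Ω.maurerCartan (ofCodouble.symm b) = 0 ∧ Double.counit k G b = 0 := Iff.rfl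

/-- In the product rule both terms vanish, one since `ϖ(b) = 0` and the other since `ε(b) = 0`. -/
theorem of_mul_mul_mem {b : Double k G} (hb : b ∈ Ω.idealSubmodule) (t w : G) :
    of k t * b * Double.basis 1 w ∈ Ω.idealSubmodule := by
  have hb' := Ω.mem_idealSubmodule.1 hb
  refine Ω.mem_idealSubmodule.2 ⟨?_, by simp [hb'.2]⟩
  obtain ⟨b, rfl⟩ := ofCodouble.surjective b
  rw [Double.counit_ofCodouble, LinearEquiv.symm_apply_apply] at hb'
  rw [← ofCodouble_basis_mul, LinearEquiv.symm_apply_apply, maurerCartan_basis_mul, hb'.1, hb'.2]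
  simp

theorem mul_basis_one_mem {b : Double k G} (hb : b ∈ Ω.idealSubmodule) (w : G) :
    b * Double.basis 1 w ∈ Ω.idealSubmodule := by
  simpa [Double.of_one] using Ω.of_mul_mul_mem hb 1 w

theorem of_mul_mem {b : Double k G} (hb : b ∈ Ω.idealSubmodule) (t : G) :
    of k t * b ∈ Ω.idealSubmodule := by
  rw [← mul_one (of k t * b), Double.one_eq, Finset.mul_sum]
  exact sum_mem fun w _ => Ω.of_mul_mul_mem hb t w

theorem conj_gradedPart_mem {b : Double k G} (hb : b ∈ Ω.idealSubmodule) (v x : G) :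
    of k v⁻¹ * gradedPart x b * of k v ∈ Ω.idealSubmodule := by
  have hb' := Ω.mem_idealSubmodule.1 hb
  refine Ω.mem_idealSubmodule.2 ⟨?_, ?_⟩
  · exact Ω.maurerCartan_adCoact hb'.1 v x
  · simp [gradedPart_apply, hb'.2]

theorem gradedPart_mem {b : Double k G} (hb : b ∈ Ω.idealSubmodule) (x : G) :
    gradedPart x b ∈ Ω.idealSubmodule := by
  simpa [Double.of_one] using Ω.conj_gradedPart_mem hb 1 x

/-- Write `b·t = t·(t⁻¹bt)` and split the conjugate into conjugates of graded parts. -/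
theorem mul_of_mem {b : Double k G} (hb : b ∈ Ω.idealSubmodule) (t : G) :
    b * of k t ∈ Ω.idealSubmodule := by
  have h : b * of k t = of k t * ∑ x, of k t⁻¹ * gradedPart x b * of k t := by
    rw [← Finset.sum_mul, ← Finset.mul_sum, sum_gradedPart, ← mul_assoc, ← mul_assoc,
      Double.of_mul_of, mul_inv_cancel, Double.of_one, one_mul]
  rw [h]
  exact Ω.of_mul_mem (sum_mem fun x _ => Ω.conj_gradedPart_mem hb t x) t

theorem basis_one_mul_mem {b : Double k G} (hb : b ∈ Ω.idealSubmodule) (w : G) :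
    Double.basis 1 w * b ∈ Ω.idealSubmodule := by
  rw [← mul_one (Double.basis 1 w * b), Double.one_eq, Finset.mul_sum]
  refine sum_mem fun u _ => ?_
  rw [← gradedPart_mul_basis_one]
  exact Ω.mul_basis_one_mem (Ω.gradedPart_mem hb _) u

/-- The two-sided ideal of the double attached to a bicovariant calculus. -/
noncomputable def ideal : Ideal (Double k G) where
  __ := Ω.idealSubmodule
  smul_mem' c b hb := by
    change c * b ∈ Ω.idealSubmodule
    induction c using Double.induction_basis with
    | zero => rw [zero_mul]; exact zero_mem _
    | add x y hx hy => rw [add_mul]; exact add_mem hx hy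
    | smul c x hx => rw [smul_mul_assoc]; exact Submodule.smul_mem _ _ hx
    | basis s u =>
      rw [← Double.of_mul_basis_one, mul_assoc]
      exact Ω.of_mul_mem (Ω.basis_one_mul_mem hb u) s

theorem mem_ideal {b : Double k G} : b ∈ Ω.ideal ↔
    Ω.maurerCartan (ofCodouble.symm b) = 0 ∧ Double.counit k G b = 0 := Iff.rfl

instance : Ω.ideal.IsTwoSided where
  mul_mem_of_left {b} c hb := by
    change b * c ∈ Ω.idealSubmodule
    induction c using Double.induction_basis with
    | zero => rw [mul_zero]; exact zero_mem _
    | add x y hx hy => rw [mul_add]; exact add_mem hx hy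
    | smul c x hx => rw [mul_smul_comm]; exact Submodule.smul_mem _ _ hx
    | basis s u =>
      rw [← Double.of_mul_basis_one, ← mul_assoc]
      exact Ω.mul_basis_one_mem (Ω.mul_of_mem hb s) u

/-- As `ϖ(1) = 0`, subtracting `ε(a)·1` moves `a` into the augmentation ideal without changing
`ϖ(a)`; so the ideal remembers the whole kernel. -/
theorem maurerCartan_eq_zero_iff (a : Codouble k G) : Ω.maurerCartan a = 0 ↔
    ofCodouble a - (Coalgebra.counit a : k) • 1 ∈ Ω.ideal := by
  have h : ofCodouble a - (Coalgebra.counit a : k) • 1 =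
      ofCodouble (a - (Coalgebra.counit a : k) • 1) := by
    rw [map_sub, map_smul, Double.ofCodouble_one]
  rw [h, mem_ideal, LinearEquiv.symm_apply_apply, Double.counit_ofCodouble, map_sub,
    map_smul, maurerCartan_one, map_sub, map_smul, Bialgebra.counit_one]
  simp

variable {Ω} in
theorem ker_maurerCartan_le_iff {Ω' : BicovariantCalculus k (Codouble k G)} :
    LinearMap.ker Ω.maurerCartan ≤ LinearMap.ker Ω'.maurerCartan ↔ Ω.ideal ≤ Ω'.ideal := by
  constructor
  · intro h b hb
    exact Ω'.mem_ideal.2 ⟨h (Ω.mem_ideal.1 hb).1, (Ω.mem_ideal.1 hb).2⟩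
  · intro h a ha
    rw [LinearMap.mem_ker, maurerCartan_eq_zero_iff] at ha ⊢
    exact h ha

/-- Every two-sided ideal of the double inside the augmentation ideal comes from a calculus. -/
theorem exists_ideal_eq (J : Ideal (Double k G)) [J.IsTwoSided]
    (hJ : ∀ b ∈ J, Double.counit k G b = 0) :
    ∃ Ω : BicovariantCalculus k (Codouble k G), Ω.ideal = J := by
  -- The candidate kernel is `k·1 + J`, described as the `a` with `a - ε(a)·1 ∈ J`.
  let K : Submodule k (Codouble k G) := (J.restrictScalars k).comap
    (ofCodouble.toLinearMap - (Coalgebra.counit (R := k) (A := Codouble k G)).smulRight 1)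
  have hK : ∀ a, a ∈ K ↔ ofCodouble a - (Coalgebra.counit a : k) • 1 ∈ J := fun a => Iff.rfl
  have h1 : 1 ∈ K := by
    rw [hK, Double.ofCodouble_one, Bialgebra.counit_one, one_smul, sub_self]
    exact zero_mem _
  have hJK : ∀ b, ofCodouble b ∈ J → b ∈ K := fun b hb => by
    rw [hK, ← Double.counit_ofCodouble, hJ _ hb, zero_smul, sub_zero]
    exact hb
  have hmul : ∀ (c b : Codouble k G), ofCodouble b ∈ J → ofCodouble (c * b) ∈ J := by
    intro c b hb
    rw [Codouble.eq_sum c]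
    simp only [Finset.sum_mul, map_sum, smul_mul_assoc, map_smul, ofCodouble_basis_mul]
    exact sum_mem fun s _ => sum_mem fun u _ => (J.restrictScalars k).smul_mem _
      (J.mul_mem_right _ (J.mul_mem_left _ hb))
  have hsub : ∀ a ∈ K, ofCodouble (a - (Coalgebra.counit a : k) • 1) ∈ J := fun a ha => by
    rw [map_sub, map_smul, Double.ofCodouble_one]
    exact (hK a).1 ha
  obtain ⟨Ω, hΩ⟩ := exists_ker_maurerCartan_eq h1
    (fun a ha c => by
      have := hJK _ (hmul c _ (hsub a ha))
      rwa [mul_sub, mul_smul_comm, mul_one] at this)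
    (fun a ha => by
      have hone : K.mkQ.lTensor (Codouble k G) (adCoact 1) = 0 := by
        have : ∀ v : G, ∑ u : G, Codouble.basis 1 (v⁻¹ * u * v) = (1 : Codouble k G) := fun v => by
          rw [Codouble.one_eq]
          exact Fintype.sum_equiv ((Equiv.mulLeft v⁻¹).trans (Equiv.mulRight v)) _ _ fun u => rfl
        have h0 : K.mkQ 1 = 0 := (Submodule.Quotient.mk_eq_zero K).2 h1
        rw [Codouble.one_eq]
        simp only [map_sum, adCoact_basis, LinearMap.lTensor_tmul]
        rw [Finset.sum_comm]
        simp only [mul_one, one_mul, inv_one, inv_mul_cancel, ← TensorProduct.tmul_sum, ← map_sum,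
          this, h0, TensorProduct.tmul_zero, Finset.sum_const_zero]
      have ha' : a = (a - (Coalgebra.counit a : k) • 1) + (Coalgebra.counit a : k) • 1 := by simp
      rw [ha', map_add, map_smul, map_add, map_smul, hone, smul_zero, add_zero, adCoact_eq_sum]
      simp only [map_sum, LinearMap.lTensor_tmul]
      refine Finset.sum_eq_zero fun v _ => Finset.sum_eq_zero fun x _ => ?_
      have : K.mkQ (ofCodouble.symm (of k v⁻¹ *
          gradedPart x (ofCodouble (a - (Coalgebra.counit a : k) • 1)) * of k v)) = 0 := by
        refine (Submodule.Quotient.mk_eq_zero K).2 (hJK _ ?_)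
        rw [LinearEquiv.apply_symm_apply, gradedPart_apply]
        exact J.mul_mem_right _ (J.mul_mem_left _ (sum_mem fun t _ =>
          J.mul_mem_right _ (J.mul_mem_left _ (hsub a ha))))
      rw [this, TensorProduct.tmul_zero])
  refine ⟨Ω, ?_⟩
  ext b
  obtain ⟨b, rfl⟩ := ofCodouble.surjective b
  have hm : Ω.maurerCartan b = 0 ↔ b ∈ K := by rw [← LinearMap.mem_ker, hΩ]
  rw [mem_ideal, LinearEquiv.symm_apply_apply, hm]
  constructor
  · rintro ⟨h, h0⟩
    rw [hK, ← Double.counit_ofCodouble, h0, zero_smul, sub_zero] at h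
    exact h
  · exact fun h => ⟨hJK b h, hJ _ h⟩

end BicovariantCalculus

theorem Representation.IsIrreducible.nontrivial_space {k G V : Type*} [Field k] [Group G]
    [AddCommGroup V] [Module k V] (π : Representation k G V) [hπ : π.IsIrreducible] :
    Nontrivial V := by
  by_contra hV
  rw [not_nontrivial_iff_subsingleton] at hV
  refine bot_ne_top (α := Subrepresentation π) (SetLike.ext fun x => ?_)
  rw [Subsingleton.elim x 0]
  exact ⟨fun _ => zero_mem (⊤ : Subrepresentation π).toSubmodule,
    fun _ => zero_mem (⊥ : Subrepresentation π).toSubmodule⟩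

/-! ### The representations of the double induced from centralizers -/

namespace DoubleRep

open Double (ofCodouble of)

variable {k : Type u} {G : Type v} [Field k] [Group G] {s₀ : G}

theorem mem_centralizer {g : G} :
    g ∈ Subgroup.centralizer {s₀} ↔ g * s₀ = s₀ * g :=
  Subgroup.mem_centralizer_singleton_iff

theorem conj_eq_iff {g h : G} :
    h⁻¹ * s₀ * h = g⁻¹ * s₀ * g ↔ h * g⁻¹ ∈ Subgroup.centralizer {s₀} := by
  rw [mem_centralizer]
  constructor
  · intro e
    calc h * g⁻¹ * s₀ = h * (g⁻¹ * s₀ * g) * g⁻¹ := by group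
      _ = s₀ * (h * g⁻¹) := by rw [← e]; group
  · intro e
    calc h⁻¹ * s₀ * h = h⁻¹ * (s₀ * (h * g⁻¹)) * g := by group
      _ = _ := by rw [← e]; group

/-- A section of the orbit map of the class of `s₀`. -/
theorem exists_section (s₀ : G) : ∃ r : (ConjClasses.mk s₀).carrier → G,
    ∀ s, (r s)⁻¹ * s₀ * r s = s := by
  have : ∀ s : (ConjClasses.mk s₀).carrier, ∃ g : G, g⁻¹ * s₀ * g = s := by
    rintro ⟨s, hs⟩
    rw [ConjClasses.mem_carrier_iff_mk_eq, ConjClasses.mk_eq_mk_iff_isConj, isConj_iff] at hs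
    obtain ⟨c, rfl⟩ := hs
    exact ⟨c, by group⟩
  choose r hr using this
  exact ⟨r, hr⟩

theorem conj_mem_carrier (s₀ h : G) : h⁻¹ * s₀ * h ∈ (ConjClasses.mk s₀).carrier := by
  rw [ConjClasses.mem_carrier_iff_mk_eq, ConjClasses.mk_eq_mk_iff_isConj, isConj_iff]
  exact ⟨h, by group⟩

variable {V : Type u} [AddCommGroup V] [Module k V]
  {π : Representation k (Subgroup.centralizer {s₀}) V}

theorem apply_mul (f : Space π) (g : Subgroup.centralizer {s₀}) (h : G) :
    f.1 (g * h) = π g (f.1 h) := f.2 g h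

variable (π) [DecidableEq G]

instance : DecidablePred (· ∈ Subgroup.centralizer {s₀}) := fun _ =>
  decidable_of_iff _ mem_centralizer.symm

theorem act_apply (s u : G) (f : Space π) (h : G) :
    (act π s u f).1 h = if h⁻¹ * s₀ * h = s then f.1 (h * u) else 0 := rfl

/-- The functions in `W` supported on the centralizer. -/
noncomputable def supported : V →ₗ[k] Space π where
  toFun x := ⟨fun g => if hg : g ∈ Subgroup.centralizer {s₀} then π ⟨g, hg⟩ x else 0, by
    intro g h
    change (if hg : (g : G) * h ∈ Subgroup.centralizer {s₀} then π ⟨(g : G) * h, hg⟩ x else 0) =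
      π g (if hg : h ∈ Subgroup.centralizer {s₀} then π ⟨h, hg⟩ x else 0)
    by_cases hh : h ∈ Subgroup.centralizer {s₀}
    · have hgh : (g : G) * h ∈ Subgroup.centralizer {s₀} := mul_mem g.2 hh
      rw [dif_pos hgh, dif_pos hh, ← Module.End.mul_apply, ← map_mul]
      rfl
    · have hgh : ¬ (g : G) * h ∈ Subgroup.centralizer {s₀} := fun H =>
        hh ((Subgroup.mul_mem_cancel_left _ g.2).1 H)
      rw [dif_neg hgh, dif_neg hh, map_zero]⟩
  map_add' x y := by
    ext g
    simp only [Submodule.coe_add, Pi.add_apply]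
    split_ifs <;> simp
  map_smul' c x := by
    ext g
    simp only [Submodule.coe_smul, Pi.smul_apply, RingHom.id_apply]
    split_ifs <;> simp

theorem supported_apply (x : V) (g : G) : (supported π x).1 g =
    if hg : g ∈ Subgroup.centralizer {s₀} then π ⟨g, hg⟩ x else 0 := rfl

theorem supported_apply_one (x : V) : (supported π x).1 1 = x := by
  rw [supported_apply, dif_pos (one_mem _)]
  change π 1 x = x
  rw [map_one]; rfl

variable [Fintype G]

theorem killing_basis (s u : G) :
    killing π (Codouble.basis s u) = act π (s * u * s⁻¹) s :=
  Codouble.lift_basis _ s u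

/-- The representation of the double as a homomorphism of algebras. -/
noncomputable def killingHom : Double k G →ₐ[k] Module.End k (Space π) :=
  AlgHom.ofLinearMap (killing π ∘ₗ ofCodouble.symm.toLinearMap)
    (by
      rw [← Double.ofCodouble_one, LinearMap.comp_apply, LinearEquiv.coe_coe,
        LinearEquiv.symm_apply_apply, Codouble.one_eq, map_sum]
      ext f h
      simp only [killing_basis, LinearMap.sum_apply, Submodule.coe_sum, Finset.sum_apply, act_apply]
      simp)
    (fun x y => by
      have hb : ∀ s u : G, (killing π ∘ₗ ofCodouble.symm.toLinearMap) (Double.basis s u) =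
        act π (s * u * s⁻¹) s := killing_basis π
      induction x using Double.induction_basis with
      | zero => simp
      | add x x' h h' => simp only [map_add, add_mul, h, h']
      | smul c x h => simp only [map_smul, smul_mul_assoc, h]
      | basis s u =>
      induction y using Double.induction_basis with
      | zero => simp
      | add x x' h h' => simp only [map_add, mul_add, h, h']
      | smul c x h => simp only [map_smul, mul_smul_comm, h]
      | basis t v =>
        rw [Double.basis_mul_basis, hb, hb, act_mul]
        by_cases h : u = t * v * t⁻¹
        · subst h
          rw [if_pos rfl, if_pos rfl, hb]
          congr 1; group
        · rw [if_neg h, if_neg, map_zero]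
          simpa using h)

theorem killingHom_ofCodouble (a : Codouble k G) :
    killingHom π (ofCodouble a) = killing π a := rfl

noncomputable instance : Module (Double k G) (Space π) :=
  Module.compHom _ (killingHom π).toRingHom

variable {π}

theorem smul_def (a : Double k G) (f : Space π) : a • f = killingHom π a f := rfl

instance : IsScalarTower k (Double k G) (Space π) where
  smul_assoc c a f := by simp [smul_def]

theorem basis_smul_apply (s u : G) (f : Space π) (h : G) :
    ((Double.basis s u : Double k G) • f).1 h =
      if h⁻¹ * s₀ * h = s * u * s⁻¹ then f.1 (h * s) else 0 := by
  rw [smul_def, ← Double.ofCodouble_basis, killingHom_ofCodouble, killing_basis, act_apply]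

/-- This element is `δ_{s₀}·h`: translate the coset `G₀h` to `G₀`, then restrict to `G₀`. It
extracts the single value `f(h)` by an operator of the double. -/
theorem basis_smul_eq_supported (f : Space π) (h : G) :
    (Double.basis h (h⁻¹ * s₀ * h) : Double k G) • f = supported π (f.1 h) := by
  ext g
  rw [basis_smul_apply, supported_apply]
  have e : g⁻¹ * s₀ * g = h * (h⁻¹ * s₀ * h) * h⁻¹ ↔ g ∈ Subgroup.centralizer {s₀} := by
    have : h * (h⁻¹ * s₀ * h) * h⁻¹ = 1⁻¹ * s₀ * 1 := by group
    rw [this, conj_eq_iff, inv_one, mul_one]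
  by_cases hg : g ∈ Subgroup.centralizer {s₀}
  · rw [if_pos (e.2 hg), dif_pos hg]
    exact apply_mul f ⟨g, hg⟩ h
  · rw [if_neg (mt e.1 hg), dif_neg hg]

theorem basis_smul_supported (x : V) (h g : G) :
    ((Double.basis h⁻¹ s₀ : Double k G) • supported π x).1 g =
      (supported π x).1 (g * h⁻¹) := by
  rw [basis_smul_apply, inv_inv]
  split_ifs with e
  · rfl
  · rw [conj_eq_iff] at e
    rw [supported_apply, dif_neg e]

theorem basis_smul_supported_of_mem (x : V) (g : Subgroup.centralizer {s₀}) :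
    (Double.basis (g : G) s₀ : Double k G) • supported π x = supported π (π g x) := by
  ext h
  have := basis_smul_supported (π := π) x (g : G)⁻¹ h
  rw [inv_inv] at this
  rw [this, supported_apply, supported_apply]
  by_cases hh : h ∈ Subgroup.centralizer {s₀}
  · rw [dif_pos (mul_mem hh g.2), dif_pos hh, ← Module.End.mul_apply, ← map_mul]
    rfl
  · rw [dif_neg hh, dif_neg fun H => hh ((Subgroup.mul_mem_cancel_right _ g.2).1 H)]

/-- A function in `W` is determined by arbitrary values at representatives of the cosets. -/
theorem sum_basis_smul_supported {r : (ConjClasses.mk s₀).carrier → G}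
    (hr : ∀ s, (r s)⁻¹ * s₀ * r s = s) (x : (ConjClasses.mk s₀).carrier → V) (h : G) :
    (∑ s, (Double.basis (r s)⁻¹ s₀ : Double k G) • supported π (x s)).1 h =
      (supported π (x ⟨_, conj_mem_carrier s₀ h⟩)).1 (h * (r ⟨_, conj_mem_carrier s₀ h⟩)⁻¹) := by
  rw [Submodule.coe_sum, Finset.sum_apply, Finset.sum_eq_single ⟨_, conj_mem_carrier s₀ h⟩]
  · exact basis_smul_supported _ _ _
  · intro s _ hs
    rw [basis_smul_supported, supported_apply, dif_neg]
    rw [← conj_eq_iff, hr s]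
    exact fun e => hs (Subtype.ext e.symm)
  · intro h'; exact absurd (Finset.mem_univ _) h'

theorem eq_sum_basis_smul_supported {r : (ConjClasses.mk s₀).carrier → G}
    (hr : ∀ s, (r s)⁻¹ * s₀ * r s = s) (f : Space π) :
    f = ∑ s, (Double.basis (r s)⁻¹ s₀ : Double k G) • supported π (f.1 (r s)) := by
  ext h
  rw [sum_basis_smul_supported hr]
  have hm : h * (r ⟨_, conj_mem_carrier s₀ h⟩)⁻¹ ∈ Subgroup.centralizer {s₀} := by
    rw [← conj_eq_iff, hr]
  rw [supported_apply, dif_pos hm, ← apply_mul]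
  simp

-- A function in `W` is given freely by its values at representatives of the cosets `G₀h`, which are
-- indexed by the class.
variable (π) in
theorem finrank_space [FiniteDimensional k V] : Module.finrank k (Space π) =
    (ConjClasses.mk s₀).carrier.ncard * Module.finrank k V := by
  obtain ⟨r, hr⟩ := exists_section s₀
  let F : Space π →ₗ[k] ((ConjClasses.mk s₀).carrier → V) :=
    LinearMap.funLeft k V r ∘ₗ (Space π).subtype
  have hF : Function.Bijective F := by
    constructor
    · intro f f' e
      rw [eq_sum_basis_smul_supported hr f, eq_sum_basis_smul_supported hr f']
      refine Finset.sum_congr rfl fun s _ => ?_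
      have : f.1 (r s) = f'.1 (r s) := congrFun e s
      rw [this]
    · intro x
      refine ⟨∑ s, (Double.basis (r s)⁻¹ s₀ : Double k G) • supported π (x s), funext fun s => ?_⟩
      change (∑ s, (Double.basis (r s)⁻¹ s₀ : Double k G) • supported π (x s)).1 (r s) = _
      rw [sum_basis_smul_supported hr]
      have : (⟨_, conj_mem_carrier s₀ (r s)⟩ : (ConjClasses.mk s₀).carrier) = s :=
        Subtype.ext (hr s)
      rw [this, mul_inv_cancel, supported_apply_one]
  rw [(LinearEquiv.ofBijective F hF).finrank_eq, Module.finrank_pi_fintype, Finset.sum_const,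
    smul_eq_mul, Finset.card_univ, ← Nat.card_coe_set_eq, Nat.card_eq_fintype_card]

theorem supported_mem (N : Submodule (Double k G) (Space π)) {f : Space π} (hf : f ∈ N) (h : G) :
    supported π (f.1 h) ∈ N := by
  rw [← basis_smul_eq_supported]
  exact N.smul_mem _ hf

/-- A submodule is determined by the vectors of `V` whose functions supported on `G₀` it contains.
They form a subrepresentation, and translates of such functions generate `W`. -/
instance isSimpleModule [hπ : π.IsIrreducible] : IsSimpleModule (Double k G) (Space π) := by
  obtain ⟨r, hr⟩ := exists_section s₀
  have := Representation.IsIrreducible.nontrivial_space π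
  obtain ⟨x₀, hx₀⟩ := exists_ne (0 : V)
  rw [isSimpleModule_iff]
  refine { exists_pair_ne := ⟨⊥, ⊤, fun e => hx₀ ?_⟩, eq_bot_or_eq_top := fun N => ?_ }
  · have : supported π x₀ ∈ (⊥ : Submodule (Double k G) (Space π)) := e ▸ Submodule.mem_top
    rw [Submodule.mem_bot] at this
    rw [← supported_apply_one (π := π) x₀, this]
    rfl
  · let σ : Subrepresentation π :=
      { toSubmodule := (N.restrictScalars k).comap (supported π)
        apply_mem_toSubmodule := fun g x hx => by
          change supported π (π g x) ∈ N
          rw [← basis_smul_supported_of_mem]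
          exact N.smul_mem _ hx }
    have hσ : ∀ x, x ∈ σ ↔ supported π x ∈ N := fun x => Iff.rfl
    refine (eq_bot_or_eq_top σ).imp (fun h => ?_) (fun h => ?_)
    · rw [eq_bot_iff]
      intro f hf
      rw [Submodule.mem_bot]
      ext g
      have : f.1 g ∈ σ := supported_mem N hf g
      rw [h] at this
      exact this
    · rw [eq_top_iff]
      intro f _
      rw [eq_sum_basis_smul_supported hr f]
      refine sum_mem fun s _ => N.smul_mem _ ?_
      rw [← hσ, h]
      trivial

end DoubleRep

/-! ### Homomorphisms between induced representations of the double. -/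

namespace DoubleRep

open Double (ofCodouble of)

variable {k : Type u} {G : Type v} [Field k] [Group G] [Fintype G] [DecidableEq G]
  {s₀ : G} {V V' : Type u} [AddCommGroup V] [Module k V] [AddCommGroup V'] [Module k V']
  {π : Representation k (Subgroup.centralizer {s₀}) V}
  {π' : Representation k (Subgroup.centralizer {s₀}) V'}

/-- The homomorphism of representations of the double induced by an intertwining map. -/
noncomputable def mapSpace (φ : π.IntertwiningMap π') : Space π →ₗ[Double k G] Space π' where
  toFun f := ⟨fun h => φ (f.1 h), fun g h => by
    rw [← φ.isIntertwining, ← apply_mul]; rfl⟩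
  map_add' f f' := by ext h; exact map_add φ _ _
  map_smul' a f := by
    rw [RingHom.id_apply]
    induction a using Double.induction_basis with
    | zero => ext h; simp
    | add x y hx hy =>
      simp only [add_smul, ← hx, ← hy]
      ext h; exact map_add φ _ _
    | smul c x hx =>
      simp only [smul_assoc, ← hx]
      ext h; exact map_smul φ _ _
    | basis s u =>
      ext h
      rw [basis_smul_apply]
      change φ _ = _
      rw [basis_smul_apply]
      split_ifs <;> simp

theorem mapSpace_apply (φ : π.IntertwiningMap π') (f : Space π) (h : G) :
    (mapSpace φ f).1 h = φ (f.1 h) := rfl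

/-- The intertwining map underlying a homomorphism of representations of the double. -/
noncomputable def ofMapSpace (T : Space π →ₗ[Double k G] Space π') : π.IntertwiningMap π' where
  toFun x := (T (supported π x)).1 1
  map_add' x y := by rw [map_add, map_add]; rfl
  map_smul' c x := by
    rw [map_smul, RingHom.id_apply, ← LinearMap.coe_restrictScalars k, map_smul]; rfl
  isIntertwining' g := by
    ext x
    change (T (supported π (π g x))).1 1 = π' g ((T (supported π x)).1 1)
    rw [← basis_smul_supported_of_mem, map_smul, basis_smul_apply, ← apply_mul, if_pos, one_mul,
      mul_one]
    rw [mem_centralizer.1 g.2]; group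

/-- `T` commutes with the operator extracting the value at `h`, so it acts pointwise by one map `V →
V'`. -/
theorem map_apply (T : Space π →ₗ[Double k G] Space π') (f : Space π) (h : G) :
    (T f).1 h = ofMapSpace T (f.1 h) := by
  change _ = (T (supported π (f.1 h))).1 1
  rw [← basis_smul_eq_supported, map_smul, basis_smul_apply, if_pos (by group), one_mul]

theorem mapSpace_bijective : Function.Bijective (mapSpace (π := π) (π' := π')) := by
  constructor
  · intro φ φ' e
    ext x
    have := congrArg (fun T => (T (supported π x)).1 1) e
    simp only [mapSpace_apply, supported_apply_one] at this
    exact this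
  · intro T
    refine ⟨ofMapSpace T, LinearMap.ext fun f => ?_⟩
    ext h
    rw [mapSpace_apply, map_apply]

variable (π π') in
/-- Intertwining maps are the homomorphisms between the representations of the double. -/
noncomputable def mapSpaceEquiv :
    π.IntertwiningMap π' ≃ₗ[k] (Space π →ₗ[Double k G] Space π') :=
  LinearEquiv.ofBijective
    { toFun := mapSpace
      map_add' := fun _ _ => rfl
      map_smul' := fun _ _ => rfl } mapSpace_bijective

theorem nonempty_equiv_of_linearEquiv (e : Space π ≃ₗ[Double k G] Space π') :
    ∃ e' : V ≃ₗ[k] V', ∀ g x, e' (π g x) = π' g (e' x) := by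
  let φ := ofMapSpace e.toLinearMap
  let ψ := ofMapSpace e.symm.toLinearMap
  have h1 : ∀ x, ψ (φ x) = x := fun x => by
    have h := map_apply e.toLinearMap (supported π x) 1
    have h' := map_apply e.symm.toLinearMap (e (supported π x)) 1
    rw [supported_apply_one] at h
    change _ = ψ ((e.toLinearMap (supported π x)).1 1) at h'
    rw [h, LinearEquiv.coe_coe, LinearEquiv.symm_apply_apply, supported_apply_one] at h'
    exact h'.symm
  have h2 : ∀ x, φ (ψ x) = x := fun x => by
    have h := map_apply e.symm.toLinearMap (supported π' x) 1
    have h' := map_apply e.toLinearMap (e.symm (supported π' x)) 1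
    rw [supported_apply_one] at h
    change _ = φ ((e.symm.toLinearMap (supported π' x)).1 1) at h'
    rw [h, LinearEquiv.coe_coe, LinearEquiv.apply_symm_apply, supported_apply_one] at h'
    exact h'.symm
  exact ⟨{ φ.toLinearMap with invFun := ψ, left_inv := h1, right_inv := h2 },
    fun g x => Representation.IntertwiningMap.isIntertwining _ _ φ g x⟩

/-- The class is determined by the representation of the double. -/
theorem isConj_of_linearEquiv {s₁ : G} {π₁ : Representation k (Subgroup.centralizer {s₁}) V'}
    [Nontrivial V] (e : Space π ≃ₗ[Double k G] Space π₁) : IsConj s₀ s₁ := by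
  obtain ⟨x, hx⟩ := exists_ne (0 : V)
  have h0 : supported π x ≠ 0 := fun h => hx (by
    rw [← supported_apply_one (π := π) x, h]; rfl)
  -- `δ_{s₀}` fixes this vector, but acts by zero on `Space π₁` unless `s₀` is conjugate to `s₁`.
  have h1 : (Double.basis 1 s₀ : Double k G) • supported π x = supported π x := by
    have := basis_smul_supported_of_mem (π := π) x 1
    rwa [map_one] at this
  have h2 : e (supported π x) ≠ 0 := fun h => h0 (e.map_eq_zero_iff.1 h)
  by_contra hc
  apply h2
  rw [← h1, map_smul]
  ext g
  rw [basis_smul_apply, if_neg]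
  · rfl
  · intro h
    apply hc
    rw [isConj_comm, isConj_iff]
    exact ⟨g⁻¹, by simpa using h⟩

end DoubleRep

/-- Irreducible representations of finite groups are finite-dimensional. -/
theorem Representation.IsIrreducible.finiteDimensional {k G V : Type*} [Field k] [Group G]
    [Finite G] [AddCommGroup V] [Module k V] (π : Representation k G V) [hπ : π.IsIrreducible] :
    FiniteDimensional k V := by
  have := Representation.IsIrreducible.nontrivial_space π
  obtain ⟨x, hx⟩ := exists_ne (0 : V)
  let σ : Subrepresentation π :=
    { toSubmodule := Submodule.span k (Set.range fun g => π g x)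
      apply_mem_toSubmodule := fun g y hy => by
        induction hy using Submodule.span_induction with
        | mem y hy =>
          obtain ⟨h, rfl⟩ := hy
          refine Submodule.subset_span ⟨g * h, ?_⟩
          simp only [map_mul, Module.End.mul_apply]
        | zero => rw [map_zero]; exact zero_mem _
        | add y z _ _ hy hz => rw [map_add]; exact add_mem hy hz
        | smul c y _ hy => rw [map_smul]; exact Submodule.smul_mem _ _ hy }
  have hx' : x ∈ σ := Submodule.subset_span ⟨1, by simp⟩
  have hσ : σ = ⊤ := (eq_bot_or_eq_top σ).resolve_left fun h => by
    rw [h] at hx'; exact hx hx'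
  refine ⟨⟨(Set.finite_range fun g => π g x).toFinset, ?_⟩⟩
  rw [Set.Finite.coe_toFinset]
  exact congrArg Subrepresentation.toSubmodule hσ

/-! ### Pairs as simple modules of the double. -/

namespace CentralizerPair

open Double (ofCodouble)

variable {k : Type u} {G : Type v} [Field k] [Group G] [Fintype G] [DecidableEq G]
  {base : ConjClasses G → G} (P : CentralizerPair k base)

instance : P.rep.IsIrreducible := P.irreducible

instance : FiniteDimensional k P.V := Representation.IsIrreducible.finiteDimensional P.rep

instance : Nontrivial P.V := Representation.IsIrreducible.nontrivial_space P.rep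

/-- The representation of the double attached to a pair is not the counit. -/
theorem exists_smul_ne_zero (hbase : ∀ C, ConjClasses.mk (base C) = C) :
    ∃ j ∈ RingHom.ker (Double.counit k G), ∃ f : DoubleRep.Space P.rep, j • f ≠ 0 := by
  by_contra! h
  -- For a nontrivial class, `δ_{s₀}` is in the augmentation ideal and fixes the functions supported
  -- on `G₀`.
  have hcls : P.cls = ConjClasses.mk 1 := by
    by_contra hc
    have h1 : base P.cls ≠ 1 := fun e => hc (by rw [← hbase P.cls, e])
    obtain ⟨x, hx⟩ := exists_ne (0 : P.V)
    have h0 := h (Double.basis 1 (base P.cls))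
      (by rw [RingHom.mem_ker, Double.counit_basis, if_neg h1]) (DoubleRep.supported P.rep x)
    have h2 := DoubleRep.basis_smul_supported_of_mem (π := P.rep) x 1
    rw [OneMemClass.coe_one, h0, map_one] at h2
    apply hx
    rw [← DoubleRep.supported_apply_one (π := P.rep) x]
    change (DoubleRep.supported P.rep ((1 : Module.End k P.V) x)).1 1 = 0
    rw [← h2]; rfl
  have h1 : base P.cls = 1 := by
    have := hbase P.cls
    rw [hcls, ConjClasses.mk_eq_mk_iff_isConj, isConj_one_left] at this
    rw [hcls, this]
  refine (P.nontrivial.resolve_left (not_not.2 hcls)) ⟨fun g => LinearMap.ext fun x => ?_⟩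
  have hm := DoubleRep.basis_smul_supported_of_mem (π := P.rep) x g
  have hm' := DoubleRep.basis_smul_supported_of_mem (π := P.rep) x 1
  -- For the trivial class, `(g - 1)·δ_1` has counit zero, so its vanishing on `W` makes `g` act
  -- trivially on `V`.
  have h0 := h (Double.basis (g : G) (base P.cls) - Double.basis 1 (base P.cls))
    (by rw [RingHom.mem_ker, map_sub, Double.counit_basis, Double.counit_basis, sub_self])
    (DoubleRep.supported P.rep x)
  rw [OneMemClass.coe_one] at hm'
  rw [sub_smul, sub_eq_zero, hm, hm', map_one] at h0
  have := congrArg (fun f => f.1 1) h0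
  simp only [DoubleRep.supported_apply_one] at this
  exact this

theorem isomorphic_iff (hbase : ∀ C, ConjClasses.mk (base C) = C) {P Q : CentralizerPair k base} :
    P.Isomorphic Q ↔
      Nonempty (DoubleRep.Space P.rep ≃ₗ[Double k G] DoubleRep.Space Q.rep) := by
  constructor
  · intro ⟨hcls, e, he⟩
    obtain ⟨cls, V, π, _, _⟩ := P
    obtain ⟨cls', V', π', _, _⟩ := Q
    dsimp only at hcls e he
    subst hcls
    let φ : π.IntertwiningMap π' := ⟨e.toLinearMap, fun g => LinearMap.ext fun x =>
      he g g.2 g.2 x⟩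
    refine ⟨LinearEquiv.ofBijective (DoubleRep.mapSpace φ) ⟨fun f f' h => ?_, fun f => ?_⟩⟩
    · ext g
      exact e.injective (congrFun (congrArg Subtype.val h) g)
    · refine ⟨⟨fun h => e.symm (f.1 h), fun g h => ?_⟩, ?_⟩
      · rw [LinearEquiv.symm_apply_eq]
        have h1 := he g g.2 g.2 (e.symm (f.1 h))
        rw [LinearEquiv.apply_symm_apply] at h1
        exact (DoubleRep.apply_mul f g h).trans h1.symm
      · ext h
        exact e.apply_symm_apply _
  · rintro ⟨e⟩
    have hc := DoubleRep.isConj_of_linearEquiv e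
    have hcls : P.cls = Q.cls := by
      rw [← hbase P.cls, ← hbase Q.cls, ConjClasses.mk_eq_mk_iff_isConj]
      exact hc
    refine ⟨hcls, ?_⟩
    obtain ⟨cls, V, π, _, _⟩ := P
    obtain ⟨cls', V', π', _, _⟩ := Q
    dsimp only at hcls e ⊢
    subst hcls
    obtain ⟨e', he'⟩ := DoubleRep.nonempty_equiv_of_linearEquiv e
    exact ⟨e', fun g _ hQ x => he' ⟨g, hQ⟩ x⟩

end CentralizerPair

/-! ### Simple modules of the double are induced from centralizers. -/

namespace DoubleRep

open Double (ofCodouble of)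

variable {k : Type u} {G : Type v} [Field k] [Group G] [Fintype G] [DecidableEq G]

/-- Every finite-dimensional simple module of the double on which `δ_{s₀}` does not vanish is
induced from an irreducible representation of the centralizer of `s₀`. -/
theorem exists_equiv_space {M : Type w} [AddCommGroup M] [Module k M] [Module (Double k G) M]
    [IsScalarTower k (Double k G) M] [IsSimpleModule (Double k G) M] [FiniteDimensional k M]
    (s₀ : G) (hs₀ : ∃ m : M, (Double.basis 1 s₀ : Double k G) • m ≠ 0) :
    ∃ (V : Type u) (_ : AddCommGroup V) (_ : Module k V)
      (π : Representation k (Subgroup.centralizer {s₀}) V),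
      π.IsIrreducible ∧ Nonempty (M ≃ₗ[Double k G] Space π) := by
  let δ : Double k G := Double.basis 1 s₀
  have hδδ : δ * δ = δ := by simp [δ, Double.basis_mul_basis]
  have hcomm : ∀ g : Subgroup.centralizer {s₀}, δ * of k (g : G) = of k (g : G) * δ := fun g => by
    have hg : (g : G)⁻¹ * s₀ * g = s₀ := by
      rw [mul_assoc, ← mem_centralizer.1 g.2]; group
    rw [Double.basis_mul_of, Double.of_mul_basis, one_mul, mul_one, hg]
  let V₀ : Submodule k M := LinearMap.eqLocus (Algebra.lsmul k k M δ) LinearMap.id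
  -- The representation sought is `V₀ = δ_{s₀}M`. It lives in the universe of `M`, so it is replaced
  -- by `kⁿ`, with inclusion `j` and an arbitrary linear retraction `r`, which is evaluated only on
  -- the image of `j`.
  let e₀ := (Module.finBasis k V₀).equivFun
  let j : (Fin (Module.finrank k V₀) → k) →ₗ[k] M := V₀.subtype ∘ₗ e₀.symm.toLinearMap
  have hj : LinearMap.ker j = ⊥ :=
    LinearMap.ker_eq_bot.2 (V₀.subtype_injective.comp e₀.symm.injective)
  obtain ⟨r, hr⟩ := j.exists_leftInverse_of_injective hj
  replace hr : ∀ x, r (j x) = x := LinearMap.congr_fun hr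
  have hδj : ∀ x, δ • j x = j x := fun x => (e₀.symm x).2
  have hjr : ∀ m, δ • m = m → j (r m) = m := fun m hm => by
    have : j (e₀ ⟨m, hm⟩) = m := by simp [j]
    rw [← this, hr]
  have hjr' : ∀ m, j (r (δ • m)) = δ • m := fun m => hjr _ (by rw [← mul_smul, hδδ])
  have hjg : ∀ (g : Subgroup.centralizer {s₀}) x, j (r (of k (g : G) • j x)) = of k (g : G) • j x :=
    fun g x => hjr _ (by rw [← mul_smul, hcomm, mul_smul, hδj])
  let π : Representation k (Subgroup.centralizer {s₀}) (Fin (Module.finrank k V₀) → k) :=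
    { toFun := fun g => r ∘ₗ Algebra.lsmul k k M (of k (g : G)) ∘ₗ j
      map_one' := LinearMap.ext fun x => by
        change r (of k (1 : G) • j x) = x
        rw [Double.of_one, one_smul, hr]
      map_mul' := fun g h => LinearMap.ext fun x => by
        change r (of k ((g : G) * h) • j x) = r (of k (g : G) • j (r (of k (h : G) • j x)))
        rw [hjg, ← mul_smul, Double.of_mul_of] }
  obtain ⟨m₀, hm₀⟩ := hs₀
  have hr₀ : r (δ • m₀) ≠ 0 := fun h => hm₀ (by
    have := hjr' m₀
    rw [h, map_zero] at this
    exact this.symm)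
  have hirr : π.IsIrreducible := by
    refine { exists_pair_ne := ⟨⊥, ⊤, fun e => hr₀ ?_⟩, eq_bot_or_eq_top := fun σ => ?_ }
    · have : r (δ • m₀) ∈ (⊥ : Subrepresentation π) := by
        rw [e]; exact Submodule.mem_top (R := k)
      exact this
    · by_cases h : ∃ x ∈ σ, x ≠ 0
      · right
        obtain ⟨x, hx, hx0⟩ := h
        have hjx : j x ≠ 0 := fun h0 => hx0 (by rw [← hr x, h0, map_zero])
        -- The corner `δ·D(G)·δ` is spanned by the `g·δ` with `g ∈ G₀`. As `j x` generates `M`, a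
        -- subrepresentation containing `x ≠ 0` is therefore everything.
        have key : ∀ a : Double k G, r (δ • a • j x) ∈ σ := by
          intro a
          induction a using Double.induction_basis with
          | zero => simp only [zero_smul, smul_zero, map_zero]; exact zero_mem σ.toSubmodule
          | add a b ha hb =>
            rw [add_smul, smul_add, map_add]; exact add_mem (S := Submodule k _) ha hb
          | smul c a ha =>
            rw [smul_assoc, smul_comm, map_smul]; exact σ.toSubmodule.smul_mem c ha
          | basis s u =>
            have h1 : Double.basis s u * δ = if u = s₀ then Double.basis s u else 0 :=
              Double.basis_mul_basis_one _ _ _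
            have h2 : δ * Double.basis s s₀ =
                if s₀ = s * s₀ * s⁻¹ then Double.basis s s₀ else 0 :=
              Double.basis_one_mul_basis _ _ _
            rw [← hδj x, ← mul_smul, ← mul_smul, mul_assoc, h1]
            by_cases hu : u = s₀
            · rw [if_pos hu, hu, h2]
              split_ifs with hs
              · have hs' : s ∈ Subgroup.centralizer {s₀} := by
                  rw [mem_centralizer]
                  nth_rw 2 [hs]; group
                rw [← Double.of_mul_basis_one, mul_smul]
                change r (of k s • δ • j x) ∈ σ
                rw [hδj]
                exact σ.apply_mem_toSubmodule ⟨s, hs'⟩ hx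
              · rw [zero_smul, map_zero]; exact zero_mem σ.toSubmodule
            · rw [if_neg hu, mul_zero, zero_smul, map_zero]; exact zero_mem σ.toSubmodule
        refine SetLike.ext fun y => ⟨fun _ => Submodule.mem_top (R := k), fun _ => ?_⟩
        obtain ⟨a, ha⟩ := IsSimpleModule.toSpanSingleton_surjective (Double k G) hjx (j y)
        rw [LinearMap.toSpanSingleton_apply] at ha
        have := key a
        rwa [ha, hδj, hr] at this
      · left
        push Not at h
        refine SetLike.ext fun y => ⟨fun hy => h y hy, fun hy => ?_⟩
        have : y = 0 := hy
        rw [this]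
        exact zero_mem σ.toSubmodule
  refine ⟨_, inferInstance, inferInstance, π, hirr, ?_⟩
  -- Frobenius reciprocity: `m` goes to the function `h ↦ δ·h·m`. It is nonzero, hence bijective by
  -- Schur's lemma.
  · let Θ₀ : M →ₗ[k] Space π :=
      { toFun := fun m => ⟨fun h => r (δ • of k h • m), fun g h => by
          change r (δ • of k ((g : G) * h) • m) = r (of k (g : G) • j (r (δ • of k h • m)))
          rw [hjr', ← Double.of_mul_of, mul_smul, ← mul_smul δ, hcomm, mul_smul]⟩
        map_add' := fun m m' => by ext1; funext h; simp
        map_smul' := fun c m => by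
          ext1; funext h
          simp only [RingHom.id_apply, Submodule.coe_smul, Pi.smul_apply, ← map_smul]
          rw [smul_comm (of k h) c m, smul_comm δ c] }
    have hΘ₀ : ∀ m h, (Θ₀ m).1 h = r (δ • of k h • m) := fun m h => rfl
    let Θ : M →ₗ[Double k G] Space π :=
      { toFun := Θ₀
        map_add' := map_add Θ₀
        map_smul' := fun a m => by
          rw [RingHom.id_apply]
          induction a using Double.induction_basis with
          | zero => simp
          | add a b ha hb => rw [add_smul, add_smul, map_add, ha, hb]
          | smul c a ha => rw [smul_assoc, smul_assoc, map_smul, ha]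
          | basis s u =>
            ext1; funext h
            rw [basis_smul_apply, hΘ₀, hΘ₀, ← mul_smul (of k h), Double.of_mul_basis, ← mul_smul,
              ← mul_smul, Double.basis_one_mul_basis, Double.basis_mul_of, one_mul]
            have e1 : s₀ = h * s * u * (h * s)⁻¹ ↔ u = (h * s)⁻¹ * s₀ * (h * s) := by
              constructor
              · intro e; rw [e]; group
              · intro e; rw [e]; group
            have e2 : h⁻¹ * s₀ * h = s * u * s⁻¹ ↔ u = (h * s)⁻¹ * s₀ * (h * s) := by
              constructor
              · intro e
                calc u = s⁻¹ * (s * u * s⁻¹) * s := by group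
                  _ = _ := by rw [← e]; group
              · intro e; rw [e]; group
            by_cases hu : u = (h * s)⁻¹ * s₀ * (h * s)
            · rw [if_pos (e1.2 hu), if_pos (e2.2 hu), ← hu]
            · rw [if_neg (mt e1.1 hu), if_neg (mt e2.1 hu), zero_smul, map_zero] }
    have hΘ : Θ ≠ 0 := fun h0 => hr₀ (by
      have : (Θ m₀).1 1 = 0 := by rw [h0]; rfl
      rw [← this]
      change _ = r (δ • of k 1 • m₀)
      rw [Double.of_one, one_smul])
    exact ⟨LinearEquiv.ofBijective Θ (LinearMap.bijective_of_ne_zero hΘ)⟩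

end DoubleRep

/-! ### The integral and the trivial representation. -/

namespace Double

variable {k : Type u} {G : Type v} [Field k] [Group G] [Fintype G] [DecidableEq G]

instance : FiniteDimensional k (Double k G) :=
  Module.Finite.equiv (ofCodouble : Codouble k G ≃ₗ[k] Double k G)

theorem counit_sub_smul_one (a : Codouble k G) :
    counit k G (ofCodouble a - (Coalgebra.counit a : k) • 1) = 0 := by
  rw [map_sub, map_smul, map_one, counit_ofCodouble, smul_eq_mul, mul_one, sub_self]

/-- The normalized integral of the double. -/
theorem exists_integral [CharZero k] :
    ∃ e : Double k G, counit k G e = 1 ∧ ∀ a, a * e = counit k G a • e := by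
  -- The integral is `∑ g·δ_1`, of counit `|G|`; normalizing it requires `|G|` to be invertible.
  have hc : (Fintype.card G : k) ≠ 0 := Nat.cast_ne_zero.2 Fintype.card_ne_zero
  have key : ∀ a : Double k G, a * ∑ g, basis g 1 = counit k G a • ∑ g, basis g 1 := by
    intro a
    induction a using induction_basis with
    | zero => simp
    | add a b ha hb => rw [add_mul, ha, hb, map_add, add_smul]
    | smul c a ha => rw [smul_mul_assoc, ha, map_smul, smul_assoc]
    | basis s u =>
      simp only [Finset.mul_sum, basis_mul_basis, counit_basis, mul_one, mul_inv_cancel]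
      split_ifs with hu
      · rw [one_smul]
        exact Fintype.sum_equiv (Equiv.mulLeft s) _ _ fun g => rfl
      · simp
  refine ⟨(Fintype.card G : k)⁻¹ • ∑ g, basis g 1, ?_, fun a => ?_⟩
  · simp [counit_basis, hc]
  · rw [mul_smul_comm, key, smul_comm]

end Double

namespace DoubleRep

variable {k : Type u} {G : Type v} [Field k] [Group G] [Fintype G] [DecidableEq G]

/-- For the excluded pair the centralizer is all of `G` and acts trivially, so `W` consists of
constant functions. -/
theorem smul_eq_counit_smul {s₀ : G} {V : Type u} [AddCommGroup V] [Module k V]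
    (π : Representation k (Subgroup.centralizer {s₀}) V) [π.IsTrivial] (hs₀ : s₀ = 1)
    (a : Double k G) (f : Space π) : a • f = Double.counit k G a • f := by
  subst hs₀
  have hf : ∀ h, f.1 h = f.1 1 := fun h => by
    have := apply_mul f ⟨h, mem_centralizer.2 (by simp)⟩ 1
    rw [Representation.isTrivial_apply] at this
    simpa using this
  induction a using Double.induction_basis with
  | zero => simp
  | add a b ha hb => rw [add_smul, ha, hb, map_add, add_smul]
  | smul c a ha => rw [smul_assoc, ha, map_smul, smul_assoc]
  | basis s u =>
    ext h
    have e : h⁻¹ * 1 * h = s * u * s⁻¹ ↔ u = 1 := by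
      rw [mul_one, inv_mul_cancel, eq_comm, conj_eq_one_iff]
    rw [basis_smul_apply, Double.counit_basis, hf]
    simp only [e]
    split_ifs
    · rw [one_smul, hf h]
    · rw [zero_smul]; rfl

end DoubleRep

/-! ### Calculi attached to pairs -/

namespace CentralizerPair

open Double (ofCodouble of)

variable {k : Type u} {G : Type v} [Field k] [Group G] [Fintype G] [DecidableEq G]
  {base : ConjClasses G → G} (P : CentralizerPair k base)

/-- The ideal of the double of elements acting by zero both on `W` and under the counit. -/
noncomputable def ideal : Ideal (Double k G) :=
  RingHom.ker (DoubleRep.killingHom P.rep) ⊓ RingHom.ker (Double.counit k G)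

theorem mem_ideal {b : Double k G} : b ∈ P.ideal ↔
    (∀ f : DoubleRep.Space P.rep, b • f = 0) ∧ Double.counit k G b = 0 :=
  and_congr LinearMap.ext_iff Iff.rfl

instance : P.ideal.IsTwoSided := ⟨fun c hb =>
  ⟨(RingHom.ker _).mul_mem_right c hb.1, (RingHom.ker _).mul_mem_right c hb.2⟩⟩

theorem killing_eq_iff (a : Codouble k G) :
    DoubleRep.killing P.rep a = (Coalgebra.counit a : k) • 1 ↔
      ofCodouble a - (Coalgebra.counit a : k) • 1 ∈ P.ideal := by
  have h1 : ofCodouble a - (Coalgebra.counit a : k) • 1 ∈ RingHom.ker (Double.counit k G) :=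
    Double.counit_sub_smul_one a
  rw [ideal, Ideal.mem_inf, and_iff_left h1, RingHom.mem_ker, map_sub, map_smul, map_one,
    DoubleRep.killingHom_ofCodouble, sub_eq_zero]

/-- Both conditions on `a` depend only on `a - ε(a)·1`, which runs over the augmentation ideal. -/
theorem attachedTo_iff (Ω : BicovariantCalculus k (Codouble k G)) :
    Ω.AttachedTo P ↔ Ω.ideal = P.ideal := by
  simp only [BicovariantCalculus.AttachedTo, killing_eq_iff, Ω.maurerCartan_eq_zero_iff]
  refine ⟨fun h => Ideal.ext fun b => ?_, fun h a => by rw [h]⟩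
  by_cases hb : Double.counit k G b = 0
  · have := h (ofCodouble.symm b)
    rwa [← Double.counit_ofCodouble, LinearEquiv.apply_symm_apply, hb, zero_smul, sub_zero] at this
  · exact iff_of_false (fun h => hb (Ω.mem_ideal.1 h).2) fun h => hb (P.mem_ideal.1 h).2

/-- The ideal determines `W` because `ker ε` acts nontrivially on it; `W` in turn determines the
pair. -/
theorem ideal_eq_iff (hbase : ∀ C, ConjClasses.mk (base C) = C) (P P' : CentralizerPair k base) :
    P.ideal = P'.ideal ↔ P.Isomorphic P' := by
  rw [isomorphic_iff hbase]
  constructor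
  · intro h
    refine IsSimpleModule.nonempty_linearEquiv k (RingHom.ker (Double.counit k G))
      (P'.exists_smul_ne_zero hbase) fun j hj hjP => ?_
    have : j ∈ P.ideal := P.mem_ideal.2 ⟨hjP, hj⟩
    rw [h] at this
    exact (P'.mem_ideal.1 this).1
  · rintro ⟨e⟩
    refine Ideal.ext fun b => ?_
    rw [mem_ideal, mem_ideal]
    refine and_congr_left fun _ => ⟨fun h f => ?_, fun h f => ?_⟩
    · rw [← e.apply_symm_apply f, ← map_smul, h, map_zero]
    · rw [← e.symm_apply_apply f, ← map_smul, h, map_zero]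

end CentralizerPair

namespace BicovariantCalculus

open Double (ofCodouble of)

variable {k : Type u} {G : Type v} [Field k] [Group G] [Fintype G] [DecidableEq G]
  {base : ConjClasses G → G} {Ω Ω' : BicovariantCalculus k (Codouble k G)}

theorem subsingleton_form_iff_le_ideal :
    Subsingleton Ω.Form ↔ RingHom.ker (Double.counit k G) ≤ Ω.ideal := by
  rw [subsingleton_form_iff]
  constructor
  · intro h b hb
    refine Ω.mem_ideal.2 ⟨?_, hb⟩
    rw [← LinearMap.mem_ker, h]
    trivial
  · intro h
    refine eq_top_iff.2 fun a _ => ?_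
    rw [LinearMap.mem_ker, maurerCartan_eq_zero_iff]
    exact h (Double.counit_sub_smul_one a)

theorem isomorphic_iff_ideal_eq : Ω.Isomorphic Ω' ↔ Ω.ideal = Ω'.ideal := by
  rw [isomorphic_iff, le_antisymm_iff, ker_maurerCartan_le_iff, ker_maurerCartan_le_iff,
    ← le_antisymm_iff]

/-- Let `J` be the ideal of a quotient. If `J` acts nontrivially on `W`, every `b ∈ ker ε` acts as
some `j ∈ J`, and `b - j ∈ Ann(W) ∩ ker ε ≤ J`, so `J = ker ε` and the quotient is zero. Otherwise
`J ≤ Ann(W) ∩ ker ε`, and the quotient map is bijective. -/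
theorem AttachedTo.coirreducible (hbase : ∀ C, ConjClasses.mk (base C) = C)
    {P : CentralizerPair k base} (h : Ω.AttachedTo P) : Ω.Coirreducible := by
  rw [P.attachedTo_iff] at h
  have hP := P.exists_smul_ne_zero hbase
  refine ⟨?_, fun Ω' f => ?_⟩
  · rw [← not_subsingleton_iff_nontrivial, subsingleton_form_iff_le_ideal, h]
    obtain ⟨j, hj, x, hx⟩ := hP
    exact fun hle => hx ((P.mem_ideal.1 (hle hj)).1 x)
  · have hle : Ω.ideal ≤ Ω'.ideal := ker_maurerCartan_le_iff.1 (nonempty_hom_iff.1 ⟨f⟩)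
    by_cases hj : ∃ j ∈ Ω'.ideal, ∃ x : DoubleRep.Space P.rep, j • x ≠ 0
    · left
      refine subsingleton_form_iff_le_ideal.2 fun b hb => ?_
      obtain ⟨j, hj, hjb⟩ := IsSimpleModule.exists_mem_smul_eq k Ω'.ideal hj b
      have hbj : b - j ∈ P.ideal := P.mem_ideal.2 ⟨fun x => by rw [sub_smul, hjb, sub_self], by
        rw [map_sub, (Ω'.mem_ideal.1 hj).2, sub_zero]; exact hb⟩
      rw [← h] at hbj
      simpa using add_mem (hle hbj) hj
    · right
      push Not at hj
      refine f.bijective_of_ker_le (ker_maurerCartan_le_iff.2 fun b hb => ?_)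
      rw [h]
      exact P.mem_ideal.2 ⟨hj b hb, (Ω'.mem_ideal.1 hb).2⟩

theorem exists_attachedTo (P : CentralizerPair k base) :
    ∃ Ω : BicovariantCalculus k (Codouble k G), Ω.AttachedTo P := by
  obtain ⟨Ω, hΩ⟩ := exists_ideal_eq P.ideal fun b hb => (P.mem_ideal.1 hb).2
  exact ⟨Ω, (P.attachedTo_iff Ω).2 hΩ⟩

/-- Every nonzero calculus has the calculus attached to some pair as a quotient. -/
theorem exists_ideal_le [CharZero k] (hbase : ∀ C, ConjClasses.mk (base C) = C)
    (hΩ : Nontrivial Ω.Form) : ∃ P : CentralizerPair k base, Ω.ideal ≤ P.ideal := by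
  obtain ⟨e, he, hmul⟩ := Double.exists_integral (k := k) (G := G)
  -- If `1 = j + a·e`, the counit gives `ε(a) = 1`, so `1 = j + e`. Then `b = b·j` for `b ∈ ker ε`,
  -- whence `ker ε` lies in the ideal and the calculus is zero.
  have hne : Ω.ideal ⊔ Ideal.span {e} ≠ ⊤ := by
    intro htop
    rw [Ideal.eq_top_iff_one, Submodule.mem_sup] at htop
    obtain ⟨j, hj, x, hx, hjx⟩ := htop
    obtain ⟨a, rfl⟩ := Ideal.mem_span_singleton'.1 hx
    have hc := congrArg (Double.counit k G) hjx
    rw [map_add, map_mul, (Ω.mem_ideal.1 hj).2, he, zero_add, mul_one, map_one] at hc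
    rw [hmul, hc, one_smul] at hjx
    rw [← not_subsingleton_iff_nontrivial, subsingleton_form_iff_le_ideal] at hΩ
    refine hΩ fun b hb => ?_
    have : b = b * j := by
      rw [eq_sub_of_add_eq hjx, mul_sub, hmul, RingHom.mem_ker.1 hb, zero_smul, sub_zero, mul_one]
    rw [this]
    exact Ω.ideal.mul_mem_left b hj
  -- The quotient by a maximal left ideal is simple. The two-sided ideal kills all of it; `e` kills
  -- the generator `m`, which excludes the counit representation.
  obtain ⟨L, hL, hle⟩ := Ideal.exists_le_maximal _ hne
  have hsimple : IsSimpleModule (Double k G) (Double k G ⧸ L) := isSimpleModule_iff_isCoatom.2 hL.out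
  have hfin : FiniteDimensional k (Double k G ⧸ L) :=
    Module.Finite.of_surjective (L.mkQ.restrictScalars k) L.mkQ_surjective
  let m : Double k G ⧸ L := Submodule.Quotient.mk 1
  have hm : m ≠ 0 := fun h => hL.ne_top
    ((Ideal.eq_top_iff_one _).2 ((Submodule.Quotient.mk_eq_zero L).1 h))
  have hem : e • m = 0 := by
    change Submodule.Quotient.mk (e • 1) = (0 : Double k G ⧸ L)
    rw [Submodule.Quotient.mk_eq_zero, smul_eq_mul, mul_one]
    exact hle (le_sup_right (a := Ω.ideal) (Ideal.mem_span_singleton_self e))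
  have hann : ∀ b ∈ Ω.ideal, ∀ x : Double k G ⧸ L, b • x = 0 := by
    intro b hb x
    obtain ⟨a, rfl⟩ := Submodule.Quotient.mk_surjective L x
    rw [← Submodule.Quotient.mk_smul, Submodule.Quotient.mk_eq_zero]
    exact hle (le_sup_left (a := Ω.ideal) (Ω.ideal.mul_mem_right a hb))
  obtain ⟨u, hu⟩ : ∃ u : G, (Double.basis 1 u : Double k G) • m ≠ 0 := by
    by_contra! h
    apply hm
    rw [← one_smul (Double k G) m, Double.one_eq, Finset.sum_smul]
    exact Finset.sum_eq_zero fun u _ => h u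
  have hconj : IsConj u (base (ConjClasses.mk u)) := by
    rw [← ConjClasses.mk_eq_mk_iff_isConj, hbase]
  -- Some `δ_u` does not kill `m`; translation by `c` replaces `u` by the chosen point of its class.
  obtain ⟨c, hc⟩ := isConj_iff.1 hconj
  have hcm : (Double.basis 1 (base (ConjClasses.mk u)) : Double k G) • of k c • m =
      of k c • (Double.basis 1 u : Double k G) • m := by
    rw [← mul_smul, ← mul_smul, ← hc, Double.basis_one_mul_of, Double.of_mul_basis_one]
  obtain ⟨V, _, _, π, hπ, ⟨φ⟩⟩ := DoubleRep.exists_equiv_space (k := k)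
    (M := Double k G ⧸ L) (base (ConjClasses.mk u)) ⟨of k c • m, fun h => hu (by
      rw [hcm] at h
      have := congrArg (of k c⁻¹ • ·) h
      simpa only [← mul_smul, Double.of_mul_of, inv_mul_cancel, Double.of_one, one_mul,
        smul_zero, ← mul_assoc] using this)⟩
  refine ⟨⟨ConjClasses.mk u, V, π, hπ, ?_⟩, fun b hb => ?_⟩
  -- For the trivial pair `e` would act as `ε(e) = 1`, contradicting `e·m = 0`.
  · by_contra! h
    have := h.2
    have hb : base (ConjClasses.mk u) = 1 := by
      have := hbase (ConjClasses.mk u)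
      rwa [h.1, ConjClasses.mk_eq_mk_iff_isConj, isConj_one_left, ← h.1] at this
    have h1 := DoubleRep.smul_eq_counit_smul π hb e (φ m)
    rw [← map_smul, hem, map_zero, he, one_smul] at h1
    exact hm (φ.map_eq_zero_iff.1 h1.symm)
  · have hW : ∀ f : DoubleRep.Space π, b • f = 0 := fun f => by
      rw [← φ.apply_symm_apply f, ← map_smul, hann b hb, map_zero]
    exact (CentralizerPair.mem_ideal _).2 ⟨hW, (Ω.mem_ideal.1 hb).2⟩

/-- The calculus attached to a suitable pair is a nonzero quotient, so coirreducibility makes it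
isomorphic to `Ω`. -/
theorem Coirreducible.exists_attachedTo [CharZero k] (hbase : ∀ C, ConjClasses.mk (base C) = C)
    (hΩ : Ω.Coirreducible) : ∃ P : CentralizerPair k base, Ω.AttachedTo P := by
  obtain ⟨P, hP⟩ := exists_ideal_le hbase hΩ.1
  obtain ⟨Ω', hΩ'⟩ := BicovariantCalculus.exists_attachedTo P
  have hid := (P.attachedTo_iff Ω').1 hΩ'
  obtain ⟨f⟩ := nonempty_hom_iff.2 (ker_maurerCartan_le_iff.2 (hP.trans hid.ge))
  have hf := (hΩ.2 Ω' f).resolve_left (not_subsingleton_iff_nontrivial.2 (hΩ'.coirreducible hbase).1)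
  exact ⟨P, (P.attachedTo_iff Ω).2 ((isomorphic_iff_ideal_eq.1 ⟨f, hf⟩).trans hid)⟩

/-- If the kernel of the Maurer-Cartan form is the annihilator, up to the counit, of a simple
module of the double, the right-invariant forms have the dimension of the image of the double. -/
theorem finrank_rightInvariant_eq {W : Type*} [AddCommGroup W] [Module k W]
    [Module (Double k G) W] [IsScalarTower k (Double k G) W] [IsSimpleModule (Double k G) W]
    [FiniteDimensional k W]
    (h : ∀ a, Ω.maurerCartan a = 0 ↔
      ∀ w : W, (ofCodouble a - (Coalgebra.counit a : k) • 1) • w = 0)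
    (hW : ∃ j ∈ RingHom.ker (Double.counit k G), ∃ w : W, j • w ≠ 0) :
    Module.finrank k Ω.rightInvariant =
      Module.finrank k (LinearMap.range (Algebra.lsmul k k W (A := Double k G)).toLinearMap) := by
  -- `a ↦ ρ(a - ε(a)·1)` has the kernel of `ϖ`, hence its rank. Its image is `ρ(ker ε)`, which is
  -- `ρ(D(G))` because `ker ε` acts nontrivially on the simple module.
  let F : Codouble k G →ₗ[k] Module.End k W := (Algebra.lsmul k k W).toLinearMap ∘ₗ
    (ofCodouble.toLinearMap - (Coalgebra.counit (R := k) (A := Codouble k G)).smulRight 1)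
  have hF : ∀ a w, F a w = (ofCodouble a - (Coalgebra.counit a : k) • 1) • w := fun a w => rfl
  have hker : LinearMap.ker F = LinearMap.ker Ω.maurerCartan := by
    ext a
    rw [LinearMap.mem_ker, LinearMap.mem_ker, h a, LinearMap.ext_iff]
    rfl
  have hrange : LinearMap.range F =
      LinearMap.range (Algebra.lsmul k k W (A := Double k G)).toLinearMap := by
    apply le_antisymm
    · rintro _ ⟨a, rfl⟩
      exact ⟨_, rfl⟩
    · rintro _ ⟨a, rfl⟩
      obtain ⟨j, hj, hja⟩ := IsSimpleModule.exists_mem_smul_eq k _ hW a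
      refine ⟨ofCodouble.symm j, LinearMap.ext fun w => ?_⟩
      rw [hF, ← Double.counit_ofCodouble, LinearEquiv.apply_symm_apply, RingHom.mem_ker.1 hj,
        zero_smul, sub_zero]
      exact hja w
  have e1 := LinearMap.finrank_range_add_finrank_ker F
  have e2 := LinearMap.finrank_range_add_finrank_ker Ω.maurerCartan
  rw [hker, hrange] at e1
  rw [range_maurerCartan] at e2
  omega

theorem AttachedTo.finrank_rightInvariant_mul (hbase : ∀ C, ConjClasses.mk (base C) = C)
    {P : CentralizerPair k base} (h : Ω.AttachedTo P) :
    Module.finrank k Ω.rightInvariant *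
        Module.finrank k (Representation.IntertwiningMap P.rep P.rep) =
      P.cls.carrier.ncard ^ 2 * Module.finrank k P.V ^ 2 := by
  have hmC : ∀ a, Ω.maurerCartan a = 0 ↔ ∀ f : DoubleRep.Space P.rep,
      (ofCodouble a - (Coalgebra.counit a : k) • 1) • f = 0 := fun a => by
    rw [h a, P.killing_eq_iff, P.mem_ideal, and_iff_left (Double.counit_sub_smul_one a)]
  rw [finrank_rightInvariant_eq hmC (P.exists_smul_ne_zero hbase),
    (DoubleRep.mapSpaceEquiv P.rep P.rep).finrank_eq,
    IsSimpleModule.finrank_range_lsmul_mul, DoubleRep.finrank_space, hbase, mul_pow]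

end BicovariantCalculus

theorem theorem5p1 {k : Type u} {G : Type v} [Field k] [CharZero k]
    [Group G] [Fintype G] [DecidableEq G]
    (base : ConjClasses G → G) (hbase : ∀ C, ConjClasses.mk (base C) = C) :
    (∀ P : CentralizerPair k base,
      ∃ Ω : BicovariantCalculus k (Codouble k G), Ω.Coirreducible ∧ Ω.AttachedTo P) ∧
    (∀ Ω : BicovariantCalculus k (Codouble k G), Ω.Coirreducible →
      ∃ P : CentralizerPair k base, Ω.AttachedTo P) ∧
    (∀ (P P' : CentralizerPair k base) (Ω Ω' : BicovariantCalculus k (Codouble k G)),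
      Ω.AttachedTo P → Ω'.AttachedTo P' → (Ω.Isomorphic Ω' ↔ P.Isomorphic P')) ∧
    (∀ (P : CentralizerPair k base) (Ω : BicovariantCalculus k (Codouble k G)),
      Ω.AttachedTo P →
        Module.finrank k Ω.leftInvariant = Module.finrank k Ω.rightInvariant ∧
        Module.finrank k Ω.rightInvariant *
            Module.finrank k (Representation.IntertwiningMap P.rep P.rep) =
          P.cls.carrier.ncard ^ 2 * Module.finrank k P.V ^ 2 ∧
        (Module.finrank k (Representation.IntertwiningMap P.rep P.rep) = 1 →
          Module.finrank k Ω.rightInvariant =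
            P.cls.carrier.ncard ^ 2 * Module.finrank k P.V ^ 2) ∧
        (IsAlgClosed k →
          Module.finrank k Ω.rightInvariant =
            P.cls.carrier.ncard ^ 2 * Module.finrank k P.V ^ 2)) := by
  refine ⟨fun P => ?_, fun Ω hΩ => hΩ.exists_attachedTo hbase, fun P P' Ω Ω' h h' => ?_,
    fun P Ω h => ?_⟩
  · obtain ⟨Ω, hΩ⟩ := BicovariantCalculus.exists_attachedTo P
    exact ⟨Ω, hΩ.coirreducible hbase, hΩ⟩
  · rw [BicovariantCalculus.isomorphic_iff_ideal_eq, (P.attachedTo_iff Ω).1 h,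
      (P'.attachedTo_iff Ω').1 h', CentralizerPair.ideal_eq_iff hbase]
  · have hmul := h.finrank_rightInvariant_mul hbase
    refine ⟨Ω.finrank_leftInvariant, hmul, fun h1 => ?_, fun _ => ?_⟩
    · rwa [h1, mul_one] at hmul
    -- Schur's lemma over an algebraically closed field.
    · rwa [Representation.IsIrreducible.finrank_intertwiningMap_self, mul_one] at hmul
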